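/- Let $\Omega=(-1,1)$, $\Omega_1=(-1,0)$, $\Omega_2=(0,1)$, $T>0$ and $q,\rho_o,\rho_w,g\in\mathbb R$. For $i=1,2$ let $\phi_i\in(0,1)$, and let $\pi_i,\mu_{o,i},\mu_{w,i}:[0,1]\to\mathbb R$ be Lipschitz continuous, $\pi_i$ and $\mu_{o,i}$ strictly increasing, $\mu_{w,i}$ strictly decreasing, $\mu_{o,i}(0)=0=\mu_{w,i}(1)$. Put $$\lambda_i=\frac{\mu_{o,i}\,\mu_{w,i}}{\mu_{o,i}+\mu_{w,i}},\qquad f_i=\frac{\mu_{o,i}}{\mu_{o,i}+\mu_{w,i}}\,q+\lambda_i\,(\rho_o-\rho_w)\,g,\qquad \varphi_i(s)=\int_0^s\lambda_i(a)\,\pi_i'(a)\,da ,$$ and let $\tilde\pi_i$ be the graph $\tilde\pi_i(s)=\{\pi_i(s)\}$ for $0<s<1$, $\tilde\pi_i(0)=(-\infty,\pi_i(0)]$, $\tilde\pi_i(1)=[\pi_i(1),+\infty)$. Let $G_i:[0,1]^2\to\mathbb R$ be Lipschitz continuous, non-decreasing in its first and non-increasing in its second argument, with $G_i(a,a)=f_i(a)$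 for all $a\in[0,1]$. Let $u_0\in L^\infty(\Omega)$ and $\underline u,\overline u\in L^\infty(0,T)$ take values in $[0,1]$ a.e. **Weak solutions.** A weak solution is a function $u\in L^\infty(\Omega\times(0,T))$ with $0\le u\le1$ a.e. such that $\varphi_i(u)\in L^2(0,T;H^1(\Omega_i))$ for $i=1,2$; such that, $u_i$ denoting the trace of $u_{|\Omega_i}$ on $\{x=0\}$, $\tilde\pi_1(u_1(t))\cap\tilde\pi_2(u_2(t))\ne\emptyset$ for a.e. $t\in(0,T)$; and such that, $u(\pm1,\cdot)$ denoting the traces of $u$ at $x=\pm1$, for all $\psi\in C_c^\infty(\overline\Omega\times[0,T))$, $$\int_0^T\sum_{i=1,2}\int_{\Omega_i}\phi_i u\,\partial_t\psi\,dx\,dt+\sum_{i=1,2}\int_{\Omega_i}\phi_i u_0\,\psi(x,0)\,dx+\int_0^T\sum_{i=1,2}\int_{\Omega_i}\big[f_i(u)-\partial_x\varphi_i(u)\big]\partial_x\psi\,dx\,dt$$ $$+\int_0^T G_1(\underline u(t),u(-1,t))\,\psi(-1,t)\,dt-\int_0^T G_2(u(1,t),\overline u(t))\,\psi(1,t)\,dt=0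 .$$ **Scheme.** For positive integers $N,M$ put $\delta x=1/N$, $\delta t=T/M$, $x_j=j\,\delta x$, $t^n=n\,\delta t$, and let $u^0_{j+1/2}$ be the mean of $u_0$ on $(x_j,x_{j+1})$, and $\underline u^{n+1},\overline u^{n+1}$ the means of $\underline u,\overline u$ on $(t^n,t^{n+1})$. The unknowns $u^{n+1}_{j+1/2}$ and $u^{n+1}_{0,1},u^{n+1}_{0,2}$, all in $[0,1]$, satisfy for $-N\le j\le N-1$ and $0\le n\le M-1$ $$\phi_i\,\frac{u^{n+1}_{j+1/2}-u^n_{j+1/2}}{\delta t}\,\delta x+F^{n+1}_{j+1}-F^{n+1}_j=0,\qquad (x_j,x_{j+1})\subset\Omega_i,$$ where, for $j\notin\{-N,0,N\}$ and $i=1$ if $j<0$, $i=2$ if $j>0$, $$F_j^{n+1}=G_i(u^{n+1}_{j-1/2},u^{n+1}_{j+1/2})-\frac{\varphi_i(u^{n+1}_{j+1/2})-\varphi_i(u^{n+1}_{j-1/2})}{\delta x},$$ $$F_{-N}^{n+1}=G_1(\underline u^{n+1},u^{n+1}_{-N+1/2}),\qquad F_N^{n+1}=G_2(u^{n+1}_{N-1/2},\overline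 u^{n+1}),$$ $$F_0^{n+1}=G_1(u^{n+1}_{-1/2},u^{n+1}_{0,1})-\frac{2\big(\varphi_1(u^{n+1}_{0,1})-\varphi_1(u^{n+1}_{-1/2})\big)}{\delta x}=G_2(u^{n+1}_{0,2},u^{n+1}_{1/2})-\frac{2\big(\varphi_2(u^{n+1}_{1/2})-\varphi_2(u^{n+1}_{0,2})\big)}{\delta x},$$ $$\tilde\pi_1(u^{n+1}_{0,1})\cap\tilde\pi_2(u^{n+1}_{0,2})\ne\emptyset .$$ The associated discrete solution equals $u^{n+1}_{j+1/2}$ on $(x_j,x_{j+1})\times(t^n,t^{n+1}]$ and $u^0_{j+1/2}$ on $(x_j,x_{j+1})\times\{0\}$. **Theorem.** Let $(M_p)_{p\in\mathbb N}$ and $(N_p)_{p\in\mathbb N}$ be sequences of positive integers tending to $+\infty$. For every $p$ the scheme with $N=N_p$, $M=M_p$ has a discrete solution. For any sequence $(u_{\mathcal D_p})_p$ of corresponding discrete solutions there are a subsequence and a weak solution $u$ such that, along this subsequence, $u_{\mathcal D_p}\to u$ in $L^r(\Omega\times(0,T))$ for all $r\in[1,\infty)$. In particular $u$ satisfies the transmission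 condition $\tilde\pi_1(u_1)\cap\tilde\pi_2(u_2)\neq\emptyset$ a.e. in $(0,T)$ and, in the weak sense above, the boundary conditions. -/

import Mathlib

open MeasureTheory Set Filter Topology
open scoped ContDiff NNReal ENNReal

noncomputable section

namespace TwoPhase

/-- A function is Lipschitz continuous on the set `s`. -/
def IsLipschitzOn {E : Type*} [PseudoEMetricSpace E] (f : E → ℝ) (s : Set E) : Prop :=
  ∃ K : ℝ≥0, LipschitzOnWith K f s

/-- Data of one homogeneous layer. The functions of the saturation are used on `[0,1]` only. -/
structure Layer where
  /-- porosity -/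
  poro : ℝ
  /-- capillary pressure -/
  pc : ℝ → ℝ
  /-- oil mobility -/
  muo : ℝ → ℝ
  /-- water mobility -/
  muw : ℝ → ℝ
  /-- numerical (and boundary) convection flux -/
  G : ℝ → ℝ → ℝ

/-- Standing assumptions on the porosity, the capillary pressure and the mobilities of a layer. -/
structure Layer.Admissible (L : Layer) : Prop where
  poro_mem : L.poro ∈ Ioo (0 : ℝ) 1
  pc_strictMono : StrictMonoOn L.pc (Icc 0 1)
  pc_lip : IsLipschitzOn L.pc (Icc 0 1)
  muo_strictMono : StrictMonoOn L.muo (Icc 0 1)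
  muo_lip : IsLipschitzOn L.muo (Icc 0 1)
  muo_zero : L.muo 0 = 0
  muw_strictAnti : StrictAntiOn L.muw (Icc 0 1)
  muw_lip : IsLipschitzOn L.muw (Icc 0 1)
  muw_one : L.muw 1 = 0

/-- `λ = μ_o μ_w / (μ_o + μ_w)`. -/
def Layer.lam (L : Layer) (s : ℝ) : ℝ := L.muo s * L.muw s / (L.muo s + L.muw s)

/-- `φ(s) = ∫_0^s λ(a) π'(a) da`. The derivative of the Lipschitz function `π` exists almost
everywhere on `(0,1)`. -/
def Layer.phi (L : Layer) (s : ℝ) : ℝ := ∫ a in (0 : ℝ)..s, L.lam a * deriv L.pc a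

/-- The monotone graph of the capillary pressure: `{π(s)}` for `0 < s < 1`, `(-∞, π(0)]` for
`s = 0`, `[π(1), +∞)` for `s = 1`. -/
def Layer.graph (L : Layer) (s : ℝ) : Set ℝ :=
  {p | (0 < s ∧ s < 1 ∧ p = L.pc s) ∨ (s = 0 ∧ p ≤ L.pc 0) ∨ (s = 1 ∧ L.pc 1 ≤ p)}

/-- Data of the initial-boundary value problem. Layer `0` occupies `(-1,0)`, layer `1` occupies
`(0,1)`. -/
structure Problem where
  /-- final time -/
  T : ℝ
  /-- total flow rate -/
  q : ℝ
  /-- oil density -/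
  rhoo : ℝ
  /-- water density -/
  rhow : ℝ
  /-- gravity -/
  grav : ℝ
  layer : Fin 2 → Layer
  /-- initial saturation -/
  u0 : ℝ → ℝ
  /-- boundary datum at `x = -1` -/
  ul : ℝ → ℝ
  /-- boundary datum at `x = 1` -/
  ur : ℝ → ℝ

namespace Problem

variable (P : Problem)

/-- The convection flux `f_i = μ_o / (μ_o + μ_w) q + λ_i (ρ_o - ρ_w) g`. -/
def f (i : Fin 2) (s : ℝ) : ℝ :=
  (P.layer i).muo s / ((P.layer i).muo s + (P.layer i).muw s) * P.q
    + (P.layer i).lam s * (P.rhoo - P.rhow) * P.grav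

/-- The function `φ_i`. -/
def phi (i : Fin 2) (s : ℝ) : ℝ := (P.layer i).phi s

/-- The numerical flux `G_i`. -/
def G (i : Fin 2) (a b : ℝ) : ℝ := (P.layer i).G a b

/-- The layers `Ω_1 = (-1,0)` and `Ω_2 = (0,1)`. -/
def dom (i : Fin 2) : Set ℝ := if i = 0 then Ioo (-1) 0 else Ioo 0 1

/-- The assumptions on the data. -/
structure Admissible : Prop where
  T_pos : 0 < P.T
  layers : ∀ i, (P.layer i).Admissible
  G_lip : ∀ i, IsLipschitzOn (fun z : ℝ × ℝ => P.G i z.1 z.2) (Icc 0 1 ×ˢ Icc 0 1)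
  G_mono : ∀ i, ∀ b ∈ Icc (0 : ℝ) 1, MonotoneOn (fun a => P.G i a b) (Icc 0 1)
  G_anti : ∀ i, ∀ a ∈ Icc (0 : ℝ) 1, AntitoneOn (fun b => P.G i a b) (Icc 0 1)
  G_diag : ∀ i, ∀ a ∈ Icc (0 : ℝ) 1, P.G i a a = P.f i a
  u0_meas : AEStronglyMeasurable P.u0 (volume.restrict (Ioo (-1) 1))
  u0_mem : ∀ᵐ x ∂volume.restrict (Ioo (-1 : ℝ) 1), P.u0 x ∈ Icc (0 : ℝ) 1
  ul_meas : AEStronglyMeasurable P.ul (volume.restrict (Ioo 0 P.T))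
  ul_mem : ∀ᵐ t ∂volume.restrict (Ioo 0 P.T), P.ul t ∈ Icc (0 : ℝ) 1
  ur_meas : AEStronglyMeasurable P.ur (volume.restrict (Ioo 0 P.T))
  ur_mem : ∀ᵐ t ∂volume.restrict (Ioo 0 P.T), P.ur t ∈ Icc (0 : ℝ) 1

/-! ### Weak solutions -/

/-- `g` is the weak derivative of `w` on the open set `I` of the real line. -/
def IsWeakDeriv (I : Set ℝ) (w g : ℝ → ℝ) : Prop :=
  LocallyIntegrableOn w I ∧ LocallyIntegrableOn g I ∧
    ∀ ζ : ℝ → ℝ, ContDiff ℝ ∞ ζ → HasCompactSupport ζ → tsupport ζ ⊆ I →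
      ∫ x in I, w x * deriv ζ x = -∫ x in I, g x * ζ x

/-- `w` belongs to `L²(0,T;H¹(I))` and `g` is its (weak) derivative in space: `w` and `g` are
square integrable on `I × (0,T)` and `g(·,t)` is the weak derivative of `w(·,t)` for almost
every `t`. -/
def MemL2H1 (I : Set ℝ) (w g : ℝ × ℝ → ℝ) : Prop :=
  MemLp w 2 (volume.restrict (I ×ˢ Ioo 0 P.T)) ∧
  MemLp g 2 (volume.restrict (I ×ˢ Ioo 0 P.T)) ∧
  ∀ᵐ t ∂volume.restrict (Ioo 0 P.T), IsWeakDeriv I (fun x => w (x, t)) (fun x => g (x, t))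

/-- `γ` is the trace at the boundary point `α` of the restriction of `u` to `I × (0,T)`: for almost
every `t`, `u(x,t)` tends to `γ(t)` as `x → α` in `I`, the limit being an essential one (up to
a set of `x` of measure zero). -/
def HasTrace (I : Set ℝ) (α : ℝ) (u : ℝ × ℝ → ℝ) (γ : ℝ → ℝ) : Prop :=
  AEMeasurable γ (volume.restrict (Ioo 0 P.T)) ∧
  ∀ᵐ t ∂volume.restrict (Ioo 0 P.T),
    Tendsto (fun x => u (x, t)) (𝓝[I] α ⊓ ae volume) (𝓝 (γ t))

/-- Test functions on `[-1,1] × [0,T)`: restrictions of smooth functions on the plane whose support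
is compact and lies in `{t < T}`. -/
def IsTest (ψ : ℝ × ℝ → ℝ) : Prop :=
  ContDiff ℝ ∞ ψ ∧ HasCompactSupport ψ ∧ tsupport ψ ⊆ {z | z.2 < P.T}

/-- Weak solutions of the problem. Here `g i` is `∂ₓ φ_i(u)` on `Ω_i × (0,T)`, `γl` and `γr` are
the traces of `u` at `x = -1` and `x = 1`, and `γ i` is the trace at `x = 0` of `u` restricted to
`Ω_i`. -/
def IsWeakSolution (u : ℝ × ℝ → ℝ) : Prop :=
  AEStronglyMeasurable u (volume.restrict (Ioo (-1) 1 ×ˢ Ioo 0 P.T)) ∧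
  (∀ᵐ z ∂volume.restrict (Ioo (-1 : ℝ) 1 ×ˢ Ioo 0 P.T), u z ∈ Icc (0 : ℝ) 1) ∧
  ∃ (g : Fin 2 → ℝ × ℝ → ℝ) (γ : Fin 2 → ℝ → ℝ) (γl γr : ℝ → ℝ),
    (∀ i, P.MemL2H1 (dom i) (fun z => P.phi i (u z)) (g i)) ∧
    (∀ i, P.HasTrace (dom i) 0 u (γ i)) ∧
    P.HasTrace (dom 0) (-1) u γl ∧
    P.HasTrace (dom 1) 1 u γr ∧
    (∀ᵐ t ∂volume.restrict (Ioo 0 P.T),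
      ((P.layer 0).graph (γ 0 t) ∩ (P.layer 1).graph (γ 1 t)).Nonempty) ∧
    ∀ ψ : ℝ × ℝ → ℝ, P.IsTest ψ →
      (∑ i, ∫ z in dom i ×ˢ Ioo 0 P.T,
          (P.layer i).poro * u z * deriv (fun t => ψ (z.1, t)) z.2)
      + (∑ i, ∫ x in dom i, (P.layer i).poro * P.u0 x * ψ (x, 0))
      + (∑ i, ∫ z in dom i ×ˢ Ioo 0 P.T,
          (P.f i (u z) - g i z) * deriv (fun x => ψ (x, z.2)) z.1)
      + (∫ t in Ioo 0 P.T, P.G 0 (P.ul t) (γl t) * ψ (-1, t))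
      - (∫ t in Ioo 0 P.T, P.G 1 (γr t) (P.ur t) * ψ (1, t)) = 0

/-! ### The finite volume scheme -/

/-- Space step `δx = 1/N`. -/
def dx (N : ℕ) : ℝ := 1 / N

/-- Time step `δt = T/M`. -/
def dt (M : ℕ) : ℝ := P.T / M

/-- `u_{j+1/2}^0`, the mean of `u_0` on `(x_j, x_{j+1})` with `x_j = j δx`. -/
def u0Mean (N : ℕ) (j : ℤ) : ℝ :=
  1 / dx N * ∫ x in (j * dx N)..((j + 1) * dx N), P.u0 x

/-- Mean of the left boundary datum on `(t^n, t^{n+1})` with `t^n = n δt`. -/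
def ulMean (M n : ℕ) : ℝ :=
  1 / P.dt M * ∫ t in (n * P.dt M)..((n + 1) * P.dt M), P.ul t

/-- Mean of the right boundary datum on `(t^n, t^{n+1})`. -/
def urMean (M n : ℕ) : ℝ :=
  1 / P.dt M * ∫ t in (n * P.dt M)..((n + 1) * P.dt M), P.ur t

/-- Unknowns of the scheme: `cell n j` is `u_{j+1/2}^n` (used for `0 ≤ n ≤ M`, `-N ≤ j ≤ N-1`), and
`face i n` is the interface value at `x = 0` on the side of layer `i` at time level `n` (used for
`1 ≤ n ≤ M`). -/
structure Unknowns where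
  cell : ℕ → ℤ → ℝ
  face : Fin 2 → ℕ → ℝ

/-- The layer that contains the cell `(x_j, x_{j+1})`. -/
def cellLayer (j : ℤ) : Fin 2 := if j < 0 then 0 else 1

/-- The interface flux `F_0^{n+1}`, written from the first layer. -/
def faceFluxLeft (N : ℕ) (w : Unknowns) (n : ℕ) : ℝ :=
  P.G 0 (w.cell (n + 1) (-1)) (w.face 0 (n + 1))
    - 2 * (P.phi 0 (w.face 0 (n + 1)) - P.phi 0 (w.cell (n + 1) (-1))) / dx N

/-- The interface flux `F_0^{n+1}`, written from the second layer. -/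
def faceFluxRight (N : ℕ) (w : Unknowns) (n : ℕ) : ℝ :=
  P.G 1 (w.face 1 (n + 1)) (w.cell (n + 1) 0)
    - 2 * (P.phi 1 (w.cell (n + 1) 0) - P.phi 1 (w.face 1 (n + 1))) / dx N

/-- The discrete flux `F_j^{n+1}`, `-N ≤ j ≤ N`. -/
def flux (N M : ℕ) (w : Unknowns) (n : ℕ) (j : ℤ) : ℝ :=
  if j = -(N : ℤ) then P.G 0 (P.ulMean M n) (w.cell (n + 1) j)
  else if j = (N : ℤ) then P.G 1 (w.cell (n + 1) (j - 1)) (P.urMean M n)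
  else if j = 0 then P.faceFluxLeft N w n
  else
    P.G (cellLayer j) (w.cell (n + 1) (j - 1)) (w.cell (n + 1) j)
      - (P.phi (cellLayer j) (w.cell (n + 1) j)
          - P.phi (cellLayer j) (w.cell (n + 1) (j - 1))) / dx N

/-- `w` solves the implicit finite volume scheme with `2N` cells and `M` time steps. All unknowns
are saturations, hence in `[0,1]`, where the nonlinearities are defined. -/
structure IsSchemeSolution (N M : ℕ) (w : Unknowns) : Prop where
  cell_mem : ∀ n ≤ M, ∀ j : ℤ, -(N : ℤ) ≤ j → j < N → w.cell n j ∈ Icc (0 : ℝ) 1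
  face_mem : ∀ n < M, ∀ i, w.face i (n + 1) ∈ Icc (0 : ℝ) 1
  initial : ∀ j : ℤ, -(N : ℤ) ≤ j → j < N → w.cell 0 j = P.u0Mean N j
  balance : ∀ n < M, ∀ j : ℤ, -(N : ℤ) ≤ j → j < N →
    (P.layer (cellLayer j)).poro * ((w.cell (n + 1) j - w.cell n j) / P.dt M) * dx N
      + P.flux N M w n (j + 1) - P.flux N M w n j = 0
  face_flux : ∀ n < M, P.faceFluxLeft N w n = P.faceFluxRight N w n
  face_graph : ∀ n < M,
    ((P.layer 0).graph (w.face 0 (n + 1)) ∩ (P.layer 1).graph (w.face 1 (n + 1))).Nonempty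

/-- The piecewise constant function equal to `u_{j+1/2}^{n+1}` on `(x_j, x_{j+1}) × (t^n, t^{n+1}]`
and to `u_{j+1/2}^0` on `(x_j, x_{j+1})` for `t = 0`. -/
def reconstruct (N M : ℕ) (w : Unknowns) : ℝ × ℝ → ℝ :=
  fun z => w.cell ⌈z.2 / P.dt M⌉₊ ⌊z.1 / dx N⌋

/-- `v` is a discrete solution for the discretization given by `N` and `M`. -/
def IsDiscreteSolution (N M : ℕ) (v : ℝ × ℝ → ℝ) : Prop :=
  ∃ w : Unknowns, P.IsSchemeSolution N M w ∧ v = P.reconstruct N M w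

end Problem

end TwoPhase

end

/-! Existence. One implicit time step is a system in which the equation of each unknown is
non-increasing in all the other unknowns and has the right sign when its own unknown is 0 or 1,
because `f_i(0) = 0` and `f_i(1) = q` in both layers. Such a system has a zero by Knaster–Tarski
(`exists_zero_of_quasimonotone`). The two interface values become one unknown, a pressure common to
both sides, so that the graph condition holds by construction (`exists_step`).

Energy. The balance of each cell is multiplied by the capillary pressure `π_i` of its new
saturation. The time term dominates the increment of a convex primitive. The convective part is
dominated by an exact difference, since `G_i` is monotone in each argument (`G_mul_pc_le`). The
diffusive part dissipates, since the increments of `φ_i` are controlled by those of `π_i`. At the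
interface either the pressure is continuous or one face value is extreme, and then the sign of the
flux helps (`interface_mul_pc_le`). This bounds `∂ₓφ_i(u)` in `L²` uniformly in the mesh
(`exists_energy_bound`). All that is used afterwards is collected in `IsApprox`.

Compactness. At a fixed time, a bound `K ≤ R` on the root of the energy makes `φ_i(u)`
equicontinuous in space, and also `u`, because `φ_i` has a uniformly continuous inverse. The moments
of `u` against bump functions are equicontinuous in time by the equation, so a diagonal extraction
makes them converge at every time. Together, the solutions with `K ≤ R` at time `t` form a uniformly
Cauchy family, traces included (`cauchy_of_moments`, `cauchy_traces_of_moments`). The energy may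
blow up at individual times, but its time integral is bounded, so the bad times have small measure.
Hence saturations and traces are Cauchy in `L¹` and converge almost everywhere along a subsequence
(`exists_subseq_ae_tendsto`, `exists_ae_limit`).

Limit. The discrete gradients converge weakly in `L²`. Testing with indicators of rectangles shows
that `φ_i(u)` is a primitive of the weak limit `g` and that the limits of the discrete traces are
its end values (`ae_primitive`), which gives both the regularity and the traces of `u`. The set of
pairs with intersecting graphs is closed, so the transmission condition survives
(`graph_inter_of_tendsto`). The scheme has an exact weak form, in which only the time argument of
the test function is rounded to the grid, and each of its terms converges (`weak_formulation`). -/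

noncomputable section
namespace TwoPhase

/-! ### Truncation, inverses, and the nonlinear functions of one layer. -/

/-- Truncation of a real number to `[0,1]`. -/
def clamp (s : ℝ) : ℝ := max 0 (min s 1)

lemma clamp_mem (s : ℝ) : clamp s ∈ Icc (0 : ℝ) 1 := ⟨le_max_left _ _, by simp [clamp]⟩

lemma clamp_of_mem {s : ℝ} (hs : s ∈ Icc (0 : ℝ) 1) : clamp s = s := by
  simp [clamp, hs.1, hs.2]

lemma continuous_clamp : Continuous clamp := by unfold clamp; fun_prop

lemma monotone_clamp : Monotone clamp := fun a b h => by unfold clamp; gcongr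

/-- A function continuous on `[0,1]` becomes continuous on the line after truncation. -/
lemma continuous_comp_clamp {h : ℝ → ℝ} (hc : ContinuousOn h (Icc 0 1)) :
    Continuous fun s => h (clamp s) :=
  hc.comp_continuous continuous_clamp clamp_mem

/-- The inverse of a strictly increasing continuous function on `[0,1]`, extended by constants. -/
lemma exists_clampedInverse {h : ℝ → ℝ} (hm : StrictMonoOn h (Icc 0 1))
    (hc : ContinuousOn h (Icc 0 1)) :
    ∃ k : ℝ → ℝ, Continuous k ∧ Monotone k ∧ (∀ y, k y ∈ Icc (0 : ℝ) 1) ∧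
      (∀ s ∈ Icc (0 : ℝ) 1, k (h s) = s) ∧ (∀ y ≤ h 0, k y = 0) ∧ (∀ y, h 1 ≤ y → k y = 1) ∧
      ∀ y ∈ Icc (h 0) (h 1), h (k y) = y := by
  -- Continuing `h` with slope one outside `[0,1]` gives an increasing bijection of the line. Its
  -- inverse, truncated, is `k`.
  let e : ℝ → ℝ := fun s => h (clamp s) + (s - clamp s)
  have hm' : MonotoneOn h (Icc 0 1) := hm.monotoneOn
  have hres : Monotone fun s : ℝ => s - clamp s := by
    intro a b hab
    simp only [clamp]
    rcases le_total a 1 with h1 | h1 <;> rcases le_total b 1 with h2 | h2 <;>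
      rcases le_total a 0 with h3 | h3 <;> rcases le_total b 0 with h4 | h4 <;>
      simp [h1, h2, h3, h4] <;> linarith
  have he : StrictMono e := by
    intro a b hab
    have h1 := hres hab.le
    have h2 := hm' (clamp_mem a) (clamp_mem b) (monotone_clamp hab.le)
    simp only [e]
    rcases (monotone_clamp hab.le).eq_or_lt with h3 | h3
    · rw [h3]; linarith
    · have := hm (clamp_mem a) (clamp_mem b) h3
      simp only at h1; linarith
  have hec : Continuous e := (continuous_comp_clamp hc).add (continuous_id.sub continuous_clamp)
  have hbd : ∀ s, h 0 ≤ h (clamp s) ∧ h (clamp s) ≤ h 1 := fun s =>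
    ⟨hm' (by simp) (clamp_mem s) (clamp_mem s).1, hm' (clamp_mem s) (by simp) (clamp_mem s).2⟩
  have hsurj : Function.Surjective e := by
    refine hec.surjective ?_ ?_
    · refine tendsto_atTop_mono (fun s => ?_) (tendsto_atTop_add_const_right _ (h 0 - 1) tendsto_id)
      have := (clamp_mem s).2; have := (hbd s).1
      simp only [e, id]; linarith
    · refine tendsto_atBot_mono (fun s => ?_) (tendsto_atBot_add_const_right _ (h 1) tendsto_id)
      have := (clamp_mem s).1; have := (hbd s).2
      simp only [e, id]; linarith
  let E := he.orderIsoOfSurjective e hsurj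
  have hEe : ∀ s, E s = e s := fun s => rfl
  have heI : ∀ s ∈ Icc (0 : ℝ) 1, e s = h s := fun s hs => by simp [e, clamp_of_mem hs]
  have hinv : ∀ s ∈ Icc (0 : ℝ) 1, E.symm (h s) = s := fun s hs => by
    rw [← heI s hs, ← hEe, E.symm_apply_apply]
  refine ⟨fun y => clamp (E.symm y), continuous_clamp.comp E.symm.continuous,
    monotone_clamp.comp E.symm.monotone, fun y => clamp_mem _, fun s hs => ?_, fun y hy => ?_,
    fun y hy => ?_, fun y hy => ?_⟩
  · simp only [hinv s hs, clamp_of_mem hs]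
  · have : E.symm y ≤ 0 := (E.symm.monotone hy).trans_eq (hinv 0 (by simp))
    simp [clamp, min_le_of_left_le this]
  · have : 1 ≤ E.symm y := (hinv 1 (by simp)).symm.trans_le (E.symm.monotone hy)
    simp [clamp, this]
  · have h1 : 0 ≤ E.symm y := (hinv 0 (by simp)).symm.trans_le (E.symm.monotone hy.1)
    have h2 : E.symm y ≤ 1 := (E.symm.monotone hy.2).trans_eq (hinv 1 (by simp))
    simp only [clamp_of_mem ⟨h1, h2⟩]
    rw [← heI _ ⟨h1, h2⟩, ← hEe, E.apply_symm_apply]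

lemma IsLipschitzOn.continuousOn {f : ℝ → ℝ} {s : Set ℝ} (h : IsLipschitzOn f s) :
    ContinuousOn f s := h.elim fun _ hK => hK.continuousOn

lemma exists_abs_le_of_continuousOn {h : ℝ → ℝ} (hc : ContinuousOn h (Icc 0 1)) :
    ∃ C, 0 ≤ C ∧ ∀ s ∈ Icc (0 : ℝ) 1, |h s| ≤ C := by
  obtain ⟨C, hC⟩ := isCompact_Icc.exists_bound_of_continuousOn hc
  exact ⟨max C 0, le_max_right _ _, fun s hs => (hC s hs).trans (le_max_left _ _)⟩

/-- `W_h(s) = ∫_0^s h(a) π'(a) da`. -/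
def Layer.weighted (L : Layer) (h : ℝ → ℝ) (s : ℝ) : ℝ := ∫ a in (0 : ℝ)..s, h a * deriv L.pc a

namespace Layer.Admissible

variable {L : Layer} (hL : L.Admissible)
include hL

lemma pc_cont : ContinuousOn L.pc (Icc 0 1) := hL.pc_lip.continuousOn
lemma muo_cont : ContinuousOn L.muo (Icc 0 1) := hL.muo_lip.continuousOn
lemma muw_cont : ContinuousOn L.muw (Icc 0 1) := hL.muw_lip.continuousOn

lemma muo_nonneg {s : ℝ} (hs : s ∈ Icc (0 : ℝ) 1) : 0 ≤ L.muo s :=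
  hL.muo_zero ▸ hL.muo_strictMono.monotoneOn (by simp) hs hs.1

lemma muw_nonneg {s : ℝ} (hs : s ∈ Icc (0 : ℝ) 1) : 0 ≤ L.muw s :=
  hL.muw_one ▸ hL.muw_strictAnti.antitoneOn hs (by simp) hs.2

lemma muo_pos {s : ℝ} (hs : s ∈ Icc (0 : ℝ) 1) (h : 0 < s) : 0 < L.muo s :=
  hL.muo_zero ▸ hL.muo_strictMono (by simp) hs h

lemma muw_pos {s : ℝ} (hs : s ∈ Icc (0 : ℝ) 1) (h : s < 1) : 0 < L.muw s :=
  hL.muw_one ▸ hL.muw_strictAnti hs (by simp) h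

lemma den_pos {s : ℝ} (hs : s ∈ Icc (0 : ℝ) 1) : 0 < L.muo s + L.muw s := by
  rcases hs.1.eq_or_lt with h | h
  · have := hL.muw_pos hs (by linarith); have := hL.muo_nonneg hs; linarith
  · have := hL.muo_pos hs h; have := hL.muw_nonneg hs; linarith

lemma lam_cont : ContinuousOn L.lam (Icc 0 1) :=
  (hL.muo_cont.mul hL.muw_cont).div (hL.muo_cont.add hL.muw_cont) fun _ hs => (hL.den_pos hs).ne'

lemma lam_nonneg {s : ℝ} (hs : s ∈ Icc (0 : ℝ) 1) : 0 ≤ L.lam s :=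
  div_nonneg (mul_nonneg (hL.muo_nonneg hs) (hL.muw_nonneg hs)) (hL.den_pos hs).le

lemma lam_pos {s : ℝ} (hs : s ∈ Ioo (0 : ℝ) 1) : 0 < L.lam s :=
  div_pos (mul_pos (hL.muo_pos ⟨hs.1.le, hs.2.le⟩ hs.1) (hL.muw_pos ⟨hs.1.le, hs.2.le⟩ hs.2))
    (hL.den_pos ⟨hs.1.le, hs.2.le⟩)

lemma pc_ac {a b : ℝ} (ha : a ∈ Icc (0 : ℝ) 1) (hb : b ∈ Icc (0 : ℝ) 1) :
    AbsolutelyContinuousOnInterval L.pc a b :=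
  hL.pc_lip.elim fun _ hK => (hK.mono (uIcc_subset_Icc ha hb)).absolutelyContinuousOnInterval

lemma deriv_pc_nonneg {s : ℝ} (hs : s ∈ Ioo (0 : ℝ) 1) : 0 ≤ deriv L.pc s := by
  rw [← derivWithin_of_isOpen isOpen_Ioo hs]
  exact (hL.pc_strictMono.monotoneOn.mono Ioo_subset_Icc_self).derivWithin_nonneg

lemma integrable_weight {h : ℝ → ℝ} (hc : ContinuousOn h (Icc 0 1)) {a b : ℝ}
    (ha : a ∈ Icc (0 : ℝ) 1) (hb : b ∈ Icc (0 : ℝ) 1) :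
    IntervalIntegrable (fun x => h x * deriv L.pc x) volume a b :=
  (hL.pc_ac ha hb).intervalIntegrable_deriv.continuousOn_mul (hc.mono (uIcc_subset_Icc ha hb))

lemma weighted_sub {h : ℝ → ℝ} (hc : ContinuousOn h (Icc 0 1)) {a b : ℝ}
    (ha : a ∈ Icc (0 : ℝ) 1) (hb : b ∈ Icc (0 : ℝ) 1) :
    L.weighted h b - L.weighted h a = ∫ x in a..b, h x * deriv L.pc x :=
  intervalIntegral.integral_interval_sub_left (hL.integrable_weight hc (by simp) hb)
    (hL.integrable_weight hc (by simp) ha)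

/-- Only `π' ≥ 0` is used, so `c` may have any sign. The increment of `π` is the integral of its
derivative because Lipschitz functions are absolutely continuous. -/
lemma weighted_ge {h : ℝ → ℝ} (hc : ContinuousOn h (Icc 0 1)) {a b c : ℝ}
    (ha : a ∈ Icc (0 : ℝ) 1) (hb : b ∈ Icc (0 : ℝ) 1) (hab : a ≤ b)
    (hle : ∀ s ∈ Ioo a b, c ≤ h s) :
    c * (L.pc b - L.pc a) ≤ L.weighted h b - L.weighted h a := by
  rw [hL.weighted_sub hc ha hb, ← (hL.pc_ac ha hb).integral_deriv_eq_sub,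
    ← intervalIntegral.integral_const_mul]
  refine intervalIntegral.integral_mono_on_of_le_Ioo hab
    ((hL.pc_ac ha hb).intervalIntegrable_deriv.const_mul c) (hL.integrable_weight hc ha hb)
    fun x hx => mul_le_mul_of_nonneg_right (hle x hx)
      (hL.deriv_pc_nonneg ⟨ha.1.trans_lt hx.1, hx.2.trans_le hb.2⟩)

lemma weighted_le {h : ℝ → ℝ} (hc : ContinuousOn h (Icc 0 1)) {a b c : ℝ}
    (ha : a ∈ Icc (0 : ℝ) 1) (hb : b ∈ Icc (0 : ℝ) 1) (hab : a ≤ b)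
    (hle : ∀ s ∈ Ioo a b, h s ≤ c) :
    L.weighted h b - L.weighted h a ≤ c * (L.pc b - L.pc a) := by
  rw [hL.weighted_sub hc ha hb, ← (hL.pc_ac ha hb).integral_deriv_eq_sub,
    ← intervalIntegral.integral_const_mul]
  refine intervalIntegral.integral_mono_on_of_le_Ioo hab (hL.integrable_weight hc ha hb)
    ((hL.pc_ac ha hb).intervalIntegrable_deriv.const_mul c)
    fun x hx => mul_le_mul_of_nonneg_right (hle x hx)
      (hL.deriv_pc_nonneg ⟨ha.1.trans_lt hx.1, hx.2.trans_le hb.2⟩)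

lemma weighted_cont {h : ℝ → ℝ} (hc : ContinuousOn h (Icc 0 1)) :
    ContinuousOn (L.weighted h) (Icc 0 1) := by
  have := (hL.integrable_weight hc (a := 0) (b := 1) (by simp)
    (by simp)).absolutelyContinuousOnInterval_intervalIntegral (c := 0) (by simp)
  simpa [uIcc_of_le] using! this.continuousOn

/-- The derivative `π'` may vanish on a set of positive measure. If `φ` took the same value at `a <
b`, then `λ > 0` inside would force `π' = 0` almost everywhere on `(a,b)`, and absolute continuity
would give `π(a) = π(b)`. -/
lemma phi_strictMono : StrictMonoOn L.phi (Icc 0 1) := by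
  intro a ha b hb hab
  have h0 := hL.weighted_ge hL.lam_cont ha hb hab.le (c := 0)
    fun s hs => hL.lam_nonneg ⟨ha.1.trans hs.1.le, hs.2.le.trans hb.2⟩
  rw [zero_mul] at h0
  change L.weighted L.lam a < L.weighted L.lam b
  refine lt_of_le_of_ne (by linarith) fun heq => ?_
  have h1 := hL.weighted_sub hL.lam_cont ha hb
  rw [heq, sub_self, intervalIntegral.integral_of_le hab.le, integral_Ioc_eq_integral_Ioo,
    eq_comm] at h1
  have hsub : Ioo a b ⊆ Ioo 0 1 := Ioo_subset_Ioo ha.1 hb.2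
  have hint : IntegrableOn (fun x => L.lam x * deriv L.pc x) (Ioo a b) :=
    ((intervalIntegrable_iff_integrableOn_Ioo_of_le hab.le).1 (hL.integrable_weight hL.lam_cont ha hb))
  have h2 := (setIntegral_eq_zero_iff_of_nonneg_ae (s := Ioo a b) ?_ hint).1 h1
  · have h3 : ∫ x in a..b, deriv L.pc x = 0 := by
      rw [intervalIntegral.integral_of_le hab.le, integral_Ioc_eq_integral_Ioo]
      refine integral_eq_zero_of_ae ?_
      filter_upwards [h2, ae_restrict_mem measurableSet_Ioo] with x hx hx'
      exact (mul_eq_zero.1 hx).resolve_left (hL.lam_pos (hsub hx')).ne'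
    rw [(hL.pc_ac ha hb).integral_deriv_eq_sub] at h3
    have := hL.pc_strictMono ha hb hab
    linarith
  · filter_upwards [ae_restrict_mem measurableSet_Ioo] with x hx
    exact mul_nonneg (hL.lam_pos (hsub hx)).le (hL.deriv_pc_nonneg (hsub hx))

lemma phi_cont : ContinuousOn L.phi (Icc 0 1) := hL.weighted_cont hL.lam_cont

/-- The increments of `φ` are controlled by those of the capillary pressure. -/
lemma exists_phi_sub_sq_le : ∃ c, 0 < c ∧ ∀ a ∈ Icc (0 : ℝ) 1, ∀ b ∈ Icc (0 : ℝ) 1,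
    c * (L.phi b - L.phi a) ^ 2 ≤ (L.phi b - L.phi a) * (L.pc b - L.pc a) := by
  obtain ⟨C, hC0, hC⟩ := exists_abs_le_of_continuousOn hL.lam_cont
  have key : ∀ a ∈ Icc (0 : ℝ) 1, ∀ b ∈ Icc (0 : ℝ) 1, a ≤ b →
      (C + 1)⁻¹ * (L.phi b - L.phi a) ^ 2 ≤ (L.phi b - L.phi a) * (L.pc b - L.pc a) := by
    intro a ha b hb hab
    -- `C` bounds `|λ|` and may be zero. The bound `C + 1` can be inverted.
    have h1 := hL.weighted_le hL.lam_cont ha hb hab (c := C + 1) fun s hs => by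
      have := (le_abs_self _).trans (hC s ⟨ha.1.trans hs.1.le, hs.2.le.trans hb.2⟩); linarith
    have h2 : 0 ≤ L.phi b - L.phi a := sub_nonneg.2 (hL.phi_strictMono.monotoneOn ha hb hab)
    change L.phi b - L.phi a ≤ _ at h1
    rw [inv_mul_le_iff₀ (by positivity)]
    nlinarith
  refine ⟨(C + 1)⁻¹, by positivity, fun a ha b hb => ?_⟩
  rcases le_total a b with h | h
  · exact key a ha b hb h
  · have := key b hb a ha h; nlinarith

/-- The graph of the capillary pressure is the inverse of a continuous monotone function. -/
lemma exists_graph_inverse : ∃ k : ℝ → ℝ, Continuous k ∧ Monotone k ∧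
    (∀ y, k y ∈ Icc (0 : ℝ) 1) ∧ (∀ y ≤ L.pc 0, k y = 0) ∧ (∀ y, L.pc 1 ≤ y → k y = 1) ∧
    ∀ s p, p ∈ L.graph s ↔ k p = s := by
  obtain ⟨k, h1, h2, h3, h4, h5, h6, h7⟩ := exists_clampedInverse hL.pc_strictMono hL.pc_cont
  refine ⟨k, h1, h2, h3, h5, h6, fun s p => ⟨?_, ?_⟩⟩
  · rintro (⟨hs0, hs1, rfl⟩ | ⟨rfl, h⟩ | ⟨rfl, h⟩)
    · exact h4 s ⟨hs0.le, hs1.le⟩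
    · exact h5 p h
    · exact h6 p h
  · rintro rfl
    rcases le_or_gt p (L.pc 0) with h | h
    · exact Or.inr (Or.inl ⟨h5 p h, h⟩)
    rcases le_or_gt (L.pc 1) p with h' | h'
    · exact Or.inr (Or.inr ⟨h6 p h', h'⟩)
    have hp := h7 p ⟨h.le, h'.le⟩
    refine Or.inl ⟨(h3 p).1.lt_of_ne fun h0 => ?_, (h3 p).2.lt_of_ne fun h0 => ?_, hp.symm⟩
    · rw [← h0] at hp; linarith
    · rw [h0] at hp; linarith

lemma exists_phi_inverse : ∃ k : ℝ → ℝ, Continuous k ∧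
    (∀ y, k y ∈ Icc (0 : ℝ) 1) ∧ (∀ s ∈ Icc (0 : ℝ) 1, k (L.phi s) = s) ∧
    ∀ y ∈ Icc (L.phi 0) (L.phi 1), L.phi (k y) = y := by
  obtain ⟨k, h1, h2, h3, h4, h5, h6, h7⟩ := exists_clampedInverse hL.phi_strictMono hL.phi_cont
  exact ⟨k, h1, h3, h4, h7⟩

/-- Uniform continuity of the inverse of `φ`. -/
lemma exists_phi_modulus {ε : ℝ} (hε : 0 < ε) : ∃ δ, 0 < δ ∧ ∀ a ∈ Icc (0 : ℝ) 1,
    ∀ b ∈ Icc (0 : ℝ) 1, |L.phi a - L.phi b| ≤ δ → |a - b| ≤ ε := by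
  obtain ⟨k, hk, -, hk', -⟩ := hL.exists_phi_inverse
  have := (isCompact_Icc (a := L.phi 0) (b := L.phi 1)).uniformContinuousOn_of_continuous hk.continuousOn
  obtain ⟨δ, hδ, H⟩ := Metric.uniformContinuousOn_iff_le.1 this ε hε
  have hm := hL.phi_strictMono.monotoneOn
  have hmem : ∀ a ∈ Icc (0 : ℝ) 1, L.phi a ∈ Icc (L.phi 0) (L.phi 1) := fun a ha =>
    ⟨hm (by simp) ha ha.1, hm ha (by simp) ha.2⟩
  refine ⟨δ, hδ, fun a ha b hb hab => ?_⟩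
  have := H _ (hmem a ha) _ (hmem b hb) hab
  rwa [hk' a ha, hk' b hb] at this

end Layer.Admissible

namespace Problem.Admissible

variable {P : Problem} (hP : P.Admissible)
include hP

lemma f_cont (i : Fin 2) : ContinuousOn (P.f i) (Icc 0 1) := by
  have hL := hP.layers i
  exact (((hL.muo_cont.div (hL.muo_cont.add hL.muw_cont) fun _ hs => (hL.den_pos hs).ne').mul
    continuousOn_const).add (((hL.lam_cont).mul continuousOn_const).mul continuousOn_const))

lemma f_zero (i : Fin 2) : P.f i 0 = 0 := by
  simp [Problem.f, Layer.lam, (hP.layers i).muo_zero]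

lemma f_one (i : Fin 2) : P.f i 1 = P.q := by
  have := (hP.layers i).muo_pos (s := 1) (by simp) one_pos
  simp [Problem.f, Layer.lam, (hP.layers i).muw_one, this.ne']

/-- With the three lemmas that follow, this fixes the sign of the flux, or of the flux minus `q`, at
extreme saturations. Both the invariance of `[0,1]` and the interface estimate rest on it, and on
the fact that `q` is the same in the two layers. -/
lemma G_zero_left (i : Fin 2) {b : ℝ} (hb : b ∈ Icc (0 : ℝ) 1) : P.G i 0 b ≤ 0 := by
  have h := hP.G_anti i 0 (by simp) (by simp) hb hb.1
  simpa [hP.G_diag i 0 (by simp), hP.f_zero i] using h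

lemma G_zero_right (i : Fin 2) {a : ℝ} (ha : a ∈ Icc (0 : ℝ) 1) : 0 ≤ P.G i a 0 := by
  have h := hP.G_mono i 0 (by simp) (by simp) ha ha.1
  simpa [hP.G_diag i 0 (by simp), hP.f_zero i] using h

lemma G_one_left (i : Fin 2) {b : ℝ} (hb : b ∈ Icc (0 : ℝ) 1) : P.q ≤ P.G i 1 b := by
  rw [← hP.f_one i, ← hP.G_diag i 1 (by simp)]
  exact hP.G_anti i 1 (by simp) hb (by simp) hb.2

lemma G_one_right (i : Fin 2) {a : ℝ} (ha : a ∈ Icc (0 : ℝ) 1) : P.G i a 1 ≤ P.q := by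
  rw [← hP.f_one i, ← hP.G_diag i 1 (by simp)]
  exact hP.G_mono i 1 (by simp) ha (by simp) ha.2

lemma G_cont (i : Fin 2) : ContinuousOn (fun z : ℝ × ℝ => P.G i z.1 z.2) (Icc 0 1 ×ˢ Icc 0 1) :=
  (hP.G_lip i).elim fun _ hK => hK.continuousOn

lemma G_cont_clamp (i : Fin 2) : Continuous fun z : ℝ × ℝ => P.G i (clamp z.1) (clamp z.2) :=
  (hP.G_cont i).comp_continuous (f := fun z : ℝ × ℝ => (clamp z.1, clamp z.2))
    ((continuous_clamp.comp continuous_fst).prodMk (continuous_clamp.comp continuous_snd))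
    fun _ => ⟨clamp_mem _, clamp_mem _⟩

lemma exists_G_bound : ∃ C, 0 ≤ C ∧ ∀ i, ∀ a ∈ Icc (0 : ℝ) 1, ∀ b ∈ Icc (0 : ℝ) 1,
    |P.G i a b| ≤ C := by
  have : ∀ i, ∃ C, ∀ a ∈ Icc (0 : ℝ) 1, ∀ b ∈ Icc (0 : ℝ) 1, |P.G i a b| ≤ C := fun i => by
    obtain ⟨C, hC⟩ := (isCompact_Icc.prod isCompact_Icc).exists_bound_of_continuousOn (hP.G_cont i)
    exact ⟨C, fun a ha b hb => hC (a, b) ⟨ha, hb⟩⟩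
  choose C hC using this
  refine ⟨max (max (C 0) (C 1)) 0, le_max_right _ _, fun i a ha b hb => (hC i a ha b hb).trans ?_⟩
  fin_cases i
  · exact (le_max_left _ _).trans (le_max_left _ _)
  · exact (le_max_right _ _).trans (le_max_left _ _)

lemma exists_G_lip : ∃ C, 0 ≤ C ∧ ∀ i, ∀ a ∈ Icc (0 : ℝ) 1, ∀ b ∈ Icc (0 : ℝ) 1,
    ∀ c ∈ Icc (0 : ℝ) 1, ∀ d ∈ Icc (0 : ℝ) 1, |P.G i a b - P.G i c d| ≤ C * (|a - c| + |b - d|) := by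
  choose K hK using hP.G_lip
  refine ⟨max (K 0) (K 1), le_max_of_le_left (K 0).2, fun i a ha b hb c hc d hd => ?_⟩
  have h1 := (hK i).dist_le_mul (a, b) ⟨ha, hb⟩ (c, d) ⟨hc, hd⟩
  rw [Real.dist_eq, Prod.dist_eq, Real.dist_eq, Real.dist_eq] at h1
  have h2 : (K i : ℝ) ≤ max (K 0) (K 1) := by
    fin_cases i
    · exact le_max_left _ _
    · exact le_max_right _ _
  refine h1.trans (mul_le_mul h2 (max_le (le_add_of_nonneg_right (abs_nonneg _))
    (le_add_of_nonneg_left (abs_nonneg _))) (by positivity) (le_max_of_le_left (K 0).2))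

/-- The monotone flux is dominated by the entropy flux of the capillary pressure. -/
lemma G_mul_pc_le (i : Fin 2) {a b : ℝ} (ha : a ∈ Icc (0 : ℝ) 1) (hb : b ∈ Icc (0 : ℝ) 1) :
    P.G i a b * ((P.layer i).pc b - (P.layer i).pc a) ≤
      (P.layer i).weighted (P.f i) b - (P.layer i).weighted (P.f i) a := by
  -- For `s` between `a` and `b`, moving one argument at a time to `s` gives `G(a,b) ≤ G(s,s) =
  -- f(s)` if `a ≤ b` and the reverse inequality if `b ≤ a`. Integrating against `π'` yields the
  -- same final inequality in both cases.
  rcases le_total a b with h | h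
  · refine (hP.layers i).weighted_ge (hP.f_cont i) ha hb h fun s hs => ?_
    have hs' : s ∈ Icc (0 : ℝ) 1 := ⟨ha.1.trans hs.1.le, hs.2.le.trans hb.2⟩
    rw [← hP.G_diag i s hs']
    exact (hP.G_mono i b hb ha hs' hs.1.le).trans (hP.G_anti i s hs' hs' hb hs.2.le)
  · have := (hP.layers i).weighted_le (hP.f_cont i) (c := P.G i a b) hb ha h fun s hs => by
      have hs' : s ∈ Icc (0 : ℝ) 1 := ⟨hb.1.trans hs.1.le, hs.2.le.trans ha.2⟩
      rw [← hP.G_diag i s hs']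
      exact (hP.G_anti i s hs' hb hs' hs.1.le).trans (hP.G_mono i b hb hs' ha hs.2.le)
    linarith

end Problem.Admissible
end TwoPhase
-- Existence of discrete solutions by monotonicity.
namespace TwoPhase

/-- A quasi-monotone system on the cube, with the right signs on the faces, has a zero. -/
theorem exists_zero_of_quasimonotone {ι : Type*} [DecidableEq ι] (H : ι → (ι → ℝ) → ℝ)
    (hcont : ∀ j, Continuous (H j))
    (hanti : ∀ j v v', (∀ i, v i ∈ Icc (0 : ℝ) 1) → (∀ i, v' i ∈ Icc (0 : ℝ) 1) → v ≤ v' →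
      v j = v' j → H j v' ≤ H j v)
    (h0 : ∀ j v, (∀ i, v i ∈ Icc (0 : ℝ) 1) → v j = 0 → H j v ≤ 0)
    (h1 : ∀ j v, (∀ i, v i ∈ Icc (0 : ℝ) 1) → v j = 1 → 0 ≤ H j v) :
    ∃ v : ι → ℝ, (∀ i, v i ∈ Icc (0 : ℝ) 1) ∧ ∀ j, H j v = 0 := by
  have : Fact ((0 : ℝ) ≤ 1) := ⟨zero_le_one⟩
  -- With the other coordinates of `v` frozen, `S v j` holds the values of the coordinate `j` at
  -- which `H j` is nonnegative, and `T v j` is the least of them. Raising the frozen coordinates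
  -- lowers `H j`, so it shrinks this set: `T` is monotone on a complete lattice and has a fixed
  -- point. The index set need not be finite.
  let S : (ι → Icc (0 : ℝ) 1) → ι → Set ℝ := fun v j =>
    {s | s ∈ Icc (0 : ℝ) 1 ∧ 0 ≤ H j (Function.update (fun i => (v i : ℝ)) j s)}
  have hupd : ∀ (v : ι → Icc (0 : ℝ) 1) (j : ι) (s : ℝ), s ∈ Icc (0 : ℝ) 1 →
      ∀ i, Function.update (fun i => (v i : ℝ)) j s i ∈ Icc (0 : ℝ) 1 := by
    intro v j s hs i
    by_cases h : i = j
    · subst h; simpa using hs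
    · rw [Function.update_of_ne h]; exact (v i).2
  have hS1 : ∀ v j, (1 : ℝ) ∈ S v j := fun v j =>
    ⟨by simp, h1 j _ (hupd v j 1 (by simp)) (by simp)⟩
  have hSb : ∀ v j, BddBelow (S v j) := fun v j => ⟨0, fun s hs => hs.1.1⟩
  let T : (ι → Icc (0 : ℝ) 1) → ι → Icc (0 : ℝ) 1 := fun v j =>
    ⟨sInf (S v j), le_csInf ⟨1, hS1 v j⟩ fun s hs => hs.1.1, csInf_le (hSb v j) (hS1 v j)⟩
  have hT : Monotone T := by
    intro v v' hv j
    refine csInf_le_csInf (hSb v j) ⟨1, hS1 v' j⟩ fun s hs => ⟨hs.1, hs.2.trans ?_⟩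
    refine hanti j _ _ (hupd v j s hs.1) (hupd v' j s hs.1) ?_ (by simp)
    exact update_le_update_iff.2 ⟨le_rfl, fun i _ => hv i⟩
  let F : (ι → Icc (0 : ℝ) 1) →o (ι → Icc (0 : ℝ) 1) := ⟨T, hT⟩
  have hfix : T F.lfp = F.lfp := F.map_lfp
  generalize F.lfp = v at hfix
  have hval : ∀ j, (v j : ℝ) = sInf (S v j) := fun j => by
    conv_lhs => rw [← hfix]
  refine ⟨fun i => v i, fun i => (v i).2, fun j => ?_⟩
  have hc : Continuous fun s => H j (Function.update (fun i => (v i : ℝ)) j s) :=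
    (hcont j).comp (continuous_const.update j continuous_id)
  have hself : Function.update (fun i => (v i : ℝ)) j (v j : ℝ) = fun i => (v i : ℝ) := by simp
  have hclosed : IsClosed (S v j) := isClosed_Icc.inter (isClosed_le continuous_const hc)
  have hmem : (v j : ℝ) ∈ S v j := hval j ▸ hclosed.csInf_mem ⟨1, hS1 v j⟩ (hSb v j)
  refine le_antisymm ?_ (hself ▸ hmem.2)
  -- Below the infimum `H j` is negative, so it is nonpositive at `v j` by continuity from the left.
  -- If `v j = 0` there is nothing below, and the sign on the face replaces the limit.
  rcases (v j).2.1.eq_or_lt with h | h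
  · exact h0 j _ (fun i => (v i).2) h.symm
  · have hev : ∀ᶠ s in 𝓝[<] (v j : ℝ), H j (Function.update (fun i => (v i : ℝ)) j s) ≤ 0 := by
      filter_upwards [Ioo_mem_nhdsLT h] with s hs
      by_contra hcon
      have : sInf (S v j) ≤ s :=
        csInf_le (hSb v j) ⟨⟨hs.1.le, hs.2.le.trans (v j).2.2⟩, (not_le.1 hcon).le⟩
      rw [← hval j] at this
      exact absurd hs.2 (not_lt.2 this)
    have hlim := (hc.tendsto (v j : ℝ)).mono_left (nhdsWithin_le_nhds (s := Iio (v j : ℝ)))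
    rw [hself] at hlim
    exact le_of_tendsto hlim hev

lemma interval_mean_mem {f : ℝ → ℝ} {a b : ℝ} (hab : a < b)
    (hf : ∀ᵐ x ∂volume.restrict (Ioo a b), f x ∈ Icc (0 : ℝ) 1) :
    1 / (b - a) * ∫ x in a..b, f x ∈ Icc (0 : ℝ) 1 := by
  have hba : 0 < b - a := sub_pos.2 hab
  rw [intervalIntegral.integral_of_le hab.le, integral_Ioc_eq_integral_Ioo]
  have h1 : 0 ≤ ∫ x in Ioo a b, f x := integral_nonneg_of_ae (hf.mono fun x hx => hx.1)
  have h2 : ‖∫ x in Ioo a b, f x‖ ≤ 1 * volume.real (Ioo a b) :=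
    norm_setIntegral_le_of_norm_le_const_ae (by simp)
      (hf.mono fun x hx => abs_le.2 ⟨by linarith [hx.1], hx.2⟩)
  rw [Real.volume_real_Ioo_of_le hab.le, one_mul] at h2
  refine ⟨by positivity, ?_⟩
  rw [one_div, inv_mul_le_iff₀ hba, mul_one]
  exact (le_abs_self _).trans h2

namespace Problem

/-- Value on the left of the cell `j`. -/
def lval (N : ℕ) (al fr : ℝ) (c : ℤ → ℝ) (j : ℤ) : ℝ :=
  if j = -(N : ℤ) then al else if j = 0 then fr else c (j - 1)

/-- Value on the right of the cell `j`. -/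
def rval (N : ℕ) (ar fl : ℝ) (c : ℤ → ℝ) (j : ℤ) : ℝ :=
  if j = (N : ℤ) - 1 then ar else if j = -1 then fl else c (j + 1)

/-- Transmissibility of the left edge of the cell `j`. -/
def lcoef (N : ℕ) (j : ℤ) : ℝ :=
  if j = -(N : ℤ) then 0 else if j = 0 then 2 / dx N else 1 / dx N

/-- Transmissibility of the right edge of the cell `j`. -/
def rcoef (N : ℕ) (j : ℤ) : ℝ :=
  if j = (N : ℤ) - 1 then 0 else if j = -1 then 2 / dx N else 1 / dx N

variable (P : Problem)

/-- Two-point flux with transmissibility `κ`. -/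
def twoPoint (i : Fin 2) (κ a b : ℝ) : ℝ := P.G i a b - κ * (P.phi i b - P.phi i a)

lemma dx_pos {N : ℕ} (hN : 0 < N) : 0 < dx N := by unfold dx; positivity

lemma lcoef_nonneg {N : ℕ} (hN : 0 < N) (j : ℤ) : 0 ≤ lcoef N j := by
  have := dx_pos hN
  unfold lcoef; split_ifs <;> positivity

lemma rcoef_nonneg {N : ℕ} (hN : 0 < N) (j : ℤ) : 0 ≤ rcoef N j := by
  have := dx_pos hN
  unfold rcoef; split_ifs <;> positivity

lemma lval_mem {N : ℕ} {al fr : ℝ} {c : ℤ → ℝ} {j : ℤ} (hal : al ∈ Icc (0 : ℝ) 1)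
    (hfr : fr ∈ Icc (0 : ℝ) 1) (hc : j ≠ -N → j ≠ 0 → c (j - 1) ∈ Icc (0 : ℝ) 1) :
    lval N al fr c j ∈ Icc (0 : ℝ) 1 := by
  unfold lval; split_ifs with h1 h2
  exacts [hal, hfr, hc h1 h2]

lemma rval_mem {N : ℕ} {ar fl : ℝ} {c : ℤ → ℝ} {j : ℤ} (har : ar ∈ Icc (0 : ℝ) 1)
    (hfl : fl ∈ Icc (0 : ℝ) 1) (hc : j ≠ N - 1 → j ≠ -1 → c (j + 1) ∈ Icc (0 : ℝ) 1) :
    rval N ar fl c j ∈ Icc (0 : ℝ) 1 := by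
  unfold rval; split_ifs with h1 h2
  exacts [har, hfl, hc h1 h2]

/-- Seen from a cell, each edge carries a two-point flux of the layer of that cell. At `x = 0` the
flux must be read from the right layer, which is where `hface` enters. At the outer boundary the
transmissibility is zero: pure convection. -/
lemma flux_left {N M : ℕ} {w : Unknowns} {n : ℕ}
    (hface : P.faceFluxLeft N w n = P.faceFluxRight N w n) {j : ℤ} (hj' : j < N) :
    P.flux N M w n j = P.twoPoint (cellLayer j) (lcoef N j)
      (lval N (P.ulMean M n) (w.face 1 (n + 1)) (w.cell (n + 1)) j) (w.cell (n + 1) j) := by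
  unfold flux lcoef lval twoPoint
  by_cases h1 : j = -(N : ℤ)
  · have : cellLayer j = 0 := by simp [cellLayer]; omega
    simp [h1, h1 ▸ this]
  have h2 : j ≠ N := hj'.ne
  by_cases h3 : j = 0
  · subst h3
    simp only [h1, h2, hface, faceFluxRight, cellLayer, if_false, if_true, lt_irrefl]
    ring
  · simp only [h1, h2, h3, if_false]
    ring

lemma flux_right {N M : ℕ} {w : Unknowns} {n : ℕ} (hN : 0 < N) {j : ℤ} (hj : -(N : ℤ) ≤ j) :
    P.flux N M w n (j + 1) = P.twoPoint (cellLayer j) (rcoef N j)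
      (w.cell (n + 1) j) (rval N (P.urMean M n) (w.face 0 (n + 1)) (w.cell (n + 1)) j) := by
  unfold flux rcoef rval twoPoint
  have h1 : j + 1 ≠ -(N : ℤ) := by omega
  by_cases h2 : j = (N : ℤ) - 1
  · subst h2
    have : cellLayer ((N : ℤ) - 1) = 1 := by simp [cellLayer]; omega
    simp [this, hN.ne']
  have h2' : j + 1 ≠ (N : ℤ) := by omega
  by_cases h3 : j = -1
  · subst h3
    simp only [h1, h2, h2', faceFluxLeft, cellLayer, if_false, if_true]
    norm_num
    ring
  · have h3' : j + 1 ≠ 0 := by omega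
    have : cellLayer (j + 1) = cellLayer j := by
      unfold cellLayer; split_ifs <;> first | rfl | omega
    simp only [h1, h2, h2', h3, h3', if_false, this, add_sub_cancel_right]
    ring

end Problem

namespace Problem.Admissible

variable {P : Problem} (hP : P.Admissible)
include hP

lemma phi_cont (i : Fin 2) : ContinuousOn (P.phi i) (Icc 0 1) := (hP.layers i).phi_cont

lemma phi_mono (i : Fin 2) : StrictMonoOn (P.phi i) (Icc 0 1) := (hP.layers i).phi_strictMono

/-- Convection and diffusion are monotone in the same direction, so no relation between `κ` and the
time step is needed. -/
lemma twoPoint_mono {i : Fin 2} {κ a a' b : ℝ} (hκ : 0 ≤ κ) (ha : a ∈ Icc (0 : ℝ) 1)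
    (ha' : a' ∈ Icc (0 : ℝ) 1) (hb : b ∈ Icc (0 : ℝ) 1) (h : a ≤ a') :
    P.twoPoint i κ a b ≤ P.twoPoint i κ a' b := by
  have h1 := hP.G_mono i b hb ha ha' h
  have h2 := mul_le_mul_of_nonneg_left ((hP.phi_mono i).monotoneOn ha ha' h) hκ
  simp only [twoPoint] at h1 ⊢
  linarith

lemma twoPoint_anti {i : Fin 2} {κ a b b' : ℝ} (hκ : 0 ≤ κ) (ha : a ∈ Icc (0 : ℝ) 1)
    (hb : b ∈ Icc (0 : ℝ) 1) (hb' : b' ∈ Icc (0 : ℝ) 1) (h : b ≤ b') :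
    P.twoPoint i κ a b' ≤ P.twoPoint i κ a b := by
  have h1 := hP.G_anti i a ha hb hb' h
  have h2 := mul_le_mul_of_nonneg_left ((hP.phi_mono i).monotoneOn hb hb' h) hκ
  simp only [twoPoint] at h1 ⊢
  linarith

lemma twoPoint_zero_left {i : Fin 2} {κ b : ℝ} (hκ : 0 ≤ κ) (hb : b ∈ Icc (0 : ℝ) 1) :
    P.twoPoint i κ 0 b ≤ 0 := by
  refine (hP.twoPoint_anti hκ (by simp) (by simp) hb hb.1).trans ?_
  simpa [twoPoint] using hP.G_zero_left i (b := 0) (by simp)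

lemma twoPoint_zero_right {i : Fin 2} {κ a : ℝ} (hκ : 0 ≤ κ) (ha : a ∈ Icc (0 : ℝ) 1) :
    0 ≤ P.twoPoint i κ a 0 := by
  refine le_trans ?_ (hP.twoPoint_mono hκ (by simp) ha (by simp) ha.1)
  simpa [twoPoint] using hP.G_zero_right i (a := 0) (by simp)

lemma twoPoint_one_left {i : Fin 2} {κ b : ℝ} (hκ : 0 ≤ κ) (hb : b ∈ Icc (0 : ℝ) 1) :
    P.q ≤ P.twoPoint i κ 1 b := by
  refine le_trans ?_ (hP.twoPoint_anti hκ (by simp) hb (by simp) hb.2)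
  simpa [twoPoint] using hP.G_one_left i (b := 1) (by simp)

lemma twoPoint_one_right {i : Fin 2} {κ a : ℝ} (hκ : 0 ≤ κ) (ha : a ∈ Icc (0 : ℝ) 1) :
    P.twoPoint i κ a 1 ≤ P.q := by
  refine (hP.twoPoint_mono hκ ha (by simp) (by simp) ha.2).trans ?_
  simpa [twoPoint] using hP.G_one_right i (a := 1) (by simp)

lemma continuous_twoPoint (i : Fin 2) (κ : ℝ) :
    Continuous fun z : ℝ × ℝ => P.twoPoint i κ (clamp z.1) (clamp z.2) := by
  have h := continuous_comp_clamp (hP.phi_cont i)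
  exact (hP.G_cont_clamp i).sub (continuous_const.mul
    ((h.comp continuous_snd).sub (h.comp continuous_fst)))

lemma dt_pos {M : ℕ} (hM : 0 < M) : 0 < P.dt M := by
  have := hP.T_pos
  unfold Problem.dt; positivity

/-- One implicit time step. -/
lemma exists_step {N : ℕ} (hN : 0 < N) {τ al ar : ℝ} (hτ : 0 < τ) (hal : al ∈ Icc (0 : ℝ) 1)
    (har : ar ∈ Icc (0 : ℝ) 1) (c₀ : ℤ → ℝ) (hc₀ : ∀ j, c₀ j ∈ Icc (0 : ℝ) 1) :
    ∃ (c : ℤ → ℝ) (face : Fin 2 → ℝ), (∀ j, c j ∈ Icc (0 : ℝ) 1) ∧ (∀ i, face i ∈ Icc (0 : ℝ) 1) ∧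
      ((P.layer 0).graph (face 0) ∩ (P.layer 1).graph (face 1)).Nonempty ∧
      P.twoPoint 0 (2 / dx N) (c (-1)) (face 0) = P.twoPoint 1 (2 / dx N) (face 1) (c 0) ∧
      ∀ j : ℤ, -(N : ℤ) ≤ j → j < N →
        (P.layer (cellLayer j)).poro * ((c j - c₀ j) / τ) * dx N
          + P.twoPoint (cellLayer j) (rcoef N j) (c j) (rval N ar (face 0) c j)
          - P.twoPoint (cellLayer j) (lcoef N j) (lval N al (face 1) c j) (c j) = 0 := by
  have hdx := dx_pos hN
  choose k hkc hkm hkI hk0 hk1 hkg using fun i => (hP.layers i).exists_graph_inverse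
  -- The range `[A, B]` contains the pressure ranges of both layers, so each graph inverse `k i` is
  -- 0 at `A` and 1 at `B`.
  set A := min ((P.layer 0).pc 0) ((P.layer 1).pc 0) with hA
  set B := max ((P.layer 0).pc 1) ((P.layer 1).pc 1) with hB
  have hAB : A ≤ B := (min_le_left _ _).trans
    (((hP.layers 0).pc_strictMono.monotoneOn (by simp) (by simp) zero_le_one).trans (le_max_left _ _))
  have hA' : ∀ i, A ≤ (P.layer i).pc 0 := fun i => by
    fin_cases i
    exacts [min_le_left _ _, min_le_right _ _]
  have hB' : ∀ i, (P.layer i).pc 1 ≤ B := fun i => by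
    fin_cases i
    exacts [le_max_left _ _, le_max_right _ _]
  -- Both face values are functions of one parameter in `[0,1]`, the rescaled common pressure. They
  -- are non-decreasing in it, and both are 0 at the parameter 0 and 1 at the parameter 1.
  let e : Fin 2 → ℝ → ℝ := fun i s => k i (A + s * (B - A))
  have hec : ∀ i, Continuous (e i) := fun i => (hkc i).comp (by fun_prop)
  have hem : ∀ i, Monotone (e i) := fun i a b hab => hkm i (by
    have := mul_le_mul_of_nonneg_right hab (sub_nonneg.2 hAB); linarith)
  have heI : ∀ i s, e i s ∈ Icc (0 : ℝ) 1 := fun i s => hkI i _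
  have he0 : ∀ i, e i 0 = 0 := fun i => hk0 i _ (by simpa using hA' i)
  have he1 : ∀ i, e i 1 = 1 := fun i => hk1 i _ (by simpa using hB' i)
  let tp : Fin 2 → ℝ → ℝ → ℝ → ℝ := fun i κ a b => P.twoPoint i κ (clamp a) (clamp b)
  have htp : ∀ i κ (f g : (Option ℤ → ℝ) → ℝ), Continuous f → Continuous g →
      Continuous fun v => tp i κ (f v) (g v) := fun i κ f g hf hg =>
    (hP.continuous_twoPoint i κ).comp (hf.prodMk hg)
  let cs : (Option ℤ → ℝ) → ℤ → ℝ := fun v j => v (some j)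
  -- The index `none` is the interface parameter, with the equality of the two interface fluxes as
  -- its equation, written with the sign that makes it decreasing in the neighbouring cells. Indices
  -- outside the mesh get the trivial equation `v = 0`. The truncations inside `tp` make `H`
  -- continuous off the cube as well.
  let H : Option ℤ → (Option ℤ → ℝ) → ℝ := fun o v =>
    match o with
    | none => tp 1 (2 / dx N) (e 1 (v none)) (v (some 0))
        - tp 0 (2 / dx N) (v (some (-1))) (e 0 (v none))
    | some j => if -(N : ℤ) ≤ j ∧ j < N then
        (P.layer (cellLayer j)).poro * ((v (some j) - c₀ j) / τ) * dx N
          + tp (cellLayer j) (rcoef N j) (v (some j)) (rval N ar (e 0 (v none)) (cs v) j)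
          - tp (cellLayer j) (lcoef N j) (lval N al (e 1 (v none)) (cs v) j) (v (some j))
        else v (some j)
  have hlc : ∀ j, Continuous fun v : Option ℤ → ℝ => lval N al (e 1 (v none)) (cs v) j := by
    intro j
    unfold lval
    split_ifs
    exacts [continuous_const, (hec 1).comp (continuous_apply _), continuous_apply _]
  have hrc : ∀ j, Continuous fun v : Option ℤ → ℝ => rval N ar (e 0 (v none)) (cs v) j := by
    intro j
    unfold rval
    split_ifs
    exacts [continuous_const, (hec 0).comp (continuous_apply _), continuous_apply _]
  have hlI : ∀ j v, (∀ i, v i ∈ Icc (0 : ℝ) 1) →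
      lval N al (e 1 (v none)) (cs v) j ∈ Icc (0 : ℝ) 1 := fun j v hv =>
    lval_mem hal (heI _ _) fun _ _ => hv _
  have hrI : ∀ j v, (∀ i, v i ∈ Icc (0 : ℝ) 1) →
      rval N ar (e 0 (v none)) (cs v) j ∈ Icc (0 : ℝ) 1 := fun j v hv =>
    rval_mem har (heI _ _) fun _ _ => hv _
  have hporo : ∀ i, 0 < (P.layer i).poro := fun i => (hP.layers i).poro_mem.1
  have h2 : 0 ≤ 2 / dx N := by positivity
  have key : ∃ v : Option ℤ → ℝ, (∀ i, v i ∈ Icc (0 : ℝ) 1) ∧ ∀ j, H j v = 0 := by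
    refine exists_zero_of_quasimonotone H ?_ ?_ ?_ ?_
    · rintro (_ | j)
      · exact (htp _ _ _ _ ((hec 1).comp (continuous_apply _)) (continuous_apply _)).sub
          (htp _ _ _ _ (continuous_apply _) ((hec 0).comp (continuous_apply _)))
      · simp only [H]
        split_ifs
        · exact (Continuous.add (by fun_prop) (htp _ _ _ _ (continuous_apply (some j)) (hrc j))).sub
            (htp _ _ _ _ (hlc j) (continuous_apply (some j)))
        · exact continuous_apply _
    · rintro (_ | j) v v' hv hv' hvv hj
      · simp only [H, tp, clamp_of_mem (heI _ _), clamp_of_mem (hv _), clamp_of_mem (hv' _), ← hj]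
        have h3 := hP.twoPoint_anti (i := 1) h2 (heI 1 (v none)) (hv (some 0)) (hv' (some 0)) (hvv _)
        have h4 := hP.twoPoint_mono (i := 0) h2 (hv (some (-1))) (hv' (some (-1))) (heI 0 (v none))
          (hvv _)
        linarith
      · simp only [H]
        split_ifs with hjj
        · simp only [tp, clamp_of_mem (hv _), clamp_of_mem (hlI j v hv),
            clamp_of_mem (hrI j v hv), clamp_of_mem (hlI j v' hv'), clamp_of_mem (hrI j v' hv'), ← hj]
          have h3 := hP.twoPoint_anti (i := cellLayer j) (rcoef_nonneg hN j) (hv (some j))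
            (hrI j v hv) (hrI j v' hv') (by
              unfold rval; split_ifs
              exacts [le_rfl, hem 0 (hvv _), hvv _])
          have h4 := hP.twoPoint_mono (i := cellLayer j) (lcoef_nonneg hN j)
            (hlI j v hv) (hlI j v' hv') (hv (some j)) (by
              unfold lval; split_ifs
              exacts [le_rfl, hem 1 (hvv _), hvv _])
          linarith
        · exact hj.ge
    · rintro (_ | j) v hv hj
      · simp only [H, tp, hj, he0, clamp_of_mem (hv _), clamp_of_mem (s := 0) (by simp)]
        have h3 := hP.twoPoint_zero_left (i := 1) h2 (hv (some 0))
        have h4 := hP.twoPoint_zero_right (i := 0) h2 (hv (some (-1)))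
        linarith
      · simp only [H]
        split_ifs with hjj
        · simp only [tp, hj, clamp_of_mem (hlI j v hv), clamp_of_mem (hrI j v hv),
            clamp_of_mem (s := 0) (by simp)]
          have h3 := hP.twoPoint_zero_left (i := cellLayer j) (rcoef_nonneg hN j) (hrI j v hv)
          have h4 := hP.twoPoint_zero_right (i := cellLayer j) (lcoef_nonneg hN j) (hlI j v hv)
          have h5 : (P.layer (cellLayer j)).poro * ((0 - c₀ j) / τ) * dx N ≤ 0 := by
            have h6 : (0 - c₀ j) / τ ≤ 0 :=
              div_nonpos_of_nonpos_of_nonneg (by linarith [(hc₀ j).1]) hτ.le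
            exact mul_nonpos_of_nonpos_of_nonneg
              (mul_nonpos_of_nonneg_of_nonpos (hporo _).le h6) hdx.le
          linarith
        · exact hj.le
    · rintro (_ | j) v hv hj
      · simp only [H, tp, hj, he1, clamp_of_mem (hv _), clamp_of_mem (s := 1) (by simp)]
        have h3 := hP.twoPoint_one_left (i := 1) h2 (hv (some 0))
        have h4 := hP.twoPoint_one_right (i := 0) h2 (hv (some (-1)))
        linarith
      · simp only [H]
        split_ifs with hjj
        · simp only [tp, hj, clamp_of_mem (hlI j v hv), clamp_of_mem (hrI j v hv),
            clamp_of_mem (s := 1) (by simp)]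
          have h3 := hP.twoPoint_one_left (i := cellLayer j) (rcoef_nonneg hN j) (hrI j v hv)
          have h4 := hP.twoPoint_one_right (i := cellLayer j) (lcoef_nonneg hN j) (hlI j v hv)
          have h5 : 0 ≤ (P.layer (cellLayer j)).poro * ((1 - c₀ j) / τ) * dx N := by
            have h6 : 0 ≤ 1 - c₀ j := by linarith [(hc₀ j).2]
            have := hporo (cellLayer j)
            positivity
          linarith
        · rw [hj]; exact zero_le_one
  obtain ⟨v, hvI, hv⟩ := key
  refine ⟨cs v, fun i => e i (v none), fun j => hvI _, fun i => heI _ _,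
    ⟨A + v none * (B - A), (hkg 0 _ _).2 rfl, (hkg 1 _ _).2 rfl⟩, ?_, fun j hj hj' => ?_⟩
  · have := hv none
    simp only [H, tp, clamp_of_mem (heI _ _), clamp_of_mem (hvI _)] at this
    simp only [cs]; linarith
  · have := hv (some j)
    simp only [H, tp, hj, hj', and_self, if_true, clamp_of_mem (hvI _), clamp_of_mem (hlI j v hvI),
      clamp_of_mem (hrI j v hvI)] at this
    exact this

lemma u0Mean_mem {N : ℕ} (hN : 0 < N) {j : ℤ} (hj : -(N : ℤ) ≤ j) (hj' : j < N) :
    P.u0Mean N j ∈ Icc (0 : ℝ) 1 := by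
  have hdx := dx_pos hN
  have hNdx : (N : ℝ) * dx N = 1 := by unfold dx; field_simp
  have h1 : (-(N : ℝ)) ≤ j := by exact_mod_cast hj
  have h2 : (j : ℝ) + 1 ≤ N := by exact_mod_cast hj'
  have := interval_mean_mem (f := P.u0) (a := j * dx N) (b := (j + 1) * dx N) (by nlinarith)
    (ae_mono (Measure.restrict_mono (Ioo_subset_Ioo (by nlinarith) (by nlinarith)) le_rfl) hP.u0_mem)
  rwa [show (j + 1) * dx N - j * dx N = dx N by ring] at this

lemma time_subset {M n : ℕ} (hM : 0 < M) (hn : n < M) :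
    Ioo (n * P.dt M) ((n + 1) * P.dt M) ⊆ Ioo 0 P.T := by
  have hdt := hP.dt_pos hM
  have hMdt : (M : ℝ) * P.dt M = P.T := by unfold Problem.dt; field_simp
  have h2 : (n : ℝ) + 1 ≤ M := by exact_mod_cast hn
  exact Ioo_subset_Ioo (by positivity) (by nlinarith)

lemma ulMean_mem {M n : ℕ} (hM : 0 < M) (hn : n < M) : P.ulMean M n ∈ Icc (0 : ℝ) 1 := by
  have := interval_mean_mem (f := P.ul) (a := n * P.dt M) (b := (n + 1) * P.dt M)
    (by have := hP.dt_pos hM; nlinarith)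
    (ae_mono (Measure.restrict_mono (hP.time_subset hM hn) le_rfl) hP.ul_mem)
  rwa [show (n + 1) * P.dt M - n * P.dt M = P.dt M by ring] at this

lemma urMean_mem {M n : ℕ} (hM : 0 < M) (hn : n < M) : P.urMean M n ∈ Icc (0 : ℝ) 1 := by
  have := interval_mean_mem (f := P.ur) (a := n * P.dt M) (b := (n + 1) * P.dt M)
    (by have := hP.dt_pos hM; nlinarith)
    (ae_mono (Measure.restrict_mono (hP.time_subset hM hn) le_rfl) hP.ur_mem)
  rwa [show (n + 1) * P.dt M - n * P.dt M = P.dt M by ring] at this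

theorem exists_schemeSolution {N M : ℕ} (hN : 0 < N) (hM : 0 < M) :
    ∃ w : Unknowns, P.IsSchemeSolution N M w := by
  have hdt := hP.dt_pos hM
  -- The boundary means lie in `[0,1]` only for `n < M`. Truncating them makes the recursion total,
  -- and the truncation is removed below for `n < M`.
  have step := fun (n : ℕ) (c₀ : {c : ℤ → ℝ // ∀ j, c j ∈ Icc (0 : ℝ) 1}) =>
    hP.exists_step hN (al := clamp (P.ulMean M n)) (ar := clamp (P.urMean M n)) hdt
      (clamp_mem _) (clamp_mem _) c₀.1 c₀.2
  choose c face hc hface hgraph hff hbal using step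
  let lev : ℕ → {c : ℤ → ℝ // ∀ j, c j ∈ Icc (0 : ℝ) 1} := fun n =>
    Nat.rec ⟨fun j => clamp (P.u0Mean N j), fun j => clamp_mem _⟩ (fun n c₀ => ⟨c n c₀, hc n c₀⟩) n
  -- The step from level `n` produces the face values of level `n + 1`, hence the shift by one.
  let w : Unknowns := ⟨fun n => (lev n).1, fun i n => face (n - 1) (lev (n - 1)) i⟩
  have hfl : ∀ n, P.faceFluxLeft N w n = P.twoPoint 0 (2 / dx N) (w.cell (n + 1) (-1))
      (w.face 0 (n + 1)) := fun n => by unfold faceFluxLeft twoPoint; ring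
  have hfr : ∀ n, P.faceFluxRight N w n = P.twoPoint 1 (2 / dx N) (w.face 1 (n + 1))
      (w.cell (n + 1) 0) := fun n => by unfold faceFluxRight twoPoint; ring
  have hF : ∀ n, P.faceFluxLeft N w n = P.faceFluxRight N w n := fun n => by
    rw [hfl, hfr]; exact hff n (lev n)
  refine ⟨w, fun n _ j _ _ => (lev n).2 j, fun n _ i => hface _ _ i, fun j hj hj' => ?_,
    fun n hn j hj hj' => ?_, fun n _ => hF n, fun n _ => hgraph n (lev n)⟩
  · exact clamp_of_mem (hP.u0Mean_mem hN hj hj')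
  · rw [P.flux_left (hF n) hj', P.flux_right hN hj]
    have := hbal n (lev n) j hj hj'
    rw [clamp_of_mem (hP.ulMean_mem hM hn), clamp_of_mem (hP.urMean_mem hM hn)] at this
    exact this

end Problem.Admissible
end TwoPhase
-- The discrete energy estimate.
namespace TwoPhase

/-- Primitive of the capillary pressure. -/
def Layer.pcPrim (L : Layer) (s : ℝ) : ℝ := ∫ a in (0 : ℝ)..s, L.pc a

/-- The primitive of an increasing function is convex, and this is its tangent inequality at `b`. It
turns the implicit time difference, multiplied by the pressure at the new level, into a telescoping
sum. -/
lemma Layer.Admissible.pcPrim_sub_le {L : Layer} (hL : L.Admissible) {a b : ℝ}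
    (ha : a ∈ Icc (0 : ℝ) 1) (hb : b ∈ Icc (0 : ℝ) 1) :
    L.pcPrim b - L.pcPrim a ≤ (b - a) * L.pc b := by
  have hint : ∀ a ∈ Icc (0 : ℝ) 1, ∀ b ∈ Icc (0 : ℝ) 1, IntervalIntegrable L.pc volume a b :=
    fun a ha b hb => (hL.pc_cont.mono (uIcc_subset_Icc ha hb)).intervalIntegrable
  have h0 : L.pcPrim b - L.pcPrim a = ∫ x in a..b, L.pc x :=
    intervalIntegral.integral_interval_sub_left (hint 0 (by simp) b hb) (hint 0 (by simp) a ha)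
  have hm := hL.pc_strictMono.monotoneOn
  rw [h0]
  rcases le_total a b with h | h
  · have := intervalIntegral.integral_mono_on h (hint a ha b hb) (intervalIntegrable_const (c := L.pc b))
      fun x hx => hm ⟨ha.1.trans hx.1, hx.2.trans hb.2⟩ hb hx.2
    simpa using this
  · have := intervalIntegral.integral_mono_on h (intervalIntegrable_const (c := L.pc b)) (hint b hb a ha)
      fun x hx => hm hb ⟨hb.1.trans hx.1, hx.2.trans ha.2⟩ hx.1
    rw [intervalIntegral.integral_symm]
    simp only [intervalIntegral.integral_const, smul_eq_mul] at this
    linarith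

lemma Layer.Admissible.pcPrim_cont {L : Layer} (hL : L.Admissible) :
    ContinuousOn L.pcPrim (Icc 0 1) := by
  have := ((hL.pc_cont.mono (uIcc_subset_Icc (by simp) (by simp) :
    uIcc (0 : ℝ) 1 ⊆ Icc 0 1)).intervalIntegrable (μ :=
      volume)).absolutelyContinuousOnInterval_intervalIntegral (c := 0) (by simp)
  simpa [uIcc_of_le] using! this.continuousOn

/-- Summation by parts with a one-sided bound of the terms of the transformed sum. -/
lemma summation_by_parts_le (F p W e : ℤ → ℝ) (a : ℤ) (m : ℕ)
    (h : ∀ k < m, F (a + k + 1) * (p (a + k + 1) - p (a + k)) ≤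
      W (a + k + 1) - W (a + k) - e (a + k + 1)) :
    F (a + m + 1) * p (a + m) - F a * p a - (W (a + m) - W a)
      + ∑ k ∈ Finset.range m, e (a + k + 1) ≤
      ∑ k ∈ Finset.range (m + 1), (F (a + k + 1) - F (a + k)) * p (a + k) := by
  induction m with
  | zero => simp [sub_mul]
  | succ m ih =>
    have h1 := ih fun k hk => h k (hk.trans (Nat.lt_succ_self m))
    have h2 := h m (Nat.lt_succ_self m)
    rw [Finset.sum_range_succ, Finset.sum_range_succ _ (m + 1)]
    push_cast
    simp only [← add_assoc]
    linarith

/-- The layers are summed separately, since the pressure law changes at `x = 0` and summation by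
parts is carried out inside one layer. -/
lemma sum_cells_eq (N : ℕ) (h : ℤ → ℝ) :
    ∑ j ∈ Finset.Ico (-(N : ℤ)) N, h j =
      ∑ k ∈ Finset.range N, h (-(N : ℤ) + k) + ∑ k ∈ Finset.range N, h (0 + k) := by
  have key : ∀ a : ℤ, ∑ k ∈ Finset.range N, h (a + k) = ∑ j ∈ Finset.Ico a (a + N), h j := by
    intro a
    refine Finset.sum_bij (fun k _ => a + k) ?_ ?_ ?_ ?_
    · intro k hk; simp at hk ⊢; omega
    · intro k _ l _ hkl; simpa using hkl
    · intro j hj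
      simp only [Finset.mem_Ico] at hj
      exact ⟨(j - a).toNat, by simp; omega, by simp only [Int.toNat_sub_of_le hj.1]; omega⟩
    · intros; rfl
  rw [key, key, neg_add_cancel, zero_add]
  rw [← Finset.sum_union (Finset.Ico_disjoint_Ico_consecutive _ _ _),
    Finset.Ico_union_Ico_eq_Ico (by omega) (by omega)]

namespace Problem

variable (P : Problem)

/-- Discrete gradient of `φ(u)` at the left edge of the cell `j`, at time level `n + 1`. -/
def gradL (N M : ℕ) (w : Unknowns) (n : ℕ) (j : ℤ) : ℝ :=
  lcoef N j * (P.phi (cellLayer j) (w.cell (n + 1) j) - P.phi (cellLayer j)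
    (lval N (P.ulMean M n) (w.face 1 (n + 1)) (w.cell (n + 1)) j))

/-- Discrete gradient of `φ(u)` at the right edge of the cell `j`, at time level `n + 1`. -/
def gradR (N M : ℕ) (w : Unknowns) (n : ℕ) (j : ℤ) : ℝ :=
  rcoef N j * (P.phi (cellLayer j) (rval N (P.urMean M n) (w.face 0 (n + 1)) (w.cell (n + 1)) j)
    - P.phi (cellLayer j) (w.cell (n + 1) j))

/-- Discrete Dirichlet energy of `φ(u)` at time level `n + 1`. -/
def energy (N M : ℕ) (w : Unknowns) (n : ℕ) : ℝ :=
  ∑ j ∈ Finset.Ico (-(N : ℤ)) N, dx N * (P.gradL N M w n j ^ 2 + P.gradR N M w n j ^ 2)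

end Problem

namespace Problem.Admissible

variable {P : Problem} (hP : P.Admissible)
include hP

/-- Convection contributes at most an exact difference, which telescopes over the cells of a layer.
Diffusion contributes the dissipation. The constant `c` is independent of `κ`, hence of the mesh. -/
lemma exists_twoPoint_mul_pc_le : ∃ c, 0 < c ∧ ∀ i κ, 0 ≤ κ → ∀ a ∈ Icc (0 : ℝ) 1,
    ∀ b ∈ Icc (0 : ℝ) 1, P.twoPoint i κ a b * ((P.layer i).pc b - (P.layer i).pc a) ≤
      (P.layer i).weighted (P.f i) b - (P.layer i).weighted (P.f i) a
        - c * (κ * (P.phi i b - P.phi i a) ^ 2) := by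
  choose c hc hphi using fun i => (hP.layers i).exists_phi_sub_sq_le
  refine ⟨min (c 0) (c 1), lt_min (hc 0) (hc 1), fun i κ hκ a ha b hb => ?_⟩
  have h1 := hP.G_mul_pc_le i ha hb
  have h2 := hphi i a ha b hb
  have h3 : min (c 0) (c 1) ≤ c i := by
    fin_cases i
    exacts [min_le_left _ _, min_le_right _ _]
  have h4 := mul_le_mul_of_nonneg_right h3 (sq_nonneg (P.phi i b - P.phi i a))
  have h5 := mul_le_mul_of_nonneg_left (h4.trans h2) hκ
  change _ ≤ κ * ((P.phi i b - P.phi i a) * _) at h5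
  unfold twoPoint
  linarith

/-- The interface flux does not produce energy, up to a constant. -/
lemma interface_mul_pc_le {κ a b s t D : ℝ} (hκ : 0 ≤ κ) (ha : a ∈ Icc (0 : ℝ) 1)
    (hb : b ∈ Icc (0 : ℝ) 1)
    (hD : ∀ i, ∀ s ∈ Icc (0 : ℝ) 1, |(P.layer i).pc s| ≤ D)
    (hs : s ∈ Icc (0 : ℝ) 1) (ht : t ∈ Icc (0 : ℝ) 1)
    (heq : P.twoPoint 0 κ a s = P.twoPoint 1 κ t b)
    (hst : ((P.layer 0).graph s ∩ (P.layer 1).graph t).Nonempty) :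
    P.twoPoint 0 κ a s * ((P.layer 1).pc t - (P.layer 0).pc s) ≤ |P.q| * (2 * D) := by
  have hs0 : s = 0 → 0 ≤ P.twoPoint 0 κ a s := fun h => h ▸ hP.twoPoint_zero_right hκ ha
  have hs1 : s = 1 → P.twoPoint 0 κ a s ≤ P.q := fun h => h ▸ hP.twoPoint_one_right hκ ha
  have ht0 : t = 0 → P.twoPoint 0 κ a s ≤ 0 := fun h => by
    rw [heq, h]; exact hP.twoPoint_zero_left hκ hb
  have ht1 : t = 1 → P.q ≤ P.twoPoint 0 κ a s := fun h => by
    rw [heq, h]; exact hP.twoPoint_one_left hκ hb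
  generalize P.twoPoint 0 κ a s = F at *
  have hm0 := (hP.layers 0).pc_strictMono.monotoneOn (show (0 : ℝ) ∈ Icc 0 1 by simp)
    (show (1 : ℝ) ∈ Icc 0 1 by simp) zero_le_one
  have hm1 := (hP.layers 1).pc_strictMono.monotoneOn (show (0 : ℝ) ∈ Icc 0 1 by simp)
    (show (1 : ℝ) ∈ Icc 0 1 by simp) zero_le_one
  have hx := abs_le.1 (hD 0 s hs)
  have hy := abs_le.1 (hD 1 t ht)
  have hq1 := le_abs_self P.q
  have hq2 := neg_abs_le P.q
  have hq0 := abs_nonneg P.q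
  have hD0 : 0 ≤ D := (abs_nonneg _).trans (hD 0 s hs)
  have hpos : 0 ≤ |P.q| * (2 * D) := by positivity
  -- If both face values are interior, the common pressure `p` makes the jump vanish. A face value 0
  -- or 1 fixes the sign of `F` or of `F - q`, and its half-line in the graph constrains the jump.
  -- The product is then at most 0 or at most `q` times the jump, which is bounded by `2 D`.
  obtain ⟨p, hp0, hp1⟩ := hst
  rcases hp0 with ⟨-, -, h0⟩ | ⟨h0, h0'⟩ | ⟨h0, h0'⟩ <;>
    rcases hp1 with ⟨-, -, h1⟩ | ⟨h1, h1'⟩ | ⟨h1, h1'⟩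
  · rw [← h0, ← h1]; simpa using hpos
  · have := ht0 h1
    subst h1
    nlinarith
  · have := ht1 h1
    subst h1
    nlinarith
  · have := hs0 h0
    subst h0
    nlinarith
  · have := hs0 h0
    have := ht0 h1
    have : F = 0 := by linarith
    rw [this]; simpa using hpos
  · have := hs0 h0
    have := ht1 h1
    subst h0 h1
    nlinarith
  · have := hs1 h0
    subst h0
    nlinarith
  · have := hs1 h0
    have := ht0 h1
    subst h0 h1
    nlinarith
  · have := hs1 h0
    have := ht1 h1
    have : F = P.q := by linarith
    rw [this]
    nlinarith

end Problem.Admissible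

namespace Problem.IsSchemeSolution

variable {P : Problem} {N M : ℕ} {w : Unknowns} (hw : P.IsSchemeSolution N M w)
  (hP : P.Admissible) (hN : 0 < N) (hM : 0 < M)
include hw hP hM

lemma lval_mem {n : ℕ} (hn : n < M) {j : ℤ} (hj : -(N : ℤ) ≤ j) (hj' : j < N) :
    lval N (P.ulMean M n) (w.face 1 (n + 1)) (w.cell (n + 1)) j ∈ Icc (0 : ℝ) 1 :=
  Problem.lval_mem (hP.ulMean_mem hM hn) (hw.face_mem n hn 1) fun h1 _ =>
    hw.cell_mem (n + 1) hn _ (by omega) (by omega)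

lemma rval_mem {n : ℕ} (hn : n < M) {j : ℤ} (hj : -(N : ℤ) ≤ j) (hj' : j < N) :
    rval N (P.urMean M n) (w.face 0 (n + 1)) (w.cell (n + 1)) j ∈ Icc (0 : ℝ) 1 :=
  Problem.rval_mem (hP.urMean_mem hM hn) (hw.face_mem n hn 0) fun h1 _ =>
    hw.cell_mem (n + 1) hn _ (by omega) (by omega)

include hN

lemma abs_flux_le {C : ℝ}
    (hC : ∀ i, ∀ a ∈ Icc (0 : ℝ) 1, ∀ b ∈ Icc (0 : ℝ) 1, |P.G i a b| ≤ C) {n : ℕ} (hn : n < M) :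
    |P.flux N M w n (-(N : ℤ))| ≤ C ∧ |P.flux N M w n N| ≤ C := by
  have h1 : (N : ℤ) ≠ -N := by omega
  simp only [flux, if_true, h1, if_false]
  exact ⟨hC 0 _ (hP.ulMean_mem hM hn) _ (hw.cell_mem _ hn _ (by omega) (by omega)),
    hC 1 _ (hw.cell_mem _ hn _ (by omega) (by omega)) _ (hP.urMean_mem hM hn)⟩

/-- Dissipation of the discrete fluxes at one time level. -/
lemma energy_le_sum_flux {c D CG CW : ℝ}
    (hcc : ∀ i κ, 0 ≤ κ → ∀ a ∈ Icc (0 : ℝ) 1,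
      ∀ b ∈ Icc (0 : ℝ) 1, P.twoPoint i κ a b * ((P.layer i).pc b - (P.layer i).pc a) ≤
      (P.layer i).weighted (P.f i) b - (P.layer i).weighted (P.f i) a
        - c * (κ * (P.phi i b - P.phi i a) ^ 2))
    (hD : ∀ i, ∀ s ∈ Icc (0 : ℝ) 1, |(P.layer i).pc s| ≤ D)
    (hCG : ∀ i, ∀ a ∈ Icc (0 : ℝ) 1, ∀ b ∈ Icc (0 : ℝ) 1, |P.G i a b| ≤ CG)
    (hCW : ∀ i, ∀ s ∈ Icc (0 : ℝ) 1, |(P.layer i).weighted (P.f i) s| ≤ CW)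
    {n : ℕ} (hn : n < M) :
    c / 2 * P.energy N M w n ≤ ∑ j ∈ Finset.Ico (-(N : ℤ)) N,
      (P.flux N M w n (j + 1) - P.flux N M w n j) * (P.layer (cellLayer j)).pc (w.cell (n + 1) j)
      + (|P.q| * (2 * D) + 2 * CG * D + 4 * CW) := by
  have hdx := dx_pos hN
  set u := w.cell (n + 1) with hu
  set F := P.flux N M w n with hF
  have hu01 : ∀ j : ℤ, -(N : ℤ) ≤ j → j < N → u j ∈ Icc (0 : ℝ) 1 := fun j => hw.cell_mem (n + 1) hn j
  have hs := hw.face_mem n hn 0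
  have ht := hw.face_mem n hn 1
  have hu0 := hu01 0 (by omega) (by omega)
  have hum := hu01 (-1) (by omega) (by omega)
  have hF0 : F 0 = P.twoPoint 0 (2 / dx N) (u (-1)) (w.face 0 (n + 1)) := by
    simp only [hF, hu, flux, faceFluxLeft, twoPoint]
    rw [if_neg (by omega), if_neg (by omega), if_pos trivial]; ring
  have hF0' : F 0 = P.twoPoint 1 (2 / dx N) (w.face 1 (n + 1)) (u 0) := by
    simp only [hF, hu, flux, hw.face_flux n hn, faceFluxRight, twoPoint]
    rw [if_neg (by omega), if_neg (by omega), if_pos trivial]; ring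
  let p : ℤ → ℝ := fun j => (P.layer (cellLayer j)).pc (u j)
  let W : ℤ → ℝ := fun j => (P.layer (cellLayer j)).weighted (P.f (cellLayer j)) (u j)
  let gl := P.gradL N M w n
  let gr := P.gradR N M w n
  have hsame : ∀ j : ℤ, -(N : ℤ) < j → j < N → j ≠ 0 →
      cellLayer (j - 1) = cellLayer j ∧ gr (j - 1) = gl j ∧
      F j * (p j - p (j - 1)) ≤ W j - W (j - 1) - c * (dx N * gl j ^ 2) := by
    intro j h1 h2 h3
    have hl : cellLayer (j - 1) = cellLayer j := by
      unfold cellLayer; split_ifs <;> first | rfl | omega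
    have hlc : lcoef N j = 1 / dx N := by
      unfold lcoef; rw [if_neg (by omega), if_neg h3]
    have hlv : lval N (P.ulMean M n) (w.face 1 (n + 1)) u j = u (j - 1) := by
      unfold lval; rw [if_neg (by omega), if_neg h3]
    refine ⟨hl, ?_, ?_⟩
    · simp only [gl, gr, gradL, gradR, hl, hlc, ← hu, hlv]
      unfold rcoef rval
      rw [if_neg (by omega), if_neg (by omega), if_neg (by omega), if_neg (by omega),
        sub_add_cancel]
    · have h4 : F j = P.twoPoint (cellLayer j) (1 / dx N) (u (j - 1)) (u j) := by
        rw [hF, P.flux_left (hw.face_flux n hn) h2, hlc, ← hu, hlv]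
      have h5 := hcc (cellLayer j) (1 / dx N) (by positivity) _ (hu01 (j - 1) (by omega) (by omega))
        _ (hu01 j h1.le h2)
      have h6 : dx N * gl j ^ 2 = 1 / dx N * (P.phi (cellLayer j) (u j)
          - P.phi (cellLayer j) (u (j - 1))) ^ 2 := by
        simp only [gl, gradL, hlc, ← hu, hlv]; field_simp
      simp only [p, W, h4, hl, h6]
      exact h5
  have hS := fun (a : ℤ) (ha : a = -(N : ℤ) ∨ a = 0) =>
    summation_by_parts_le F p W (fun j => c * (dx N * gl j ^ 2)) a (N - 1) fun k hk => by
      have := (hsame (a + k + 1) (by omega) (by omega) (by omega)).2.2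
      rwa [add_sub_cancel_right] at this
  -- Each interior edge of a layer is counted twice in the energy, as the right edge of one cell and
  -- the left edge of the next. This is why the estimate carries `c / 2`.
  have hE := fun (a : ℤ) (ha : a = -(N : ℤ) ∨ a = 0) =>
    show ∑ k ∈ Finset.range N, dx N * (gl (a + k) ^ 2 + gr (a + k) ^ 2) =
      2 * ∑ k ∈ Finset.range (N - 1), dx N * gl (a + k + 1) ^ 2 + dx N * gl a ^ 2
        + dx N * gr (a + (N - 1 : ℕ)) ^ 2 by
      obtain ⟨m, rfl⟩ : ∃ m, N = m + 1 := ⟨N - 1, by omega⟩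
      simp only [mul_add, Finset.sum_add_distrib, Nat.add_sub_cancel]
      rw [Finset.sum_range_succ', Finset.sum_range_succ (fun k : ℕ => dx (m + 1) * gr (a + k) ^ 2)]
      have : ∀ k ∈ Finset.range m, dx (m + 1) * gr (a + k) ^ 2 = dx (m + 1) * gl (a + k + 1) ^ 2 := by
        intro k hk
        have hk' := Finset.mem_range.1 hk
        have := (hsame (a + k + 1) (by omega) (by push_cast at *; omega) (by push_cast at *; omega)).2.1
        rw [add_sub_cancel_right] at this
        rw [this]
      rw [Finset.sum_congr rfl this]
      push_cast
      simp only [add_assoc, add_zero]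
      ring
  have hglN : gl (-(N : ℤ)) = 0 := by simp [gl, gradL, lcoef]
  have hgrN : gr (0 + (N - 1 : ℕ)) = 0 := by
    simp only [gr, gradR, rcoef]
    rw [if_pos (by omega), zero_mul]
  -- The interface half-edge belongs to one cell of the layer only, but `δx (2/δx)² = 2 (2/δx)`
  -- produces the same factor two as for interior edges.
  have hgl0 : dx N * gl 0 ^ 2 = 2 * (2 / dx N * (P.phi 1 (u 0) - P.phi 1 (w.face 1 (n + 1))) ^ 2) := by
    have : (0 : ℤ) ≠ -(N : ℤ) := by omega
    simp only [gl, gradL, lcoef, lval, cellLayer, this, if_false, if_true, lt_irrefl, ← hu]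
    field_simp
  have hgr0 : dx N * gr (-1) ^ 2
      = 2 * (2 / dx N * (P.phi 0 (w.face 0 (n + 1)) - P.phi 0 (u (-1))) ^ 2) := by
    simp only [gr, gradR, rcoef, rval, cellLayer, ← hu]
    have h1 : ¬ (-1 : ℤ) = N - 1 := by omega
    have h2 : (-1 : ℤ) < 0 := by omega
    simp only [h1, h2, if_true, if_false]
    field_simp
  have h2dx : 0 ≤ 2 / dx N := by positivity
  have hi0 := hcc 0 (2 / dx N) h2dx _ hum _ hs
  have hi1 := hcc 1 (2 / dx N) h2dx _ ht _ hu0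
  have hint := hP.interface_mul_pc_le h2dx hum hu0 hD hs ht (hF0 ▸ hF0') (hw.face_graph n hn)
  rw [← hF0] at hi0 hint
  rw [← hF0'] at hi1
  have hS0 := hS (-(N : ℤ)) (Or.inl rfl)
  have hS1 := hS 0 (Or.inr rfl)
  have hE0 := hE (-(N : ℤ)) (Or.inl rfl)
  have hE1 := hE 0 (Or.inr rfl)
  rw [Nat.sub_add_cancel hN, ← Finset.mul_sum] at hS0 hS1
  have e1 : -(N : ℤ) + ((N - 1 : ℕ) : ℤ) = -1 := by omega
  have e2 : (0 : ℤ) + ((N - 1 : ℕ) : ℤ) = N - 1 := by omega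
  rw [e1] at hS0 hE0
  rw [hgrN] at hE1
  rw [e2] at hS1
  rw [hglN] at hE0
  rw [neg_add_cancel] at hS0
  rw [sub_add_cancel] at hS1
  have hp1 : p (-1) = (P.layer 0).pc (u (-1)) := by simp [p, cellLayer]
  have hp0 : p 0 = (P.layer 1).pc (u 0) := by simp [p, cellLayer]
  have hW1 : W (-1) = (P.layer 0).weighted (P.f 0) (u (-1)) := by simp [W, cellLayer]
  have hW0 : W 0 = (P.layer 1).weighted (P.f 1) (u 0) := by simp [W, cellLayer]
  have hflux := hw.abs_flux_le hP hN hM hCG hn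
  have hbd : ∀ j : ℤ, -(N : ℤ) ≤ j → j < N → ∀ f, |f| ≤ CG → |f * p j| ≤ CG * D := by
    intro j h1 h2 f hf
    rw [abs_mul]
    exact mul_le_mul hf (hD _ _ (hu01 j h1 h2)) (abs_nonneg _) ((abs_nonneg _).trans hf)
  have hb1 := abs_le.1 (hbd (-(N : ℤ)) le_rfl (by omega) _ hflux.1)
  have hb2 := abs_le.1 (hbd ((N : ℤ) - 1) (by omega) (by omega) _ hflux.2)
  have hw1 := abs_le.1 (hCW (cellLayer (-(N : ℤ))) _ (hu01 (-(N : ℤ)) le_rfl (by omega)))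
  have hw2 := abs_le.1 (hCW (cellLayer ((N : ℤ) - 1)) _ (hu01 ((N : ℤ) - 1) (by omega) (by omega)))
  have hw3 := abs_le.1 (hCW 0 _ hs)
  have hw4 := abs_le.1 (hCW 1 _ ht)
  have hen : P.energy N M w n = _ := sum_cells_eq N _
  rw [sum_cells_eq, hen]
  change c / 2 * (∑ k ∈ Finset.range N, dx N * (gl (-(N : ℤ) + k) ^ 2 + gr (-(N : ℤ) + k) ^ 2)
    + ∑ k ∈ Finset.range N, dx N * (gl (0 + k) ^ 2 + gr (0 + k) ^ 2)) ≤
    ∑ k ∈ Finset.range N, (F (-(N : ℤ) + k + 1) - F (-(N : ℤ) + k)) * p (-(N : ℤ) + k)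
    + ∑ k ∈ Finset.range N, (F (0 + k + 1) - F (0 + k)) * p (0 + k) + _
  rw [hE0, hE1, hgl0, hgr0]
  simp only [hp1, hp0, hW1, hW0] at *
  change _ ≤ F (-(N : ℤ)) * p (-(N : ℤ)) ∧ F (-(N : ℤ)) * p (-(N : ℤ)) ≤ _ at hb1
  change _ ≤ F N * p (N - 1) ∧ F N * p (N - 1) ≤ _ at hb2
  change _ ≤ W (-(N : ℤ)) ∧ W (-(N : ℤ)) ≤ _ at hw1
  change _ ≤ W (N - 1) ∧ W (N - 1) ≤ _ at hw2
  linarith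

end Problem.IsSchemeSolution

/-- The balance is tested with the capillary pressure of the new saturation. The time term
telescopes to `B 0 - B M`, which is bounded. Interface, boundary and convection terms cost at most
`K` per unit of time. No constant depends on `N` or `M`. -/
theorem Problem.Admissible.exists_energy_bound {P : Problem} (hP : P.Admissible) :
    ∃ C, 0 ≤ C ∧ ∀ (N M : ℕ) (w : Problem.Unknowns), 0 < N → 0 < M → P.IsSchemeSolution N M w →
      ∑ n ∈ Finset.range M, P.dt M * P.energy N M w n ≤ C := by
  obtain ⟨c, hc, hcc⟩ := hP.exists_twoPoint_mul_pc_le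
  obtain ⟨CG, hCG0, hCG⟩ := hP.exists_G_bound
  choose D hD0 hD using fun i => exists_abs_le_of_continuousOn (hP.layers i).pc_cont
  choose V hV0 hV using fun i => exists_abs_le_of_continuousOn
    ((hP.layers i).weighted_cont (hP.f_cont i))
  choose Q hQ0 hQ using fun i => exists_abs_le_of_continuousOn (hP.layers i).pcPrim_cont
  have hsum : ∀ (f : Fin 2 → ℝ), (∀ i, 0 ≤ f i) → ∀ i, f i ≤ f 0 + f 1 := fun f hf i => by
    fin_cases i
    exacts [le_add_of_nonneg_right (hf 1), le_add_of_nonneg_left (hf 0)]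
  set K := |P.q| * (2 * (D 0 + D 1)) + 2 * CG * (D 0 + D 1) + 4 * (V 0 + V 1) with hK
  have hK0 : 0 ≤ K := by
    have := hD0 0; have := hD0 1; have := hV0 0; have := hV0 1
    positivity
  have hT := hP.T_pos
  refine ⟨2 / c * (K * P.T + 4 * (Q 0 + Q 1)), ?_, fun N M w hN hM hw => ?_⟩
  · have := hQ0 0; have := hQ0 1
    positivity
  have hdt := hP.dt_pos hM
  have hdx := Problem.dx_pos hN
  let B : ℕ → ℝ := fun n => ∑ j ∈ Finset.Ico (-(N : ℤ)) N,
    (P.layer (Problem.cellLayer j)).poro * dx N * (P.layer (Problem.cellLayer j)).pcPrim (w.cell n j)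
  -- The total length of the cells is 2 and the porosity is less than 1.
  have hB : ∀ n ≤ M, |B n| ≤ 2 * (Q 0 + Q 1) := by
    intro n hn
    refine (Finset.abs_sum_le_sum_abs _ _).trans ?_
    have h1 : ∀ j ∈ Finset.Ico (-(N : ℤ)) N, |(P.layer (Problem.cellLayer j)).poro * dx N *
        (P.layer (Problem.cellLayer j)).pcPrim (w.cell n j)| ≤ dx N * (Q 0 + Q 1) := by
      intro j hj
      rw [Finset.mem_Ico] at hj
      have h2 := (hP.layers (Problem.cellLayer j)).poro_mem
      rw [abs_mul, abs_of_pos (mul_pos h2.1 hdx)]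
      refine mul_le_mul (by nlinarith [h2.2]) ((hQ _ _ (hw.cell_mem n hn j hj.1 hj.2)).trans
        (hsum Q hQ0 _)) (abs_nonneg _) hdx.le
    refine (Finset.sum_le_sum h1).trans_eq ?_
    rw [Finset.sum_const, Int.card_Ico, nsmul_eq_mul]
    have : (((N : ℤ) - -(N : ℤ)).toNat : ℝ) = 2 * N := by
      have : ((N : ℤ) - -(N : ℤ)).toNat = 2 * N := by omega
      rw [this]; push_cast; ring
    rw [this]
    unfold Problem.dx
    field_simp
  have hstep : ∀ n < M, P.dt M * P.energy N M w n ≤ 2 / c * (P.dt M * K + (B n - B (n + 1))) := by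
    intro n hn
    have h1 := hw.energy_le_sum_flux hP hN hM hcc (fun i s hs => (hD i s hs).trans (hsum D hD0 i))
      hCG (fun i s hs => (hV i s hs).trans (hsum V hV0 i)) hn
    have h2 : P.dt M * ∑ j ∈ Finset.Ico (-(N : ℤ)) N,
        (P.flux N M w n (j + 1) - P.flux N M w n j) *
          (P.layer (Problem.cellLayer j)).pc (w.cell (n + 1) j) ≤ B n - B (n + 1) := by
      rw [← Finset.sum_sub_distrib, Finset.mul_sum]
      refine Finset.sum_le_sum fun j hj => ?_
      rw [Finset.mem_Ico] at hj
      have h3 := hw.balance n hn j hj.1 hj.2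
      have h4 := (hP.layers (Problem.cellLayer j)).pcPrim_sub_le
        (hw.cell_mem n hn.le j hj.1 hj.2) (hw.cell_mem (n + 1) hn j hj.1 hj.2)
      have h5 := (hP.layers (Problem.cellLayer j)).poro_mem.1
      have h6 := mul_le_mul_of_nonneg_left h4 (mul_pos h5 hdx).le
      have h7 : P.dt M * (P.flux N M w n (j + 1) - P.flux N M w n j) =
          -((P.layer (Problem.cellLayer j)).poro * dx N * (w.cell (n + 1) j - w.cell n j)) := by
        have h8 : P.flux N M w n (j + 1) - P.flux N M w n j = -((P.layer (Problem.cellLayer j)).poro *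
          ((w.cell (n + 1) j - w.cell n j) / P.dt M) * dx N) := by linarith
        rw [h8]; field_simp
      rw [← mul_assoc, h7]
      linarith
    have h9 := mul_le_mul_of_nonneg_left h1 hdt.le
    rw [div_mul_eq_mul_div, le_div_iff₀ hc]
    rw [← hK] at h9
    linarith
  have hMdt : (M : ℝ) * P.dt M = P.T := by unfold Problem.dt; field_simp
  refine (Finset.sum_le_sum fun n hn => hstep n (Finset.mem_range.1 hn)).trans ?_
  rw [← Finset.mul_sum, Finset.sum_add_distrib, Finset.sum_const, Finset.card_range,
    nsmul_eq_mul, Finset.sum_range_sub', ← mul_assoc, hMdt]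
  have h1 := abs_le.1 (hB 0 (Nat.zero_le _))
  have h2 := abs_le.1 (hB M le_rfl)
  refine mul_le_mul_of_nonneg_left ?_ (by positivity)
  linarith

end TwoPhase
-- Piecewise linear reconstruction of gradients and fluxes.
namespace TwoPhase
namespace Problem

/-- Piecewise linear function with values `l j` and `r j` at the ends of the cell `j`. -/
def lin (N : ℕ) (l r : ℤ → ℝ) (x : ℝ) : ℝ :=
  l ⌊x / dx N⌋ * (1 - Int.fract (x / dx N)) + r ⌊x / dx N⌋ * Int.fract (x / dx N)

lemma floor_cell {N : ℕ} (hN : 0 < N) {j : ℤ} {x : ℝ} (hx : x ∈ Ico (j * dx N) ((j + 1) * dx N)) :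
    ⌊x / dx N⌋ = j := by
  have hdx := dx_pos hN
  rw [Int.floor_eq_iff, le_div_iff₀ hdx, div_lt_iff₀ hdx]
  exact hx

lemma lin_cell {N : ℕ} (hN : 0 < N) {l r : ℤ → ℝ} {j : ℤ} {x : ℝ}
    (hx : x ∈ Ico (j * dx N) ((j + 1) * dx N)) :
    lin N l r x = l j + (r j - l j) / dx N * (x - j * dx N) := by
  have hdx := dx_pos hN
  rw [lin, ← Int.self_sub_floor, floor_cell hN hx]
  field_simp; ring

lemma measurable_lin (N : ℕ) (l r : ℤ → ℝ) : Measurable (lin N l r) := by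
  have h : Measurable fun x : ℝ => x / dx N := measurable_id.div_const _
  have hf : ∀ c : ℤ → ℝ, Measurable fun x : ℝ => c ⌊x / dx N⌋ := fun c =>
    (measurable_of_countable c).comp h.floor
  exact ((hf l).mul (measurable_const.sub h.fract)).add ((hf r).mul h.fract)

lemma mul_dx (N : ℕ) (hN : 0 < N) : (N : ℝ) * dx N = 1 := by unfold dx; field_simp

lemma floor_mem {N : ℕ} (hN : 0 < N) {x : ℝ} (hx : x ∈ Ico (-1 : ℝ) 1) :
    -(N : ℤ) ≤ ⌊x / dx N⌋ ∧ ⌊x / dx N⌋ < N := by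
  have hdx := dx_pos hN
  have h := mul_dx N hN
  rw [Int.le_floor, Int.floor_lt, le_div_iff₀ hdx, div_lt_iff₀ hdx]
  push_cast
  exact ⟨by linarith [hx.1], by linarith [hx.2]⟩

lemma abs_lin_le {N : ℕ} {l r : ℤ → ℝ} {x C : ℝ} (hl : |l ⌊x / dx N⌋| ≤ C)
    (hr : |r ⌊x / dx N⌋| ≤ C) : |lin N l r x| ≤ C := by
  have h0 := Int.fract_nonneg (x / dx N)
  have h1 := (Int.fract_lt_one (x / dx N)).le
  rw [abs_le] at *
  unfold lin
  constructor <;> nlinarith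

lemma exists_abs_lin_le {N : ℕ} (hN : 0 < N) (l r : ℤ → ℝ) :
    ∃ C, ∀ x ∈ Ico (-1 : ℝ) 1, |lin N l r x| ≤ C := by
  refine ⟨∑ j ∈ Finset.Ico (-(N : ℤ)) N, (|l j| + |r j|), fun x hx => ?_⟩
  have hj := Finset.mem_Ico.2 (floor_mem hN hx)
  have h1 := Finset.single_le_sum (f := fun j => |l j| + |r j|) (fun j _ => by positivity) hj
  exact abs_lin_le ((le_add_of_nonneg_right (abs_nonneg _)).trans h1)
    ((le_add_of_nonneg_left (abs_nonneg _)).trans h1)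

lemma intervalIntegrable_of_bound {h : ℝ → ℝ} (hm : Measurable h) {C : ℝ}
    (hC : ∀ x ∈ Ico (-1 : ℝ) 1, |h x| ≤ C) {a b : ℝ} (ha : a ∈ Icc (-1 : ℝ) 1)
    (hb : b ∈ Icc (-1 : ℝ) 1) : IntervalIntegrable h volume a b := by
  have : IntegrableOn h (Ico (-1) 1) :=
    Measure.integrableOn_of_bounded (by simp) hm.aestronglyMeasurable
      ((ae_restrict_mem measurableSet_Ico).mono fun x hx => hC x hx)
  have h' : IntervalIntegrable h volume (-1) 1 := by
    rw [intervalIntegrable_iff_integrableOn_Ico_of_le (by norm_num)]; exact this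
  refine h'.mono_set ?_
  rw [uIcc_of_le (by norm_num : (-1 : ℝ) ≤ 1)]
  exact uIcc_subset_Icc ha hb

lemma intervalIntegrable_lin {N : ℕ} (hN : 0 < N) (l r : ℤ → ℝ) {a b : ℝ}
    (ha : a ∈ Icc (-1 : ℝ) 1) (hb : b ∈ Icc (-1 : ℝ) 1) :
    IntervalIntegrable (lin N l r) volume a b :=
  (exists_abs_lin_le hN l r).elim fun _ hC => intervalIntegrable_of_bound (measurable_lin N l r) hC ha hb

lemma node_mem {N : ℕ} (hN : 0 < N) {j : ℤ} (hj : -(N : ℤ) ≤ j) (hj' : j ≤ N) :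
    (j : ℝ) * dx N ∈ Icc (-1 : ℝ) 1 := by
  have hdx := dx_pos hN
  have h := mul_dx N hN
  have h1 : (-(N : ℝ)) ≤ j := by exact_mod_cast hj
  have h2 : (j : ℝ) ≤ N := by exact_mod_cast hj'
  constructor <;> nlinarith

/-- Decomposition of an integral into integrals on the cells. -/
lemma integral_eq_sum_cells {N : ℕ} (hN : 0 < N) {h : ℝ → ℝ} (a : ℤ) (m : ℕ) (ha : -(N : ℤ) ≤ a)
    (hm : a + m ≤ N) (hh : IntervalIntegrable h volume (-1) 1) :
    ∫ x in (a * dx N)..((a + m : ℤ) * dx N), h x =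
      ∑ k ∈ Finset.range m, ∫ x in ((a + k : ℤ) * dx N)..((a + k + 1 : ℤ) * dx N), h x := by
  have := intervalIntegral.sum_integral_adjacent_intervals (μ := volume) (f := h)
    (a := fun k : ℕ => ((a + k : ℤ) : ℝ) * dx N) (n := m) fun k hk => hh.mono_set (by
      rw [uIcc_of_le (by norm_num : (-1 : ℝ) ≤ 1)]
      exact uIcc_subset_Icc (node_mem hN (by omega) (by omega)) (node_mem hN (by omega) (by omega)))
  simp only [Nat.cast_zero, add_zero, Nat.cast_add, Nat.cast_one, ← add_assoc] at this
  exact this.symm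

lemma integral_eq_sum {N : ℕ} (hN : 0 < N) {h : ℝ → ℝ} (hh : IntervalIntegrable h volume (-1) 1) :
    ∫ x in (-1 : ℝ)..1, h x =
      ∑ j ∈ Finset.Ico (-(N : ℤ)) N, ∫ x in (j * dx N)..((j + 1 : ℤ) * dx N), h x := by
  have hd := mul_dx N hN
  have h1 := integral_eq_sum_cells hN (-(N : ℤ)) N le_rfl (by omega) hh
  have h2 := integral_eq_sum_cells hN 0 N (by omega) (by omega) hh
  have e1 : ((-(N : ℤ) : ℤ) : ℝ) * dx N = -1 := by push_cast; linarith
  have e2 : ((-(N : ℤ) + N : ℤ) : ℝ) * dx N = 0 := by simp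
  have e3 : ((0 : ℤ) : ℝ) * dx N = 0 := by simp
  have e4 : ((0 + N : ℤ) : ℝ) * dx N = 1 := by simpa using hd
  rw [e1, e2] at h1
  rw [e3, e4] at h2
  rw [sum_cells_eq, ← h1, ← h2, intervalIntegral.integral_add_adjacent_intervals]
  · exact hh.mono_set (by
      rw [uIcc_of_le, uIcc_of_le] <;> first | exact Icc_subset_Icc (by norm_num) (by norm_num) | norm_num)
  · exact hh.mono_set (by
      rw [uIcc_of_le, uIcc_of_le] <;> first | exact Icc_subset_Icc (by norm_num) (by norm_num) | norm_num)

lemma integral_congr_cell {N : ℕ} {h k : ℝ → ℝ} {j : ℤ} {x : ℝ}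
    (hx : x ∈ Icc (j * dx N) ((j + 1) * dx N))
    (hk : ∀ y ∈ Ico (j * dx N) ((j + 1) * dx N), h y = k y) :
    ∫ y in (j * dx N)..x, h y = ∫ y in (j * dx N)..x, k y := by
  rw [intervalIntegral.integral_of_le hx.1, intervalIntegral.integral_of_le hx.1,
    integral_Ioc_eq_integral_Ioo, integral_Ioc_eq_integral_Ioo]
  exact setIntegral_congr_fun measurableSet_Ioo fun y hy => hk y ⟨hy.1.le, hy.2.trans_le hx.2⟩

lemma integral_lin_cell {N : ℕ} (hN : 0 < N) (l r : ℤ → ℝ) {j : ℤ} {x : ℝ}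
    (hx : x ∈ Icc (j * dx N) ((j + 1) * dx N)) :
    ∫ y in (j * dx N)..x, lin N l r y =
      l j * (x - j * dx N) + (r j - l j) / dx N * ((x - j * dx N) ^ 2 / 2) := by
  rw [integral_congr_cell hx fun y hy => lin_cell hN hy]
  have : ∀ y ∈ uIcc (j * dx N) x, HasDerivAt (fun y => l j * (y - j * dx N)
      + (r j - l j) / dx N * ((y - j * dx N) ^ 2 / 2))
      (l j + (r j - l j) / dx N * (y - j * dx N)) y := by
    intro y _
    have h1 : HasDerivAt (fun y : ℝ => y - j * dx N) 1 y := (hasDerivAt_id y).sub_const _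
    have h2 := (h1.const_mul (l j)).add (((h1.pow 2).div_const 2).const_mul ((r j - l j) / dx N))
    convert! h2 using 1
    simp
  rw [intervalIntegral.integral_eq_sub_of_hasDerivAt this
    ((by fun_prop : Continuous fun y : ℝ => l j + (r j - l j) / dx N * (y - j * dx N)).intervalIntegrable _ _)]
  simp

/-- Integration by parts on one cell. -/
lemma integral_lin_mul_deriv_cell {N : ℕ} (hN : 0 < N) (l r : ℤ → ℝ) {χ : ℝ → ℝ} (hχ : ContDiff ℝ 1 χ)
    (j : ℤ) :
    ∫ y in (j * dx N)..((j + 1 : ℤ) * dx N), lin N l r y * deriv χ y =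
      r j * χ ((j + 1 : ℤ) * dx N) - l j * χ (j * dx N)
        - (r j - l j) / dx N * ∫ y in (j * dx N)..((j + 1 : ℤ) * dx N), χ y := by
  have hdx := dx_pos hN
  have hx : ((j + 1 : ℤ) : ℝ) * dx N ∈ Icc (j * dx N) ((j + 1) * dx N) := by
    push_cast; constructor <;> nlinarith
  rw [integral_congr_cell hx fun y hy => by rw [lin_cell hN hy]]
  have h := intervalIntegral.integral_mul_deriv_eq_deriv_mul (a := j * dx N)
    (b := (j + 1 : ℤ) * dx N) (u := fun y => l j + (r j - l j) / dx N * (y - j * dx N))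
    (u' := fun _ => (r j - l j) / dx N) (v := χ) (v' := deriv χ)
    (fun y _ => by
      have h1 : HasDerivAt (fun y : ℝ => y - j * dx N) 1 y := (hasDerivAt_id y).sub_const _
      simpa using (h1.const_mul ((r j - l j) / dx N)).const_add (l j))
    (fun y _ => (hχ.differentiable one_ne_zero y).hasDerivAt)
    intervalIntegrable_const ((hχ.continuous_deriv le_rfl).intervalIntegrable _ _)
  rw [h, intervalIntegral.integral_const_mul]
  push_cast
  have : (r j - l j) / dx N * ((j + 1) * dx N - j * dx N) = r j - l j := by field_simp; ring
  rw [this]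
  ring

/-- The square of a convex combination of `l j` and `r j` is at most the sum of their squares. -/
lemma integral_lin_sq_cell_le {N : ℕ} (hN : 0 < N) (l r : ℤ → ℝ) (j : ℤ) :
    ∫ y in (j * dx N)..((j + 1 : ℤ) * dx N), lin N l r y ^ 2 ≤ dx N * (l j ^ 2 + r j ^ 2) := by
  have hdx := dx_pos hN
  have hx : ((j + 1 : ℤ) : ℝ) * dx N ∈ Icc (j * dx N) ((j + 1) * dx N) := by
    push_cast; constructor <;> nlinarith
  rw [integral_congr_cell hx fun y hy => by rw [lin_cell hN hy]]
  have hc : Continuous fun y : ℝ => (l j + (r j - l j) / dx N * (y - j * dx N)) ^ 2 := by fun_prop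
  have := intervalIntegral.integral_mono_on hx.1 (hc.intervalIntegrable _ _)
    (intervalIntegrable_const (μ := volume) (c := l j ^ 2 + r j ^ 2)) fun y hy => by
      set s := (y - j * dx N) / dx N with hs
      have h0 : 0 ≤ s := div_nonneg (by linarith [hy.1]) hdx.le
      have h1 : s ≤ 1 := by rw [hs, div_le_one hdx]; push_cast at hy; linarith [hy.2]
      have : (r j - l j) / dx N * (y - j * dx N) = (r j - l j) * s := by rw [hs]; field_simp
      rw [this]
      nlinarith [mul_nonneg h0 (sub_nonneg.2 h1), sq_nonneg (l j - r j), sq_nonneg (l j), sq_nonneg (r j)]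
  refine this.trans_eq ?_
  simp; ring

/-- Porosity as a function of the space variable. -/
def poro (P : Problem) (x : ℝ) : ℝ := if x < 0 then (P.layer 0).poro else (P.layer 1).poro

lemma measurable_poro (P : Problem) : Measurable P.poro :=
  Measurable.ite measurableSet_Iio measurable_const measurable_const

lemma poro_cell (P : Problem) {N : ℕ} (hN : 0 < N) {j : ℤ} {x : ℝ}
    (hx : x ∈ Ico (j * dx N) ((j + 1) * dx N)) : P.poro x = (P.layer (cellLayer j)).poro := by
  have hdx := dx_pos hN
  have : x < 0 ↔ j < 0 := by
    constructor
    · intro h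
      have : (j : ℝ) < 0 := by nlinarith [hx.1]
      exact_mod_cast this
    · intro h
      have : (j : ℝ) + 1 ≤ 0 := by exact_mod_cast h
      nlinarith [hx.2]
  unfold poro cellLayer
  simp only [this]
  split_ifs <;> rfl

end Problem

namespace Problem.IsSchemeSolution

variable {P : Problem} {N M : ℕ} {w : Unknowns} (hw : P.IsSchemeSolution N M w)
  (hP : P.Admissible) (hN : 0 < N) (hM : 0 < M)

include hN in
lemma energy_term_nonneg (n : ℕ) (j : ℤ) :
    0 ≤ dx N * (P.gradL N M w n j ^ 2 + P.gradR N M w n j ^ 2) := by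
  have := dx_pos hN
  positivity

include hN in
lemma energy_nonneg (n : ℕ) : 0 ≤ P.energy N M w n :=
  Finset.sum_nonneg fun j _ => energy_term_nonneg hN n j

include hN in
lemma integral_grad_sq_le (n : ℕ) :
    ∫ x in (-1 : ℝ)..1, lin N (P.gradL N M w n) (P.gradR N M w n) x ^ 2 ≤ P.energy N M w n := by
  obtain ⟨C, hC⟩ := exists_abs_lin_le hN (P.gradL N M w n) (P.gradR N M w n)
  rw [integral_eq_sum hN (intervalIntegrable_of_bound ((measurable_lin N _ _).pow_const 2) (C := C ^ 2)
    (fun x hx => by rw [abs_pow]; exact pow_le_pow_left₀ (abs_nonneg _) (hC x hx) 2)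
    (by simp) (by simp))]
  exact Finset.sum_le_sum fun j _ => integral_lin_sq_cell_le hN _ _ j

include hN in
-- One term of the energy is at most the whole sum, and the square of `δx g` is `δx` times `δx g²`.
lemma dx_mul_grad_le (n : ℕ) {j : ℤ} (hj : -(N : ℤ) ≤ j) (hj' : j < N) :
    dx N * |P.gradL N M w n j| ≤ √(dx N) * √(P.energy N M w n) ∧
      dx N * |P.gradR N M w n j| ≤ √(dx N) * √(P.energy N M w n) := by
  have hdx := dx_pos hN
  have h1 : dx N * (P.gradL N M w n j ^ 2 + P.gradR N M w n j ^ 2) ≤ P.energy N M w n :=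
    Finset.single_le_sum (f := fun j => dx N * (P.gradL N M w n j ^ 2 + P.gradR N M w n j ^ 2))
      (fun j _ => energy_term_nonneg hN n j) (Finset.mem_Ico.2 ⟨hj, hj'⟩)
  rw [← Real.sqrt_mul hdx.le]
  constructor <;> refine Real.le_sqrt_of_sq_le ?_ <;> rw [mul_pow, sq_abs] <;>
    nlinarith [sq_nonneg (P.gradL N M w n j), sq_nonneg (P.gradR N M w n j)]

include hN in
-- Off the outer boundary the transmissibility is at least `1/δx`, so the jump of `φ` over the edge
-- is at most `δx` times the discrete gradient. The outer edge is excluded because its gradient is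
-- zero by convention and says nothing about the boundary datum.
lemma phi_lval_sub_le (n : ℕ) {j : ℤ} (hj : -(N : ℤ) < j) (hj' : j < N) :
    |P.phi (cellLayer j) (lval N (P.ulMean M n) (w.face 1 (n + 1)) (w.cell (n + 1)) j)
      - P.phi (cellLayer j) (w.cell (n + 1) j)| ≤ √(dx N) * √(P.energy N M w n) := by
  have hdx := dx_pos hN
  refine le_trans ?_ (dx_mul_grad_le hN n hj.le hj').1
  rw [gradL, abs_mul, ← mul_assoc, abs_sub_comm]
  refine le_mul_of_one_le_left (abs_nonneg _) ?_
  unfold lcoef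
  rw [if_neg (by omega)]
  split_ifs
  · rw [abs_of_pos (by positivity)]; field_simp; norm_num
  · rw [abs_of_pos (by positivity)]; field_simp; norm_num

include hN in
lemma phi_rval_sub_le (n : ℕ) {j : ℤ} (hj : -(N : ℤ) ≤ j) (hj' : j < N - 1) :
    |P.phi (cellLayer j) (rval N (P.urMean M n) (w.face 0 (n + 1)) (w.cell (n + 1)) j)
      - P.phi (cellLayer j) (w.cell (n + 1) j)| ≤ √(dx N) * √(P.energy N M w n) := by
  have hdx := dx_pos hN
  refine le_trans ?_ (dx_mul_grad_le hN n hj (by omega)).2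
  rw [gradR, abs_mul, ← mul_assoc]
  refine le_mul_of_one_le_left (abs_nonneg _) ?_
  unfold rcoef
  rw [if_neg (by omega)]
  split_ifs
  · rw [abs_of_pos (by positivity)]; field_simp; norm_num
  · rw [abs_of_pos (by positivity)]; field_simp; norm_num

/-- Index of the first cell of a layer. -/
def _root_.TwoPhase.Problem.start (N : ℕ) (i : Fin 2) : ℤ := if i = 0 then -(N : ℤ) else 0

/-- Left discrete trace in a layer. -/
def _root_.TwoPhase.Problem.traceL (N : ℕ) (w : Unknowns) (n : ℕ) (i : Fin 2) : ℝ :=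
  if i = 0 then w.cell (n + 1) (-(N : ℤ)) else w.face 1 (n + 1)

/-- Right discrete trace in a layer. -/
def _root_.TwoPhase.Problem.traceR (N : ℕ) (w : Unknowns) (n : ℕ) (i : Fin 2) : ℝ :=
  if i = 0 then w.face 0 (n + 1) else w.cell (n + 1) ((N : ℤ) - 1)

include hN in
-- A linear function integrates over a cell to `δx/2` times the sum of its two edge values, and
-- adjacent cells of a layer share the edge gradient. The primitive that starts at the trace
-- therefore reaches each node with the value of the next cell minus half an edge increment. At the
-- start of the layer this holds because the first gradient is zero (`x = -1`) or taken over half a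
-- cell (`x = 0`).
lemma phi_traceL_add_integral (n : ℕ) (i : Fin 2) (k : ℕ) (hk : k < N) :
    P.phi i (traceL N w n i) + ∫ x in (start N i * dx N)..((start N i + k : ℤ) * dx N),
      lin N (P.gradL N M w n) (P.gradR N M w n) x =
    P.phi i (w.cell (n + 1) (start N i + k)) - P.gradL N M w n (start N i + k) * dx N / 2 := by
  have hdx := dx_pos hN
  have hl : ∀ k : ℕ, k < N → cellLayer (start N i + k) = i := by
    intro k hk
    unfold cellLayer start
    fin_cases i
    · simp; omega
    · simp
  have hs : -(N : ℤ) ≤ start N i ∧ start N i ≤ 0 := by unfold start; split_ifs <;> omega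
  induction k with
  | zero =>
    have h0 := hl 0 hN
    simp only [Nat.cast_zero, add_zero] at h0 ⊢
    rw [intervalIntegral.integral_same, gradL, h0]
    fin_cases i
    · simp [start, traceL, lcoef]
    · have : (0 : ℤ) ≠ -(N : ℤ) := by omega
      simp [start, traceL, lcoef, lval, this]
      field_simp; ring
  | succ k ih =>
    have ih := ih (by omega)
    have h1 : ∀ m : ℕ, m ≤ N → ((start N i + m : ℤ) : ℝ) * dx N ∈ Icc (-1 : ℝ) 1 := fun m hm =>
      node_mem hN (by omega) (by omega)
    have h10 := h1 0 (by omega)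
    simp only [Nat.cast_zero, add_zero] at h10
    rw [← intervalIntegral.integral_add_adjacent_intervals
      (intervalIntegrable_lin hN _ _ h10 (h1 k (by omega)))
      (intervalIntegrable_lin hN _ _ (h1 k (by omega)) (h1 (k + 1) (by omega))), ← add_assoc, ih,
      integral_lin_cell hN _ _ (by push_cast; constructor <;> nlinarith)]
    have hgr : P.gradR N M w n (start N i + k) = P.gradL N M w n (start N i + (k + 1 : ℕ)) := by
      unfold gradR gradL rcoef rval lcoef lval
      have h2 := hl k (by omega)
      have h3 := hl (k + 1) hk
      have h4 : ¬ start N i + (k : ℤ) = N - 1 ∧ ¬ start N i + (k : ℤ) = -1 ∧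
          ¬ start N i + ((k + 1 : ℕ) : ℤ) = -N ∧ ¬ start N i + ((k + 1 : ℕ) : ℤ) = 0 := by
        unfold start; split_ifs <;> push_cast <;> omega
      simp only [h2, h3, h4, if_false]
      push_cast
      rw [show start N i + ((k : ℤ) + 1) - 1 = start N i + k by ring, ← add_assoc]
    have hphi : P.phi i (w.cell (n + 1) (start N i + (k + 1 : ℕ))) =
        P.phi i (w.cell (n + 1) (start N i + k)) + dx N * P.gradL N M w n (start N i + (k + 1 : ℕ)) := by
      unfold gradL lcoef lval
      have h3 := hl (k + 1) hk
      have h4 : ¬ start N i + ((k + 1 : ℕ) : ℤ) = -N ∧ ¬ start N i + ((k + 1 : ℕ) : ℤ) = 0 := by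
        unfold start; split_ifs <;> push_cast <;> omega
      simp only [h3, h4, if_false]
      push_cast
      rw [show start N i + ((k : ℤ) + 1) - 1 = start N i + k by ring]
      field_simp; ring
    rw [hphi, hgr]
    push_cast
    field_simp
    ring

include hN in
-- The last half-cell supplies exactly the missing increment. At `x = 0` the edge gradient is taken
-- over half a cell, and at `x = 1` it is zero and the trace is the last cell value. The identity
-- has no error term, so the limit traces at the two ends are linked by the limit gradient.
lemma phi_traceR_eq (n : ℕ) (i : Fin 2) :
    P.phi i (traceR N w n i) = P.phi i (traceL N w n i) +
      ∫ x in (start N i * dx N)..((start N i + N : ℤ) * dx N),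
        lin N (P.gradL N M w n) (P.gradR N M w n) x := by
  have hdx := dx_pos hN
  have hs : -(N : ℤ) ≤ start N i ∧ start N i ≤ 0 := by unfold start; split_ifs <;> omega
  have h := phi_traceL_add_integral (P := P) (M := M) (w := w) hN n i (N - 1) (by omega)
  have h1 : ((start N i : ℤ) : ℝ) * dx N ∈ Icc (-1 : ℝ) 1 := node_mem hN (by omega) (by omega)
  have h2 : ((start N i + (N - 1 : ℕ) : ℤ) : ℝ) * dx N ∈ Icc (-1 : ℝ) 1 :=
    node_mem hN (by omega) (by omega)
  have h3 : ((start N i + N : ℤ) : ℝ) * dx N ∈ Icc (-1 : ℝ) 1 := node_mem hN (by omega) (by omega)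
  have hc : ((N - 1 : ℕ) : ℝ) = N - 1 := by rw [Nat.cast_sub hN]; simp
  rw [← intervalIntegral.integral_add_adjacent_intervals (intervalIntegrable_lin hN _ _ h1 h2)
    (intervalIntegrable_lin hN _ _ h2 h3), ← add_assoc, h,
    integral_lin_cell hN _ _ (by push_cast; rw [hc]; constructor <;> nlinarith)]
  push_cast
  rw [hc]
  have h5 : P.gradR N M w n (start N i + (N - 1 : ℕ)) * dx N / 2 =
      P.phi i (traceR N w n i) - P.phi i (w.cell (n + 1) (start N i + (N - 1 : ℕ))) := by
    unfold gradR traceR rcoef rval start cellLayer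
    fin_cases i
    · have e1 : -(N : ℤ) + (N - 1 : ℕ) = -1 := by omega
      have e2 : ¬ (-1 : ℤ) = N - 1 := by omega
      simp [e1, e2]
      field_simp
    · have e1 : (0 : ℤ) + (N - 1 : ℕ) = N - 1 := by omega
      simp [e1]
  have h6 : (start N i + (N : ℝ)) * dx N - (start N i + ((N : ℝ) - 1)) * dx N = dx N := by ring
  rw [h6]
  have h7 : (P.gradR N M w n (start N i + (N - 1 : ℕ)) - P.gradL N M w n (start N i + (N - 1 : ℕ))) /
      dx N * (dx N ^ 2 / 2) = P.gradR N M w n (start N i + (N - 1 : ℕ)) * dx N / 2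
        - P.gradL N M w n (start N i + (N - 1 : ℕ)) * dx N / 2 := by field_simp
  rw [h7, h5]
  ring

include hN in
-- Inside a cell the primitive is quadratic in the local coordinate `s`. Its distance to the cell
-- value is a combination of `δx` times the two edge gradients, with coefficients at most 1 in
-- absolute value.
lemma phi_sub_le (n : ℕ) (i : Fin 2) (k : ℕ) (hk : k < N) {x : ℝ}
    (hx : x ∈ Ico ((start N i + k : ℤ) * dx N) (((start N i + k : ℤ) + 1) * dx N)) :
    |P.phi i (w.cell (n + 1) (start N i + k)) - (P.phi i (traceL N w n i) +
      ∫ x in (start N i * dx N)..x, lin N (P.gradL N M w n) (P.gradR N M w n) x)|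
      ≤ 2 * (√(dx N) * √(P.energy N M w n)) := by
  have hdx := dx_pos hN
  have hs : -(N : ℤ) ≤ start N i ∧ start N i ≤ 0 := by unfold start; split_ifs <;> omega
  have h1 : ((start N i : ℤ) : ℝ) * dx N ∈ Icc (-1 : ℝ) 1 := node_mem hN (by omega) (by omega)
  have h2 : ((start N i + k : ℤ) : ℝ) * dx N ∈ Icc (-1 : ℝ) 1 := node_mem hN (by omega) (by omega)
  have h3 : ((start N i + k + 1 : ℤ) : ℝ) * dx N ∈ Icc (-1 : ℝ) 1 := node_mem hN (by omega) (by omega)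
  have hx' : x ∈ Icc (-1 : ℝ) 1 := ⟨h2.1.trans hx.1, hx.2.le.trans (by push_cast at h3 ⊢; exact h3.2)⟩
  rw [← intervalIntegral.integral_add_adjacent_intervals (intervalIntegrable_lin hN _ _ h1 h2)
    (intervalIntegrable_lin hN _ _ h2 hx'), ← add_assoc, phi_traceL_add_integral hN n i k hk,
    integral_lin_cell hN _ _ ⟨hx.1, hx.2.le⟩]
  have hg := dx_mul_grad_le (P := P) (M := M) (w := w) hN n (j := start N i + k) (by omega) (by omega)
  set y := x - ((start N i + k : ℤ) : ℝ) * dx N with hy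
  set s := y / dx N with hs
  have hy0 : 0 ≤ s := div_nonneg (sub_nonneg.2 hx.1) hdx.le
  have hy1 : s ≤ 1 := by rw [hs, div_le_one hdx]; linarith [hx.2]
  have hys : y = s * dx N := by rw [hs]; field_simp
  rw [hys]
  set gl := P.gradL N M w n (start N i + k)
  set gr := P.gradR N M w n (start N i + k)
  have : P.phi i (w.cell (n + 1) (start N i + k)) - (P.phi i (w.cell (n + 1) (start N i + k))
      - gl * dx N / 2 + (gl * (s * dx N) + (gr - gl) / dx N * ((s * dx N) ^ 2 / 2))) =
      (1 / 2 - s + s ^ 2 / 2) * (dx N * gl) - s ^ 2 / 2 * (dx N * gr) := by field_simp; ring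
  rw [this]
  refine (abs_sub _ _).trans ?_
  simp only [abs_mul, abs_of_pos hdx]
  have b1 : |1 / 2 - s + s ^ 2 / 2| ≤ 1 := abs_le.2 ⟨by nlinarith, by nlinarith⟩
  have b2 : |s ^ 2 / 2| ≤ 1 := abs_le.2 ⟨by nlinarith, by nlinarith⟩
  have m1 := mul_le_mul_of_nonneg_right b1 (mul_nonneg hdx.le (abs_nonneg gl))
  have m2 := mul_le_mul_of_nonneg_right b2 (mul_nonneg hdx.le (abs_nonneg gr))
  linarith [hg.1, hg.2]

include hw hP hN hM in
/-- The scheme as a conservation law for the piecewise linear flux. -/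
lemma integral_flux_mul_deriv {n : ℕ} (hn : n < M) {χ : ℝ → ℝ} (hχ : ContDiff ℝ 1 χ) :
    P.dt M * ∫ x in (-1 : ℝ)..1,
        lin N (P.flux N M w n) (fun j => P.flux N M w n (j + 1)) x * deriv χ x =
      P.dt M * (P.flux N M w n N * χ 1 - P.flux N M w n (-(N : ℤ)) * χ (-1)) +
      ∫ x in (-1 : ℝ)..1, P.poro x * (w.cell (n + 1) ⌊x / dx N⌋ - w.cell n ⌊x / dx N⌋) * χ x := by
  have hdx := dx_pos hN
  have hdt := hP.dt_pos hM
  have hd := mul_dx N hN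
  obtain ⟨C, hC⟩ := exists_abs_lin_le hN (P.flux N M w n) (fun j => P.flux N M w n (j + 1))
  have hχc := hχ.continuous
  have hχd := hχ.continuous_deriv le_rfl
  have i1 : IntervalIntegrable (fun x => lin N (P.flux N M w n) (fun j => P.flux N M w n (j + 1)) x *
      deriv χ x) volume (-1) 1 :=
    (intervalIntegrable_lin hN _ _ (by simp) (by simp)).mul_continuousOn hχd.continuousOn
  have i2 : IntervalIntegrable (fun x => P.poro x * (w.cell (n + 1) ⌊x / dx N⌋ - w.cell n ⌊x / dx N⌋)
      * χ x) volume (-1) 1 := by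
    refine IntervalIntegrable.mul_continuousOn ?_ hχc.continuousOn
    refine intervalIntegrable_of_bound (C := 1) ?_ ?_ (by simp) (by simp)
    · have hf : ∀ c : ℤ → ℝ, Measurable fun x : ℝ => c ⌊x / dx N⌋ := fun c =>
        (measurable_of_countable c).comp (measurable_id.div_const _).floor
      exact P.measurable_poro.mul ((hf _).sub (hf _))
    · intro x hx
      have hj := floor_mem hN hx
      have h1 := hw.cell_mem (n + 1) hn _ hj.1 hj.2
      have h2 := hw.cell_mem n hn.le _ hj.1 hj.2
      have h3 : |P.poro x| ≤ 1 := by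
        unfold poro
        split_ifs
        · have := (hP.layers 0).poro_mem
          exact abs_le.2 ⟨by linarith [this.1], this.2.le⟩
        · have := (hP.layers 1).poro_mem
          exact abs_le.2 ⟨by linarith [this.1], this.2.le⟩
      rw [abs_mul]
      exact mul_le_one₀ h3 (abs_nonneg _) (abs_le.2 ⟨by linarith [h1.1, h2.2], by linarith [h1.2, h2.1]⟩)
  rw [integral_eq_sum hN i1, integral_eq_sum hN i2]
  have hcell : ∀ j ∈ Finset.Ico (-(N : ℤ)) N,
      P.dt M * ∫ y in (j * dx N)..((j + 1 : ℤ) * dx N),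
        lin N (P.flux N M w n) (fun j => P.flux N M w n (j + 1)) y * deriv χ y =
      P.dt M * (P.flux N M w n (j + 1) * χ ((j + 1 : ℤ) * dx N) - P.flux N M w n j * χ (j * dx N)) +
      ∫ x in (j * dx N)..((j + 1 : ℤ) * dx N),
        P.poro x * (w.cell (n + 1) ⌊x / dx N⌋ - w.cell n ⌊x / dx N⌋) * χ x := by
    intro j hj
    rw [Finset.mem_Ico] at hj
    rw [integral_lin_mul_deriv_cell hN _ _ hχ]
    have hx : ((j + 1 : ℤ) : ℝ) * dx N ∈ Icc (j * dx N) ((j + 1) * dx N) := by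
      push_cast; constructor <;> nlinarith
    rw [integral_congr_cell (h := fun x => P.poro x * (w.cell (n + 1) ⌊x / dx N⌋
      - w.cell n ⌊x / dx N⌋) * χ x) hx fun y hy => by rw [floor_cell hN hy, P.poro_cell hN hy],
      intervalIntegral.integral_const_mul]
    -- The slope of the linear flux on the cell is, by the balance, minus the porosity times the
    -- discrete time derivative.
    have hb := hw.balance n hn j hj.1 hj.2
    have hb' : P.flux N M w n (j + 1) - P.flux N M w n j = -((P.layer (cellLayer j)).poro *
      ((w.cell (n + 1) j - w.cell n j) / P.dt M) * dx N) := by linarith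
    rw [hb']
    field_simp
    ring
  rw [Finset.mul_sum, Finset.sum_congr rfl hcell, Finset.sum_add_distrib, ← Finset.mul_sum]
  congr 2
  rw [sum_cells_eq]
  -- The nodal terms telescope across the whole mesh, the interface included, because the flux at `x
  -- = 0` is single-valued.
  have htel : ∀ a : ℤ, ∑ k ∈ Finset.range N, (P.flux N M w n (a + k + 1) * χ ((a + k + 1 : ℤ) * dx N)
      - P.flux N M w n (a + k) * χ ((a + k : ℤ) * dx N)) =
      P.flux N M w n (a + N) * χ ((a + N : ℤ) * dx N) - P.flux N M w n a * χ (a * dx N) := by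
    intro a
    have := Finset.sum_range_sub (fun k : ℕ => P.flux N M w n (a + k) * χ ((a + k : ℤ) * dx N)) N
    simpa [add_assoc] using this
  rw [htel, htel]
  have e1 : ((-(N : ℤ) : ℤ) : ℝ) * dx N = -1 := by push_cast; linarith
  have e4 : ((0 + N : ℤ) : ℝ) * dx N = 1 := by simpa using hd
  rw [e1, e4, neg_add_cancel, zero_add]
  ring

end Problem.IsSchemeSolution
end TwoPhase
-- Approximate solutions: the properties needed for the limit.
namespace TwoPhase
namespace Problem

/-- Left end of a layer. -/
def left (i : Fin 2) : ℝ := if i = 0 then -1 else 0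

lemma dom_eq (i : Fin 2) : dom i = Ioo (left i) (left i + 1) := by
  unfold dom left; split_ifs <;> norm_num

lemma left_mem (i : Fin 2) : left i ∈ Icc (-1 : ℝ) 0 := by
  unfold left; split_ifs <;> norm_num

lemma dom_subset (i : Fin 2) : dom i ⊆ Ioo (-1) 1 := by
  have := left_mem i
  rw [dom_eq]
  exact Ioo_subset_Ioo this.1 (by linarith [this.2])

/-- An approximate solution: saturation, discrete gradient of `φ(u)`, discrete convection flux,
root of the energy, time rounded down to the grid, data, and traces at the ends of the layers. -/
structure Approx where
  u : ℝ × ℝ → ℝ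
  g : ℝ × ℝ → ℝ
  H : ℝ × ℝ → ℝ
  K : ℝ → ℝ
  fl : ℝ → ℝ
  bl : ℝ → ℝ
  br : ℝ → ℝ
  u0 : ℝ → ℝ
  tl : Fin 2 → ℝ → ℝ
  tr : Fin 2 → ℝ → ℝ

/-- The properties of the discrete solutions used in the passage to the limit. -/
structure IsApprox (P : Problem) (C ε : ℝ) (A : Approx) : Prop where
  meas_u : Measurable A.u
  meas_g : Measurable A.g
  meas_H : Measurable A.H
  meas_K : Measurable A.K
  meas_fl : Measurable A.fl
  meas_bl : Measurable A.bl
  meas_br : Measurable A.br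
  meas_u0 : Measurable A.u0
  meas_tl : ∀ i, Measurable (A.tl i)
  meas_tr : ∀ i, Measurable (A.tr i)
  u_mem : ∀ x ∈ Ioo (-1 : ℝ) 1, ∀ t ∈ Ioo 0 P.T, A.u (x, t) ∈ Icc (0 : ℝ) 1
  u0_mem : ∀ x ∈ Ioo (-1 : ℝ) 1, A.u0 x ∈ Icc (0 : ℝ) 1
  tl_mem : ∀ i, ∀ t ∈ Ioo 0 P.T, A.tl i t ∈ Icc (0 : ℝ) 1
  tr_mem : ∀ i, ∀ t ∈ Ioo 0 P.T, A.tr i t ∈ Icc (0 : ℝ) 1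
  bl_mem : ∀ t ∈ Ioo 0 P.T, A.bl t ∈ Icc (0 : ℝ) 1
  br_mem : ∀ t ∈ Ioo 0 P.T, A.br t ∈ Icc (0 : ℝ) 1
  fl_mem : ∀ t ∈ Ioo 0 P.T, A.fl t ∈ Icc (t - ε) t
  abs_H_le : ∀ x ∈ Ioo (-1 : ℝ) 1, ∀ t ∈ Ioo 0 P.T, |A.H (x, t)| ≤ C
  K_nonneg : ∀ t, 0 ≤ A.K t
  K_int : IntegrableOn (fun t => A.K t ^ 2) (Ioo 0 P.T)
  K_sq : ∫ t in Ioo 0 P.T, A.K t ^ 2 ≤ C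
  g_bdd : ∃ B, ∀ x ∈ Ioo (-1 : ℝ) 1, ∀ t ∈ Ioo 0 P.T, |A.g (x, t)| ≤ B
  g_sq : ∀ t ∈ Ioo 0 P.T, ∫ x in Ioo (-1 : ℝ) 1, A.g (x, t) ^ 2 ≤ A.K t ^ 2
  near : ∀ i, ∀ x ∈ dom i, ∀ t ∈ Ioo 0 P.T,
    |P.phi i (A.u (x, t)) - (P.phi i (A.tl i t) + ∫ y in (left i)..x, A.g (y, t))| ≤ ε * A.K t
  right : ∀ i, ∀ t ∈ Ioo 0 P.T,
    P.phi i (A.tr i t) = P.phi i (A.tl i t) + ∫ y in (left i)..(left i + 1), A.g (y, t)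
  -- The points `a` and `b` stand for the neighbouring values. The condition on `|x|` keeps away
  -- from the two outer cells, where a boundary datum would be a neighbour.
  H_near : ∀ i, ∀ x ∈ dom i, ∀ t ∈ Ioo 0 P.T, |x| < 1 - ε → ∃ a ∈ Icc (0 : ℝ) 1, ∃ b ∈ Icc (0 : ℝ) 1,
    |P.phi i a - P.phi i (A.u (x, t))| ≤ ε * A.K t ∧ |P.phi i b - P.phi i (A.u (x, t))| ≤ ε * A.K t ∧
    |A.H (x, t) - P.f i (A.u (x, t))| ≤ C * (|a - A.u (x, t)| + |b - A.u (x, t)|)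
  compat : ∀ t ∈ Ioo 0 P.T,
    ((P.layer 0).graph (A.tr 0 t) ∩ (P.layer 1).graph (A.tl 1 t)).Nonempty
  -- The parameter `δ` comes from Young's inequality `|g| ≤ 1/δ + δ g²`. It is chosen small first
  -- and `t - s` afterwards, which replaces a Hölder estimate in time.
  equi : ∀ χ : ℝ → ℝ, ContDiff ℝ 1 χ → χ (-1) = 0 → χ 1 = 0 → ∀ B, 0 ≤ B →
    (∀ x ∈ Ioo (-1 : ℝ) 1, |deriv χ x| ≤ B) → ∀ δ > 0, ∀ s ∈ Ioo 0 P.T, ∀ t ∈ Ioo 0 P.T, s ≤ t →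
    |(∫ x in Ioo (-1 : ℝ) 1, P.poro x * A.u (x, t) * χ x)
      - ∫ x in Ioo (-1 : ℝ) 1, P.poro x * A.u (x, s) * χ x|
      ≤ B * ((2 * C + 2 / δ) * (t - s + ε) + δ * C)
  -- An identity without remainder. The discretisation shows only in the time `fl`, rounded down, at
  -- which space derivatives and boundary values of `ψ` are taken.
  weak : ∀ ψ, P.IsTest ψ →
    (∫ z in Ioo (-1 : ℝ) 1 ×ˢ Ioo 0 P.T, P.poro z.1 * A.u z * deriv (fun t => ψ (z.1, t)) z.2)
    + (∫ x in Ioo (-1 : ℝ) 1, P.poro x * A.u0 x * ψ (x, 0))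
    + (∫ z in Ioo (-1 : ℝ) 1 ×ˢ Ioo 0 P.T, (A.H z - A.g z) * deriv (fun x => ψ (x, A.fl z.2)) z.1)
    + (∫ t in Ioo 0 P.T, P.G 0 (A.bl t) (A.tl 0 t) * ψ (-1, A.fl t))
    - (∫ t in Ioo 0 P.T, P.G 1 (A.tr 1 t) (A.br t) * ψ (1, A.fl t)) = 0

variable (P : Problem)

/-- Index of the time step that contains `t`. -/
def lev (M : ℕ) (t : ℝ) : ℕ := ⌈t / P.dt M⌉₊ - 1

/-- The approximate solution associated with a solution of the scheme. -/
def toApprox (N M : ℕ) (w : Unknowns) : Approx where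
  u := P.reconstruct N M w
  g z := lin N (P.gradL N M w (P.lev M z.2)) (P.gradR N M w (P.lev M z.2)) z.1
  -- Adding the gradient back to the flux leaves values of `G` at the edges. Thus `H` is bounded,
  -- while `H - g` is the linear interpolation of the full flux.
  H z := lin N (fun j => P.flux N M w (P.lev M z.2) j + P.gradL N M w (P.lev M z.2) j)
    (fun j => P.flux N M w (P.lev M z.2) (j + 1) + P.gradR N M w (P.lev M z.2) j) z.1
  K t := √(P.energy N M w (P.lev M t))
  fl t := P.lev M t * P.dt M
  bl t := P.ulMean M (P.lev M t)
  br t := P.urMean M (P.lev M t)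
  u0 x := w.cell 0 ⌊x / dx N⌋
  tl i t := traceL N w (P.lev M t) i
  tr i t := traceR N w (P.lev M t) i

variable {P}

lemma measurable_lev (M : ℕ) : Measurable (P.lev M) :=
  (measurable_of_countable (fun n : ℕ => n - 1)).comp (measurable_id.div_const _).nat_ceil

lemma measurable_comp_lev (M : ℕ) {f : ℕ → ℝ → ℝ} (hf : ∀ n, Measurable (f n)) :
    Measurable fun z : ℝ × ℝ => f (P.lev M z.2) z.1 := by
  have h : Measurable fun z : ℕ × ℝ => f z.1 z.2 := measurable_from_prod_countable_right hf
  exact h.comp (((measurable_lev M).comp measurable_snd).prodMk measurable_fst)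

lemma lin_sub (N : ℕ) (l r l' r' : ℤ → ℝ) (x : ℝ) :
    lin N (fun j => l j + l' j) (fun j => r j + r' j) x - lin N l' r' x = lin N l r x := by
  unfold lin; ring

lemma integral_Ioo_eq (f : ℝ → ℝ) {a b : ℝ} (hab : a ≤ b) :
    ∫ x in Ioo a b, f x = ∫ x in a..b, f x := by
  rw [intervalIntegral.integral_of_le hab, integral_Ioc_eq_integral_Ioo]

instance isFiniteMeasure_cylinder (a b c d : ℝ) :
    IsFiniteMeasure ((volume : Measure (ℝ × ℝ)).restrict (Ioo a b ×ˢ Ioo c d)) := by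
  rw [Measure.volume_eq_prod, ← Measure.prod_restrict]
  infer_instance

lemma measurable_cell (N : ℕ) (c : ℤ → ℝ) : Measurable fun x : ℝ => c ⌊x / dx N⌋ :=
  (measurable_of_countable c).comp (measurable_id.div_const _).floor

lemma Admissible.poro_mem (hP : P.Admissible) (x : ℝ) : P.poro x ∈ Ioo (0 : ℝ) 1 := by
  unfold poro
  split_ifs
  exacts [(hP.layers 0).poro_mem, (hP.layers 1).poro_mem]

/-- A bounded measurable function is integrable on the space-time cylinder. -/
lemma integrableOn_cylinder {f : ℝ × ℝ → ℝ} (hf : AEStronglyMeasurable f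
    (volume.restrict (Ioo (-1 : ℝ) 1 ×ˢ Ioo 0 P.T))) {C : ℝ}
    (hC : ∀ x ∈ Ioo (-1 : ℝ) 1, ∀ t ∈ Ioo 0 P.T, |f (x, t)| ≤ C) :
    IntegrableOn f (Ioo (-1 : ℝ) 1 ×ˢ Ioo 0 P.T) := by
  refine Integrable.of_bound (C := C) hf ?_
  filter_upwards [ae_restrict_mem (measurableSet_Ioo.prod measurableSet_Ioo)] with z hz
  exact hC z.1 hz.1 z.2 hz.2

end Problem

namespace Problem.Admissible

variable {P : Problem} (hP : P.Admissible)
include hP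

lemma lev_eq {M n : ℕ} (hM : 0 < M) {t : ℝ} (ht : t ∈ Ioc (n * P.dt M) ((n + 1) * P.dt M)) :
    P.lev M t = n ∧ ⌈t / P.dt M⌉₊ = n + 1 := by
  have hdt := hP.dt_pos hM
  have : ⌈t / P.dt M⌉₊ = n + 1 := by
    rw [Nat.ceil_eq_iff (Nat.succ_ne_zero n), lt_div_iff₀ hdt, div_le_iff₀ hdt]
    push_cast
    exact ht
  exact ⟨by unfold lev; omega, this⟩

lemma lev_lt {M : ℕ} (hM : 0 < M) {t : ℝ} (ht : t ∈ Ioo 0 P.T) :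
    P.lev M t < M ∧ t ∈ Ioc (P.lev M t * P.dt M) ((P.lev M t + 1) * P.dt M) ∧
      ⌈t / P.dt M⌉₊ = P.lev M t + 1 := by
  have hdt := hP.dt_pos hM
  have hMdt : (M : ℝ) * P.dt M = P.T := by unfold Problem.dt; field_simp
  have h1 : 0 < ⌈t / P.dt M⌉₊ := Nat.ceil_pos.2 (div_pos ht.1 hdt)
  have h2 : ⌈t / P.dt M⌉₊ ≤ M := Nat.ceil_le.2 ((div_le_iff₀ hdt).2 (by rw [hMdt]; exact ht.2.le))
  have h3 : ⌈t / P.dt M⌉₊ = P.lev M t + 1 := by unfold lev; omega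
  have h4 := (Nat.ceil_eq_iff (Nat.succ_ne_zero _)).1 h3
  rw [lt_div_iff₀ hdt, div_le_iff₀ hdt] at h4
  push_cast at h4
  exact ⟨by omega, h4, h3⟩

lemma integral_time_eq_sum {M : ℕ} (hM : 0 < M) {f : ℝ → ℝ} (hf : IntegrableOn f (Ioo 0 P.T)) :
    ∫ t in Ioo 0 P.T, f t =
      ∑ n ∈ Finset.range M, ∫ t in (n * P.dt M)..((n + 1) * P.dt M), f t := by
  have hdt := hP.dt_pos hM
  have hMdt : (M : ℝ) * P.dt M = P.T := by unfold Problem.dt; field_simp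
  have hf' : IntervalIntegrable f volume 0 P.T := by
    rw [intervalIntegrable_iff_integrableOn_Ioo_of_le hP.T_pos.le]; exact hf
  have := intervalIntegral.sum_integral_adjacent_intervals (μ := volume) (f := f)
    (a := fun k : ℕ => (k : ℝ) * P.dt M) (n := M) fun k hk => hf'.mono_set (by
      have h2 : (k : ℝ) + 1 ≤ M := by exact_mod_cast hk
      have hk0 : (0 : ℝ) ≤ k := Nat.cast_nonneg k
      rw [uIcc_of_le hP.T_pos.le]
      push_cast
      exact uIcc_subset_Icc ⟨by positivity, by nlinarith⟩ ⟨by positivity, by nlinarith⟩)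
  simp only [Nat.cast_zero, zero_mul, Nat.cast_add, Nat.cast_one, hMdt] at this
  rw [integral_Ioo_eq _ hP.T_pos.le, this]

lemma integral_comp_lev {M : ℕ} (hM : 0 < M) (h : ℕ → ℝ) :
    IntegrableOn (fun t => h (P.lev M t)) (Ioo 0 P.T) ∧
    ∫ t in Ioo 0 P.T, h (P.lev M t) = ∑ n ∈ Finset.range M, P.dt M * h n := by
  have hdt := hP.dt_pos hM
  have hint : IntegrableOn (fun t => h (P.lev M t)) (Ioo 0 P.T) := by
    refine Measure.integrableOn_of_bounded (M := ∑ n ∈ Finset.range M, |h n|) (by simp)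
      ((measurable_of_countable h).comp (measurable_lev M)).aestronglyMeasurable ?_
    filter_upwards [ae_restrict_mem measurableSet_Ioo] with t ht
    exact Finset.single_le_sum (f := fun n => |h n|) (fun _ _ => abs_nonneg _)
      (Finset.mem_range.2 (hP.lev_lt hM ht).1)
  refine ⟨hint, ?_⟩
  rw [hP.integral_time_eq_sum hM hint]
  refine Finset.sum_congr rfl fun n _ => ?_
  have hle : (n : ℝ) * P.dt M ≤ (n + 1) * P.dt M := by nlinarith
  rw [intervalIntegral.integral_of_le hle,
    setIntegral_congr_fun (g := fun _ => h n) measurableSet_Ioc fun t ht => by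
      simp only [(hP.lev_eq hM ht).1]]
  simp [add_mul, hdt.le]

end Problem.Admissible

/-! ### Derivatives of test functions -/

lemma hasDerivAt_fst {ψ : ℝ × ℝ → ℝ} (hψ : ContDiff ℝ ∞ ψ) (x t : ℝ) :
    HasDerivAt (fun y => ψ (y, t)) (fderiv ℝ ψ (x, t) (1, 0)) x := by
  have h := (hψ.differentiable (by simp) (x, t)).hasFDerivAt
  exact h.comp_hasDerivAt x ((hasDerivAt_id x).prodMk (hasDerivAt_const x t))

lemma hasDerivAt_snd {ψ : ℝ × ℝ → ℝ} (hψ : ContDiff ℝ ∞ ψ) (x t : ℝ) :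
    HasDerivAt (fun s => ψ (x, s)) (fderiv ℝ ψ (x, t) (0, 1)) t := by
  have h := (hψ.differentiable (by simp) (x, t)).hasFDerivAt
  exact h.comp_hasDerivAt t ((hasDerivAt_const t x).prodMk (hasDerivAt_id t))

lemma continuous_fderiv_apply {ψ : ℝ × ℝ → ℝ} (hψ : ContDiff ℝ ∞ ψ) (v : ℝ × ℝ) :
    Continuous fun z => fderiv ℝ ψ z v :=
  (hψ.continuous_fderiv (by simp)).clm_apply continuous_const

lemma exists_bound_fderiv_apply {ψ : ℝ × ℝ → ℝ} (hψ : ContDiff ℝ ∞ ψ) (hc : HasCompactSupport ψ)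
    (v : ℝ × ℝ) : ∃ C, ∀ z, |fderiv ℝ ψ z v| ≤ C := by
  have : HasCompactSupport fun z => fderiv ℝ ψ z v :=
    (hc.fderiv ℝ).comp_left (g := fun L : ℝ × ℝ →L[ℝ] ℝ => L v) (by simp)
  obtain ⟨C, hC⟩ := this.exists_bound_of_continuous (continuous_fderiv_apply hψ v)
  exact ⟨C, hC⟩

lemma contDiff_slice {ψ : ℝ × ℝ → ℝ} (hψ : ContDiff ℝ ∞ ψ) (t : ℝ) :
    ContDiff ℝ 1 fun x => ψ (x, t) :=
  (hψ.of_le (by simp)).comp (contDiff_id.prodMk contDiff_const)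

namespace Problem.IsSchemeSolution

variable {P : Problem} {N M : ℕ} {w : Unknowns} (hw : P.IsSchemeSolution N M w)
  (hP : P.Admissible) (hN : 0 < N) (hM : 0 < M)

include hw hN

/-- The diffusive parts cancel exactly, also at the interface and at the outer boundary, because
`gradL` and `gradR` use the same transmissibilities as the flux. -/
lemma flux_add_grad {n : ℕ} (hn : n < M) {j : ℤ} (hj : -(N : ℤ) ≤ j) (hj' : j < N) :
    P.flux N M w n j + P.gradL N M w n j = P.G (cellLayer j)
      (lval N (P.ulMean M n) (w.face 1 (n + 1)) (w.cell (n + 1)) j) (w.cell (n + 1) j) ∧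
    P.flux N M w n (j + 1) + P.gradR N M w n j = P.G (cellLayer j) (w.cell (n + 1) j)
      (rval N (P.urMean M n) (w.face 0 (n + 1)) (w.cell (n + 1)) j) := by
  rw [P.flux_left (hw.face_flux n hn) hj', P.flux_right hN hj]
  unfold twoPoint gradL gradR
  constructor <;> ring

lemma trace_mem {n : ℕ} (hn : n < M) (i : Fin 2) :
    traceL N w n i ∈ Icc (0 : ℝ) 1 ∧ traceR N w n i ∈ Icc (0 : ℝ) 1 := by
  have h1 := hw.cell_mem (n + 1) hn (-(N : ℤ)) le_rfl (by omega)
  have h2 := hw.cell_mem (n + 1) hn ((N : ℤ) - 1) (by omega) (by omega)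
  unfold traceL traceR
  split_ifs
  exacts [⟨h1, hw.face_mem n hn 0⟩, ⟨hw.face_mem n hn 1, h2⟩]

include hP hM

lemma abs_H_le {CG : ℝ} (hCG : ∀ i, ∀ a ∈ Icc (0 : ℝ) 1, ∀ b ∈ Icc (0 : ℝ) 1, |P.G i a b| ≤ CG)
    {n : ℕ} (hn : n < M) {x : ℝ} (hx : x ∈ Ico (-1 : ℝ) 1) :
    |lin N (fun j => P.flux N M w n j + P.gradL N M w n j)
      (fun j => P.flux N M w n (j + 1) + P.gradR N M w n j) x| ≤ CG := by
  have hj := floor_mem hN hx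
  have h := hw.flux_add_grad hN hn hj.1 hj.2
  have hc := hw.cell_mem (n + 1) hn _ hj.1 hj.2
  refine abs_lin_le ?_ ?_
  · simp only [h.1]; exact hCG _ _ (hw.lval_mem hP hM hn hj.1 hj.2) _ hc
  · simp only [h.2]; exact hCG _ _ hc _ (hw.rval_mem hP hM hn hj.1 hj.2)

omit hM in
lemma poro_mul_cell_integrable {n : ℕ} (hn : n ≤ M) {χ : ℝ → ℝ} (hχ : Continuous χ) :
    IntegrableOn (fun x => P.poro x * w.cell n ⌊x / dx N⌋ * χ x) (Ioo (-1) 1) := by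
  have : IntervalIntegrable (fun x => P.poro x * w.cell n ⌊x / dx N⌋ * χ x) volume (-1) 1 := by
    refine IntervalIntegrable.mul_continuousOn ?_ hχ.continuousOn
    refine intervalIntegrable_of_bound (C := 1) (P.measurable_poro.mul (measurable_cell N (w.cell n))) ?_
      (by simp) (by simp)
    intro x hx
    have hj := floor_mem hN hx
    have h1 := hw.cell_mem n hn _ hj.1 hj.2
    have h3 : |P.poro x| ≤ 1 := abs_le.2 ⟨by linarith [(hP.poro_mem x).1], (hP.poro_mem x).2.le⟩
    rw [Pi.mul_apply, abs_mul]
    exact mul_le_one₀ h3 (abs_nonneg _) (abs_le.2 ⟨by linarith [h1.1], h1.2⟩)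
  rwa [intervalIntegrable_iff_integrableOn_Ioo_of_le (by norm_num)] at this

/-- One time step of the conservation law, as a difference of moments. -/
lemma moment_sub {n : ℕ} (hn : n < M) {χ : ℝ → ℝ} (hχ : ContDiff ℝ 1 χ) :
    (∫ x in Ioo (-1 : ℝ) 1, P.poro x * w.cell (n + 1) ⌊x / dx N⌋ * χ x)
      - ∫ x in Ioo (-1 : ℝ) 1, P.poro x * w.cell n ⌊x / dx N⌋ * χ x =
    P.dt M * ((∫ x in Ioo (-1 : ℝ) 1,
        lin N (P.flux N M w n) (fun j => P.flux N M w n (j + 1)) x * deriv χ x)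
      - P.flux N M w n N * χ 1 + P.flux N M w n (-(N : ℤ)) * χ (-1)) := by
  have h := hw.integral_flux_mul_deriv hP hN hM hn hχ
  rw [← integral_sub (hw.poro_mul_cell_integrable hP hN hn hχ.continuous)
    (hw.poro_mul_cell_integrable hP hN hn.le hχ.continuous),
    integral_Ioo_eq _ (by norm_num), integral_Ioo_eq _ (by norm_num)]
  rw [show (fun x => P.poro x * w.cell (n + 1) ⌊x / dx N⌋ * χ x - P.poro x * w.cell n ⌊x / dx N⌋ * χ x)
    = fun x => P.poro x * (w.cell (n + 1) ⌊x / dx N⌋ - w.cell n ⌊x / dx N⌋) * χ x by ext x; ring]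
  linarith

/-- Equicontinuity in time of the moments. -/
lemma abs_moment_sub_le {CG : ℝ}
    (hCG : ∀ i, ∀ a ∈ Icc (0 : ℝ) 1, ∀ b ∈ Icc (0 : ℝ) 1, |P.G i a b| ≤ CG)
    {χ : ℝ → ℝ} (hχ : ContDiff ℝ 1 χ) (h1 : χ (-1) = 0) (h2 : χ 1 = 0) {B : ℝ} (hB : 0 ≤ B)
    (hχB : ∀ x ∈ Ioo (-1 : ℝ) 1, |deriv χ x| ≤ B) {δ : ℝ} (hδ : 0 < δ) {n m : ℕ} (hnm : n + m ≤ M) :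
    |(∫ x in Ioo (-1 : ℝ) 1, P.poro x * w.cell (n + m) ⌊x / dx N⌋ * χ x)
      - ∫ x in Ioo (-1 : ℝ) 1, P.poro x * w.cell n ⌊x / dx N⌋ * χ x| ≤
    B * ((2 * CG + 2 / δ) * (m * P.dt M)
      + δ * ∑ k ∈ Finset.range m, P.dt M * P.energy N M w (n + k)) := by
  have hdt := hP.dt_pos hM
  induction m with
  | zero => simp
  | succ m ih =>
    have ih := ih (by omega)
    have hs := hw.moment_sub hP hN hM (n := n + m) (by omega) hχ
    rw [h1, h2] at hs
    simp only [mul_zero, sub_zero, add_zero] at hs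
    have hg := integral_grad_sq_le (P := P) (M := M) (w := w) hN (n + m)
    set l := lin N (P.gradL N M w (n + m)) (P.gradR N M w (n + m)) with hl
    have hflux : |∫ x in Ioo (-1 : ℝ) 1, lin N (P.flux N M w (n + m))
        (fun j => P.flux N M w (n + m) (j + 1)) x * deriv χ x| ≤
        B * (2 * CG + 2 / δ + δ * P.energy N M w (n + m)) := by
      obtain ⟨D, hD⟩ := exists_abs_lin_le hN (P.gradL N M w (n + m)) (P.gradR N M w (n + m))
      have il : IntervalIntegrable (fun x => l x ^ 2) volume (-1) 1 :=
        intervalIntegrable_of_bound ((measurable_lin N _ _).pow_const 2) (C := D ^ 2)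
          (fun x hx => by rw [abs_pow]; exact pow_le_pow_left₀ (abs_nonneg _) (hD x hx) 2)
          (by simp) (by simp)
      have ib : IntervalIntegrable (fun x => B * (CG + 1 / δ + δ * l x ^ 2)) volume (-1) 1 :=
        ((intervalIntegrable_const).add (il.const_mul δ)).const_mul B
      rw [integral_Ioo_eq _ (by norm_num), ← Real.norm_eq_abs]
      refine (intervalIntegral.norm_integral_le_of_norm_le (by norm_num) ?_ ib).trans ?_
      · have hne : ∀ᵐ x : ℝ, x ≠ 1 := by simp [ae_iff]
        filter_upwards [hne] with x hx1 hx
        have hx' : x ∈ Ioo (-1 : ℝ) 1 := ⟨hx.1, hx.2.lt_of_ne hx1⟩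
        have a1 := hw.abs_H_le hP hN hM hCG (n := n + m) (by omega) (x := x) ⟨hx'.1.le, hx'.2⟩
        have a2 := lin_sub N (P.flux N M w (n + m)) (fun j => P.flux N M w (n + m) (j + 1))
          (P.gradL N M w (n + m)) (P.gradR N M w (n + m)) x
        rw [Real.norm_eq_abs, abs_mul, mul_comm B]
        refine mul_le_mul ?_ (hχB x hx') (abs_nonneg _) ?_
        · rw [← a2]
          refine (abs_sub _ _).trans ?_
          -- Young's inequality. The quadratic part sums over the time steps to the energy, with the
          -- small factor `δ`. The rest is proportional to elapsed time.
          have a3 : |l x| ≤ 1 / δ + δ * l x ^ 2 := by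
            have : 1 / δ * δ = 1 := by field_simp
            rw [← sq_abs]
            have h0 : 0 < 1 / δ := by positivity
            nlinarith [sq_nonneg (δ * |l x| - 1), abs_nonneg (l x), mul_nonneg h0.le (sq_nonneg (δ * |l x| - 1))]
          linarith
        · have := (abs_nonneg _).trans a1
          positivity
      · rw [intervalIntegral.integral_const_mul, intervalIntegral.integral_add intervalIntegrable_const
          (il.const_mul δ), intervalIntegral.integral_const_mul]
        refine mul_le_mul_of_nonneg_left ?_ hB
        have := mul_le_mul_of_nonneg_left hg hδ.le
        simp only [intervalIntegral.integral_const, smul_eq_mul]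
        calc _ ≤ (1 - -1) * (CG + 1 / δ) + δ * P.energy N M w (n + m) := by linarith
          _ = _ := by ring
    have htri := abs_sub_le (∫ x in Ioo (-1 : ℝ) 1, P.poro x * w.cell (n + (m + 1)) ⌊x / dx N⌋ * χ x)
      (∫ x in Ioo (-1 : ℝ) 1, P.poro x * w.cell (n + m) ⌊x / dx N⌋ * χ x)
      (∫ x in Ioo (-1 : ℝ) 1, P.poro x * w.cell n ⌊x / dx N⌋ * χ x)
    rw [← add_assoc, hs, abs_mul, abs_of_pos hdt] at htri
    have := mul_le_mul_of_nonneg_left hflux hdt.le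
    rw [Finset.sum_range_succ, ← add_assoc]
    push_cast
    linarith

end Problem.IsSchemeSolution
end TwoPhase
-- Discrete solutions are approximate solutions.
namespace TwoPhase
namespace Problem.IsSchemeSolution

variable {P : Problem} {N M : ℕ} {w : Unknowns} (hw : P.IsSchemeSolution N M w)
  (hP : P.Admissible) (hN : 0 < N) (hM : 0 < M)

include hN in
lemma exists_index {i : Fin 2} {x : ℝ} (hx : x ∈ dom i) :
    ∃ k : ℕ, k < N ∧ ⌊x / dx N⌋ = start N i + k ∧ cellLayer ⌊x / dx N⌋ = i ∧
      x ∈ Ico ((start N i + k : ℤ) * dx N) (((start N i + k : ℤ) + 1) * dx N) := by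
  have hdx := dx_pos hN
  have hj := floor_mem hN (Ioo_subset_Ico_self (dom_subset i hx))
  have h0 : (⌊x / dx N⌋ : ℝ) * dx N ≤ x := (le_div_iff₀ hdx).1 (Int.floor_le _)
  have h1 : x < (⌊x / dx N⌋ + 1 : ℝ) * dx N := (div_lt_iff₀ hdx).1 (Int.lt_floor_add_one _)
  generalize ⌊x / dx N⌋ = j at *
  have key : start N i ≤ j ∧ j < start N i + N ∧ cellLayer j = i := by
    unfold start cellLayer
    fin_cases i
    · have : j < 0 := by
        have hx0 : x < 0 := by simp [dom] at hx; exact hx.2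
        have : (j : ℝ) < 0 := by nlinarith
        exact_mod_cast this
      simp [this]; omega
    · have : 0 ≤ j := by
        have hx0 : 0 < x := by simp [dom] at hx; exact hx.1
        have : (-1 : ℝ) < j := by nlinarith
        have : -1 < j := by exact_mod_cast this
        omega
      simp [this]; omega
  have hk : j = start N i + ((j - start N i).toNat : ℕ) := by omega
  refine ⟨(j - start N i).toNat, by omega, hk, key.2.2, ?_⟩
  rw [← hk]
  exact ⟨h0, h1⟩

include hN in
lemma start_mul_dx (i : Fin 2) : (start N i : ℝ) * dx N = left i := by
  have := mul_dx N hN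
  unfold start left
  split_ifs
  · push_cast; linarith
  · simp

include hP hM in
lemma reconstruct_eq {x t : ℝ} (ht : t ∈ Ioo 0 P.T) :
    P.reconstruct N M w (x, t) = w.cell (P.lev M t + 1) ⌊x / dx N⌋ := by
  simp only [reconstruct, (hP.lev_lt hM ht).2.2]

lemma measurable_reconstruct : Measurable (P.reconstruct N M w) := by
  have h : Measurable fun z : ℕ × ℝ => w.cell z.1 ⌊z.2 / dx N⌋ :=
    measurable_from_prod_countable_right fun n => measurable_cell N (w.cell n)
  exact h.comp (((measurable_snd.div_const _).nat_ceil).prodMk measurable_fst)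

include hw hP hN hM

/-- On a cell of value `c` with neighbours `a` and `b`, the flux interpolates between `G(a,c)` and
`G(c,b)`, while `f(c) = G(c,c)`. The Lipschitz bound of `G` and the jump bounds on `φ` conclude. -/
lemma H_near {LG : ℝ} (hLG : ∀ i, ∀ a ∈ Icc (0 : ℝ) 1, ∀ b ∈ Icc (0 : ℝ) 1,
    ∀ c ∈ Icc (0 : ℝ) 1, ∀ d ∈ Icc (0 : ℝ) 1, |P.G i a b - P.G i c d| ≤ LG * (|a - c| + |b - d|))
    {n : ℕ} (hn : n < M) {i : Fin 2} {x : ℝ} (hx : x ∈ dom i) (hx1 : |x| < 1 - dx N) :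
    ∃ a ∈ Icc (0 : ℝ) 1, ∃ b ∈ Icc (0 : ℝ) 1,
      |P.phi i a - P.phi i (w.cell (n + 1) ⌊x / dx N⌋)| ≤ √(dx N) * √(P.energy N M w n) ∧
      |P.phi i b - P.phi i (w.cell (n + 1) ⌊x / dx N⌋)| ≤ √(dx N) * √(P.energy N M w n) ∧
      |lin N (fun j => P.flux N M w n j + P.gradL N M w n j)
        (fun j => P.flux N M w n (j + 1) + P.gradR N M w n j) x
        - P.f i (w.cell (n + 1) ⌊x / dx N⌋)| ≤
      LG * (|a - w.cell (n + 1) ⌊x / dx N⌋| + |b - w.cell (n + 1) ⌊x / dx N⌋|) := by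
  have hdx := dx_pos hN
  obtain ⟨k, hk, -, hl, -⟩ := exists_index hN hx
  have hj := floor_mem hN (Ioo_subset_Ico_self (dom_subset i hx))
  have hNdx := mul_dx N hN
  have hj1 : -(N : ℤ) < ⌊x / dx N⌋ ∧ ⌊x / dx N⌋ < N - 1 := by
    rw [abs_lt] at hx1
    constructor
    · rw [← Int.add_one_le_iff, Int.le_floor, le_div_iff₀ hdx]
      push_cast
      nlinarith
    · rw [Int.floor_lt, div_lt_iff₀ hdx]
      push_cast
      nlinarith
  have hc := hw.cell_mem (n + 1) hn _ hj.1 hj.2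
  have ha := hw.lval_mem hP hM hn hj.1 hj.2
  have hb := hw.rval_mem hP hM hn hj.1 hj.2
  have e1 := phi_lval_sub_le (P := P) (M := M) (w := w) hN n hj1.1 hj.2
  have e2 := phi_rval_sub_le (P := P) (M := M) (w := w) hN n hj.1 hj1.2
  have hG := hw.flux_add_grad hN hn hj.1 hj.2
  rw [hl] at e1 e2 hG
  refine ⟨_, ha, _, hb, e1, e2, ?_⟩
  unfold lin
  simp only [hG.1, hG.2]
  rw [← hP.G_diag i _ hc]
  set c := w.cell (n + 1) ⌊x / dx N⌋
  set a := lval N (P.ulMean M n) (w.face 1 (n + 1)) (w.cell (n + 1)) ⌊x / dx N⌋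
  set b := rval N (P.urMean M n) (w.face 0 (n + 1)) (w.cell (n + 1)) ⌊x / dx N⌋
  have g1 := hLG i a ha c hc c hc c hc
  have g2 := hLG i c hc b hb c hc c hc
  simp only [sub_self, abs_zero, add_zero, zero_add] at g1 g2
  have f0 := Int.fract_nonneg (x / dx N)
  have f1 := (Int.fract_lt_one (x / dx N)).le
  set s := Int.fract (x / dx N)
  have : P.G i a c * (1 - s) + P.G i c b * s - P.G i c c =
      (1 - s) * (P.G i a c - P.G i c c) + s * (P.G i c b - P.G i c c) := by ring
  rw [this]
  refine (abs_add_le _ _).trans ?_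
  rw [abs_mul, abs_mul, abs_of_nonneg f0, abs_of_nonneg (sub_nonneg.2 f1)]
  have h1 : (1 - s) * |P.G i a c - P.G i c c| ≤ LG * |a - c| :=
    (mul_le_of_le_one_left (abs_nonneg _) (by linarith)).trans g1
  have h2 : s * |P.G i c b - P.G i c c| ≤ LG * |b - c| :=
    (mul_le_of_le_one_left (abs_nonneg _) f1).trans g2
  linarith

/-- The saturation is constant in time on each step, so the time derivative of `ψ` integrates
exactly there. -/
lemma weak_time {ψ : ℝ × ℝ → ℝ} (hψ : P.IsTest ψ) :
    ∫ z in Ioo (-1 : ℝ) 1 ×ˢ Ioo 0 P.T, P.poro z.1 * P.reconstruct N M w z *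
        deriv (fun t => ψ (z.1, t)) z.2 =
      ∑ n ∈ Finset.range M, ∫ x in Ioo (-1 : ℝ) 1, P.poro x * w.cell (n + 1) ⌊x / dx N⌋ *
        (ψ (x, (n + 1) * P.dt M) - ψ (x, n * P.dt M)) := by
  have hdt := hP.dt_pos hM
  obtain ⟨D, hD⟩ := exists_bound_fderiv_apply hψ.1 hψ.2.1 (0, 1)
  have hder : ∀ x t, deriv (fun t => ψ (x, t)) t = fderiv ℝ ψ (x, t) (0, 1) :=
    fun x t => (hasDerivAt_snd hψ.1 x t).deriv
  have hcd := continuous_fderiv_apply hψ.1 (0, 1)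
  have hD0 : 0 ≤ D := (abs_nonneg _).trans (hD 0)
  simp only [hder]
  have hmeas : Measurable fun z : ℝ × ℝ => P.poro z.1 * P.reconstruct N M w z *
      fderiv ℝ ψ (z.1, z.2) (0, 1) :=
    ((P.measurable_poro.comp measurable_fst).mul measurable_reconstruct).mul hcd.measurable
  have hbd : ∀ x ∈ Ioo (-1 : ℝ) 1, ∀ t ∈ Ioo 0 P.T,
      |P.poro x * P.reconstruct N M w (x, t) * fderiv ℝ ψ (x, t) (0, 1)| ≤ D := by
    intro x hx t ht
    have hj := floor_mem hN (Ioo_subset_Ico_self hx)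
    have h1 := hw.cell_mem (P.lev M t + 1) (hP.lev_lt hM ht).1 _ hj.1 hj.2
    have h2 := hP.poro_mem x
    rw [reconstruct_eq hP hM ht, abs_mul, abs_mul, abs_of_pos h2.1, abs_of_nonneg h1.1]
    exact (mul_le_of_le_one_left (abs_nonneg _) (mul_le_one₀ h2.2.le h1.1 h1.2)).trans (hD _)
  have hint := integrableOn_cylinder (P := P) hmeas.aestronglyMeasurable hbd
  rw [Measure.volume_eq_prod, setIntegral_prod _ (by rwa [Measure.volume_eq_prod] at hint),
    ← integral_finsetSum _ fun n hn => ?_]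
  · refine setIntegral_congr_fun measurableSet_Ioo fun x hx => ?_
    have hint' : IntegrableOn (fun t => P.poro x * P.reconstruct N M w (x, t) *
        fderiv ℝ ψ (x, t) (0, 1)) (Ioo 0 P.T) := by
      refine Measure.integrableOn_of_bounded (M := D) (by simp)
        (hmeas.comp measurable_prodMk_left).aestronglyMeasurable ?_
      filter_upwards [ae_restrict_mem measurableSet_Ioo] with t ht
      exact hbd x hx t ht
    simp only
    rw [hP.integral_time_eq_sum hM hint']
    refine Finset.sum_congr rfl fun n hn => ?_
    have hle : (n : ℝ) * P.dt M ≤ (n + 1) * P.dt M := by nlinarith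
    rw [intervalIntegral.integral_of_le hle, setIntegral_congr_fun
      (g := fun t => P.poro x * w.cell (n + 1) ⌊x / dx N⌋ * fderiv ℝ ψ (x, t) (0, 1))
      measurableSet_Ioc fun t ht => by
        simp only [reconstruct, (hP.lev_eq hM ht).2],
      integral_const_mul, ← intervalIntegral.integral_of_le hle,
      intervalIntegral.integral_eq_sub_of_hasDerivAt (fun t _ => hasDerivAt_snd hψ.1 x t)
        ((hcd.comp (by fun_prop : Continuous fun t : ℝ => (x, t))).intervalIntegrable _ _)]
  · have hc := hψ.1.continuous
    exact hw.poro_mul_cell_integrable hP hN (Finset.mem_range.1 hn) (by fun_prop)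

omit hw in
lemma weak_space {ψ : ℝ × ℝ → ℝ} (hψ : P.IsTest ψ) :
    ∫ z in Ioo (-1 : ℝ) 1 ×ˢ Ioo 0 P.T, ((P.toApprox N M w).H z - (P.toApprox N M w).g z) *
        deriv (fun x => ψ (x, (P.toApprox N M w).fl z.2)) z.1 =
      ∑ n ∈ Finset.range M, P.dt M * ∫ x in Ioo (-1 : ℝ) 1,
        lin N (P.flux N M w n) (fun j => P.flux N M w n (j + 1)) x *
          deriv (fun x => ψ (x, n * P.dt M)) x := by
  have hdt := hP.dt_pos hM
  obtain ⟨D, hD⟩ := exists_bound_fderiv_apply hψ.1 hψ.2.1 (1, 0)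
  have hder : ∀ x t, deriv (fun x => ψ (x, t)) x = fderiv ℝ ψ (x, t) (1, 0) :=
    fun x t => (hasDerivAt_fst hψ.1 x t).deriv
  have hcd := continuous_fderiv_apply hψ.1 (1, 0)
  have hD0 : 0 ≤ D := (abs_nonneg _).trans (hD 0)
  simp only [toApprox, lin_sub, hder]
  have hmeas : Measurable fun z : ℝ × ℝ => lin N (P.flux N M w (P.lev M z.2))
      (fun j => P.flux N M w (P.lev M z.2) (j + 1)) z.1 *
        fderiv ℝ ψ (z.1, (P.lev M z.2 : ℝ) * P.dt M) (1, 0) :=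
    measurable_comp_lev (P := P) M (f := fun n x => lin N (P.flux N M w n)
      (fun j => P.flux N M w n (j + 1)) x * fderiv ℝ ψ (x, (n : ℝ) * P.dt M) (1, 0)) fun n =>
      (measurable_lin N _ _).mul
        (hcd.comp (by fun_prop : Continuous fun x : ℝ => (x, (n : ℝ) * P.dt M))).measurable
  choose E hE using fun n => exists_abs_lin_le hN (P.flux N M w n) (fun j => P.flux N M w n (j + 1))
  have hint := integrableOn_cylinder (P := P) hmeas.aestronglyMeasurable
    (C := (∑ n ∈ Finset.range M, |E n|) * D) fun x hx t ht => by
      have h1 := hE (P.lev M t) x (Ioo_subset_Ico_self hx)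
      have h2 := Finset.single_le_sum (f := fun n => |E n|) (fun _ _ => abs_nonneg _)
        (Finset.mem_range.2 (hP.lev_lt hM ht).1)
      rw [abs_mul]
      exact mul_le_mul ((h1.trans (le_abs_self _)).trans h2) (hD _) (abs_nonneg _)
        (Finset.sum_nonneg fun _ _ => abs_nonneg _)
  have h3 := integral_prod_symm (μ := volume.restrict (Ioo (-1 : ℝ) 1))
    (ν := volume.restrict (Ioo 0 P.T)) _ (by
      rw [Measure.prod_restrict, ← Measure.volume_eq_prod]; exact hint)
  rw [Measure.prod_restrict, ← Measure.volume_eq_prod] at h3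
  rw [h3]
  exact (hP.integral_comp_lev hM (fun n => ∫ x in Ioo (-1 : ℝ) 1,
        lin N (P.flux N M w n) (fun j => P.flux N M w n (j + 1)) x *
          fderiv ℝ ψ (x, n * P.dt M) (1, 0))).2

/-- Abel summation in time. The increment of `ψ` over a step is combined with the increment of the
saturation, given by `moment_sub` with `ψ` frozen at the beginning of the step. -/
lemma weak {ψ : ℝ × ℝ → ℝ} (hψ : P.IsTest ψ) (A : Approx) (hA : A = P.toApprox N M w) :
    (∫ z in Ioo (-1 : ℝ) 1 ×ˢ Ioo 0 P.T, P.poro z.1 * A.u z * deriv (fun t => ψ (z.1, t)) z.2)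
    + (∫ x in Ioo (-1 : ℝ) 1, P.poro x * A.u0 x * ψ (x, 0))
    + (∫ z in Ioo (-1 : ℝ) 1 ×ˢ Ioo 0 P.T, (A.H z - A.g z) * deriv (fun x => ψ (x, A.fl z.2)) z.1)
    + (∫ t in Ioo 0 P.T, P.G 0 (A.bl t) (A.tl 0 t) * ψ (-1, A.fl t))
    - (∫ t in Ioo 0 P.T, P.G 1 (A.tr 1 t) (A.br t) * ψ (1, A.fl t)) = 0 := by
  subst hA
  have hMdt : (M : ℝ) * P.dt M = P.T := by unfold Problem.dt; field_simp
  rw [weak_space hP hN hM hψ]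
  have h1 := hw.weak_time hP hN hM hψ
  have h2 := (hP.integral_comp_lev hM fun n =>
    P.flux N M w n (-(N : ℤ)) * ψ (-1, (n : ℝ) * P.dt M)).2
  have h3 := (hP.integral_comp_lev hM fun n => P.flux N M w n N * ψ (1, (n : ℝ) * P.dt M)).2
  have hN1 : (N : ℤ) ≠ -N := by omega
  have e2 : ∀ n, P.flux N M w n (-(N : ℤ)) = P.G 0 (P.ulMean M n) (traceL N w n 0) := fun n => by
    simp [flux, traceL]
  have e3 : ∀ n, P.flux N M w n N = P.G 1 (traceR N w n 1) (P.urMean M n) := fun n => by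
    simp [flux, traceR, hN1]
  simp only [e2] at h2
  simp only [e3] at h3
  simp only [toApprox]
  rw [h1, h2, h3]
  have hmom : ∀ n ≤ M, ∀ t, IntegrableOn (fun x => P.poro x * w.cell n ⌊x / dx N⌋ * ψ (x, t))
      (Ioo (-1) 1) := fun n hn t =>
    hw.poro_mul_cell_integrable hP hN hn (contDiff_slice hψ.1 t).continuous
  let m : ℕ → ℕ → ℝ := fun n k => ∫ x in Ioo (-1 : ℝ) 1, P.poro x * w.cell n ⌊x / dx N⌋ *
    ψ (x, k * P.dt M)
  -- The diagonal terms `m n n` telescope from the initial datum to the final time, where `ψ`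
  -- vanishes because its support lies in `t < T`.
  have hT : m M M = 0 := by
    refine (integral_congr_ae (ae_of_all _ fun x => ?_)).trans (integral_zero _ _)
    have : ψ (x, P.T) = 0 := image_eq_zero_of_notMem_tsupport fun h => lt_irrefl P.T (hψ.2.2 h)
    simp [hMdt, this]
  have h4 : ∀ n ∈ Finset.range M, ∫ x in Ioo (-1 : ℝ) 1, P.poro x * w.cell (n + 1) ⌊x / dx N⌋ *
        (ψ (x, (n + 1) * P.dt M) - ψ (x, n * P.dt M)) =
      (m (n + 1) (n + 1) - m n n) - P.dt M * ((∫ x in Ioo (-1 : ℝ) 1,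
        lin N (P.flux N M w n) (fun j => P.flux N M w n (j + 1)) x *
          deriv (fun x => ψ (x, n * P.dt M)) x)
        - P.flux N M w n N * ψ (1, n * P.dt M) + P.flux N M w n (-(N : ℤ)) * ψ (-1, n * P.dt M)) := by
    intro n hn
    have hn := Finset.mem_range.1 hn
    rw [← hw.moment_sub hP hN hM hn (contDiff_slice hψ.1 _)]
    have : (fun x => P.poro x * w.cell (n + 1) ⌊x / dx N⌋ *
        (ψ (x, (n + 1) * P.dt M) - ψ (x, n * P.dt M))) = fun x =>
        P.poro x * w.cell (n + 1) ⌊x / dx N⌋ * ψ (x, (n + 1) * P.dt M) -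
        P.poro x * w.cell (n + 1) ⌊x / dx N⌋ * ψ (x, n * P.dt M) := by ext x; ring
    rw [this, integral_sub (hmom _ hn _) (hmom _ hn _)]
    simp only [m]
    push_cast
    ring
  rw [Finset.sum_congr rfl h4, Finset.sum_sub_distrib, Finset.sum_range_sub (fun n => m n n), hT]
  have h0 : m 0 0 = ∫ x in Ioo (-1 : ℝ) 1, P.poro x * w.cell 0 ⌊x / dx N⌋ * ψ (x, 0) := by
    simp [m]
  rw [h0]
  simp only [mul_add, mul_sub, Finset.sum_add_distrib, Finset.sum_sub_distrib, e2, e3]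
  ring

/-- In the error `2 √δx + δt`, the first term carries the constant 2 of `phi_sub_le` and also
dominates `δx`, since `δx ≤ 1`. The second accounts for the rounding of time. -/
theorem isApprox {CE CG LG : ℝ} (hCE : ∑ n ∈ Finset.range M, P.dt M * P.energy N M w n ≤ CE)
    (hCE0 : 0 ≤ CE) (hCG0 : 0 ≤ CG)
    (hCG : ∀ i, ∀ a ∈ Icc (0 : ℝ) 1, ∀ b ∈ Icc (0 : ℝ) 1, |P.G i a b| ≤ CG)
    (hLG : ∀ i, ∀ a ∈ Icc (0 : ℝ) 1, ∀ b ∈ Icc (0 : ℝ) 1, ∀ c ∈ Icc (0 : ℝ) 1,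
      ∀ d ∈ Icc (0 : ℝ) 1, |P.G i a b - P.G i c d| ≤ LG * (|a - c| + |b - d|)) (hLG0 : 0 ≤ LG) :
    P.IsApprox (CE + CG + LG) (2 * √(dx N) + P.dt M) (P.toApprox N M w) := by
  have hdx := dx_pos hN
  have hdt := hP.dt_pos hM
  have hdx1 : dx N ≤ 1 := by
    unfold dx
    rw [div_le_one (by positivity)]
    exact_mod_cast hN
  have hsq : dx N ≤ √(dx N) := Real.le_sqrt_of_sq_le (by nlinarith)
  have hmt : ∀ f : ℕ → ℝ, Measurable fun t => f (P.lev M t) := fun f =>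
    (measurable_of_countable f).comp (measurable_lev M)
  have hE0 : ∀ n, 0 ≤ P.energy N M w n := energy_nonneg hN
  constructor
  case meas_u => exact measurable_reconstruct
  case meas_g => exact measurable_comp_lev M fun n => measurable_lin N _ _
  case meas_H =>
    exact measurable_comp_lev M (f := fun n => lin N (fun j => P.flux N M w n j + P.gradL N M w n j)
      (fun j => P.flux N M w n (j + 1) + P.gradR N M w n j)) fun n => measurable_lin N _ _
  case meas_K => exact hmt fun n => √(P.energy N M w n)
  case meas_fl => exact hmt fun n => n * P.dt M
  case meas_bl => exact hmt fun n => P.ulMean M n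
  case meas_br => exact hmt fun n => P.urMean M n
  case meas_u0 => exact measurable_cell N (w.cell 0)
  case meas_tl => exact fun i => hmt fun n => traceL N w n i
  case meas_tr => exact fun i => hmt fun n => traceR N w n i
  case u_mem =>
    intro x hx t ht
    have hj := floor_mem hN (Ioo_subset_Ico_self hx)
    change P.reconstruct N M w (x, t) ∈ _
    rw [reconstruct_eq hP hM ht]
    exact hw.cell_mem _ (hP.lev_lt hM ht).1 _ hj.1 hj.2
  case u0_mem =>
    intro x hx
    have hj := floor_mem hN (Ioo_subset_Ico_self hx)
    exact hw.cell_mem 0 (Nat.zero_le _) _ hj.1 hj.2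
  case tl_mem => exact fun i t ht => (hw.trace_mem hN (hP.lev_lt hM ht).1 i).1
  case tr_mem => exact fun i t ht => (hw.trace_mem hN (hP.lev_lt hM ht).1 i).2
  case bl_mem => exact fun t ht => hP.ulMean_mem hM (hP.lev_lt hM ht).1
  case br_mem => exact fun t ht => hP.urMean_mem hM (hP.lev_lt hM ht).1
  case fl_mem =>
    intro t ht
    have h := (hP.lev_lt hM ht).2.1
    exact ⟨by simp only [toApprox]; linarith [h.2, Real.sqrt_nonneg (dx N)], h.1.le⟩
  case abs_H_le =>
    intro x hx t ht
    have := hw.abs_H_le hP hN hM hCG (hP.lev_lt hM ht).1 (Ioo_subset_Ico_self hx)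
    simp only [toApprox]
    linarith
  case K_nonneg => exact fun t => Real.sqrt_nonneg _
  case K_int =>
    simp only [toApprox, Real.sq_sqrt (hE0 _)]
    exact (hP.integral_comp_lev hM _).1
  case K_sq =>
    simp only [toApprox, Real.sq_sqrt (hE0 _)]
    rw [(hP.integral_comp_lev hM _).2]
    linarith
  case g_bdd =>
    choose E hE using fun n => exists_abs_lin_le hN (P.gradL N M w n) (P.gradR N M w n)
    refine ⟨∑ n ∈ Finset.range M, |E n|, fun x hx t ht => ?_⟩
    exact ((hE (P.lev M t) x (Ioo_subset_Ico_self hx)).trans (le_abs_self _)).trans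
      (Finset.single_le_sum (f := fun n => |E n|) (fun _ _ => abs_nonneg _)
        (Finset.mem_range.2 (hP.lev_lt hM ht).1))
  case g_sq =>
    intro t ht
    simp only [toApprox, Real.sq_sqrt (hE0 _)]
    rw [integral_Ioo_eq _ (by norm_num)]
    exact integral_grad_sq_le hN _
  case near =>
    intro i x hx t ht
    obtain ⟨k, hk, hj, -, hx'⟩ := exists_index hN hx
    have h := phi_sub_le (P := P) (M := M) (w := w) hN (P.lev M t) i k hk hx'
    rw [start_mul_dx hN] at h
    change |P.phi i (P.reconstruct N M w (x, t)) - _| ≤ _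
    rw [reconstruct_eq hP hM ht, hj]
    refine h.trans ?_
    simp only [toApprox]
    nlinarith [Real.sqrt_nonneg (dx N), Real.sqrt_nonneg (P.energy N M w (P.lev M t)),
      mul_nonneg hdt.le (Real.sqrt_nonneg (P.energy N M w (P.lev M t)))]
  case right =>
    intro i t ht
    have h := phi_traceR_eq (P := P) (M := M) (w := w) hN (P.lev M t) i
    have h1 : ((start N i + N : ℤ) : ℝ) * dx N = left i + 1 := by
      rw [← start_mul_dx hN i]
      push_cast
      linarith [mul_dx N hN]
    rw [h1, start_mul_dx hN] at h
    exact h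
  case H_near =>
    intro i x hx t ht hx1
    obtain ⟨a, ha, b, hb, h1, h2, h3⟩ := hw.H_near hP hN hM hLG (hP.lev_lt hM ht).1 hx
      (by linarith [Real.sqrt_nonneg (dx N)])
    have hK : √(dx N) * √(P.energy N M w (P.lev M t)) ≤
        (2 * √(dx N) + P.dt M) * √(P.energy N M w (P.lev M t)) :=
      mul_le_mul_of_nonneg_right (by linarith [Real.sqrt_nonneg (dx N)]) (Real.sqrt_nonneg _)
    have hu : (P.toApprox N M w).u (x, t) = w.cell (P.lev M t + 1) ⌊x / dx N⌋ :=
      reconstruct_eq hP hM ht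
    rw [hu]
    refine ⟨a, ha, b, hb, h1.trans hK, h2.trans hK, h3.trans ?_⟩
    exact mul_le_mul_of_nonneg_right (by linarith) (by positivity)
  case compat => exact fun t ht => hw.face_graph _ (hP.lev_lt hM ht).1
  case equi =>
    intro χ hχ h1 h2 B hB hχB δ hδ s hs t ht hst
    have ls := hP.lev_lt hM hs
    have lt := hP.lev_lt hM ht
    have hle : P.lev M s ≤ P.lev M t := by
      unfold lev
      exact Nat.sub_le_sub_right (Nat.ceil_le_ceil (div_le_div_of_nonneg_right hst hdt.le)) 1
    obtain ⟨m, hm⟩ := Nat.exists_eq_add_of_le hle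
    have h := hw.abs_moment_sub_le hP hN hM hCG hχ h1 h2 hB hχB hδ (n := P.lev M s + 1) (m := m)
      (by omega)
    have e : ∀ t ∈ Ioo 0 P.T, ∫ x in Ioo (-1 : ℝ) 1, P.poro x * (P.toApprox N M w).u (x, t) * χ x =
        ∫ x in Ioo (-1 : ℝ) 1, P.poro x * w.cell (P.lev M t + 1) ⌊x / dx N⌋ * χ x := by
      intro t ht
      change ∫ x in Ioo (-1 : ℝ) 1, P.poro x * P.reconstruct N M w (x, t) * χ x = _
      simp only [reconstruct_eq hP hM ht]
    rw [e t ht, e s hs, show P.lev M t + 1 = P.lev M s + 1 + m by omega]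
    refine h.trans (mul_le_mul_of_nonneg_left ?_ hB)
    have hmt : (m : ℝ) * P.dt M ≤ t - s + (2 * √(dx N) + P.dt M) := by
      have : (P.lev M t : ℝ) = P.lev M s + m := by exact_mod_cast hm
      have h3 := lt.2.1.1
      have h4 := ls.2.1.2
      rw [this] at h3
      linarith [Real.sqrt_nonneg (dx N)]
    have hsum : ∑ k ∈ Finset.range m, P.dt M * P.energy N M w (P.lev M s + 1 + k) ≤ CE := by
      refine le_trans ?_ hCE
      rw [← Finset.sum_image (f := fun n => P.dt M * P.energy N M w n)
        (g := fun k => P.lev M s + 1 + k) (fun a _ b _ hab => by simpa using hab)]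
      refine Finset.sum_le_sum_of_subset_of_nonneg ?_ fun n _ _ => mul_nonneg hdt.le (hE0 n)
      intro n hn
      obtain ⟨k, hk, rfl⟩ := Finset.mem_image.1 hn
      rw [Finset.mem_range] at *
      omega
    have a1 : (2 * CG + 2 / δ) * (m * P.dt M) ≤
        (2 * (CE + CG + LG) + 2 / δ) * (t - s + (2 * √(dx N) + P.dt M)) :=
      mul_le_mul (by linarith) hmt (by positivity) (by positivity)
    have a2 := mul_le_mul_of_nonneg_left (hsum.trans (by linarith : CE ≤ CE + CG + LG)) hδ.le
    linarith
  case weak => exact fun ψ hψ => hw.weak hP hN hM hψ _ rfl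

end Problem.IsSchemeSolution

theorem Problem.Admissible.exists_isApprox {P : Problem} (hP : P.Admissible) :
    ∃ C, 0 ≤ C ∧ ∀ (N M : ℕ) (w : Problem.Unknowns), 0 < N → 0 < M → P.IsSchemeSolution N M w →
      P.IsApprox C (2 * √(Problem.dx N) + P.dt M) (P.toApprox N M w) := by
  obtain ⟨CE, hCE0, hCE⟩ := hP.exists_energy_bound
  obtain ⟨CG, hCG0, hCG⟩ := hP.exists_G_bound
  obtain ⟨LG, hLG0, hLG⟩ := hP.exists_G_lip
  exact ⟨CE + CG + LG, by positivity, fun N M w hN hM hw =>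
    hw.isApprox hP hN hM (hCE N M w hN hM hw) hCE0 hCG0 hCG hLG hLG0⟩

end TwoPhase
-- Abstract compactness tools and bump functions.
namespace TwoPhase

/-- A bounded sequence that is Cauchy at the points where a quantity with bounded second moments
is small has an almost everywhere convergent subsequence. -/
theorem exists_subseq_ae_tendsto {α E : Type*} [MeasurableSpace α] {μ : Measure α}
    [IsFiniteMeasure μ] [NormedAddCommGroup E] [CompleteSpace E] (f : ℕ → α → E)
    (hf : ∀ p, AEStronglyMeasurable (f p) μ) {B C : ℝ} (hB : ∀ p, ∀ᵐ x ∂μ, ‖f p x‖ ≤ B)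
    (K : ℕ → α → ℝ) (hK : ∀ p, Measurable (K p)) (hKi : ∀ p, Integrable (fun x => K p x ^ 2) μ)
    (hKC : ∀ p, ∫ x, K p x ^ 2 ∂μ ≤ C)
    (hc : ∀ᵐ x ∂μ, ∀ R > 0, ∀ η > 0, ∃ p₀, ∀ p ≥ p₀, ∀ q ≥ p₀, |K p x| ≤ R → |K q x| ≤ R →
      ‖f p x - f q x‖ ≤ η) :
    ∃ F : α → E, StronglyMeasurable F ∧ ∃ σ : ℕ → ℕ, StrictMono σ ∧
      ∀ᵐ x ∂μ, Tendsto (fun p => f (σ p) x) atTop (𝓝 (F x)) := by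
  have hfi : ∀ p, Integrable (f p) μ := fun p => Integrable.of_bound (hf p) B (hB p)
  set D : ℝ := max B 0 with hD
  have hD0 : 0 ≤ D := le_max_right _ _
  have hBD : ∀ p q, ∀ᵐ x ∂μ, ‖f p x - f q x‖ ≤ 2 * D := fun p q => by
    filter_upwards [hB p, hB q] with x h1 h2
    have := norm_sub_le (f p x) (f q x)
    have := le_max_left B 0
    linarith
  have hcauchy : ∀ ε > 0, ∃ p₀, ∀ p ≥ p₀, ∀ q ≥ p₀, ∫ x, ‖f p x - f q x‖ ∂μ < ε := by
    intro ε hε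
    have hC0 : 0 ≤ C := (integral_nonneg fun x => sq_nonneg _).trans (hKC 0)
    -- Chebyshev: where `K p` or `K q` exceeds `R`, the difference is at most `2 D` and this set
    -- contributes at most `4 D C / R²`.
    obtain ⟨R, hR, hRε⟩ : ∃ R : ℝ, 0 < R ∧ 4 * D * C / R ^ 2 < ε / 2 := by
      have h : Tendsto (fun R : ℝ => 4 * D * C / R ^ 2) atTop (𝓝 0) :=
        tendsto_const_nhds.div_atTop (tendsto_pow_atTop two_ne_zero)
      exact ((eventually_gt_atTop 0).and (h.eventually (gt_mem_nhds (half_pos hε)))).exists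
    -- The difference restricted to the good set. Indexing by pairs lets one use of dominated
    -- convergence along `ℕ × ℕ` give the Cauchy property.
    let e : ℕ × ℕ → α → ℝ := fun z => ({x | |K z.1 x| ≤ R} ∩ {x | |K z.2 x| ≤ R}).indicator
      fun x => ‖f z.1 x - f z.2 x‖
    have hset : ∀ z : ℕ × ℕ, MeasurableSet ({x | |K z.1 x| ≤ R} ∩ {x | |K z.2 x| ≤ R}) := fun z =>
      (measurableSet_le (hK _).abs measurable_const).inter (measurableSet_le (hK _).abs measurable_const)
    have hem : ∀ z, AEStronglyMeasurable (e z) μ := fun z =>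
      ((hf z.1).sub (hf z.2)).norm.indicator (hset z)
    have hel : ∀ z x, 0 ≤ e z x ∧ e z x ≤ ‖f z.1 x - f z.2 x‖ := fun z x =>
      ⟨indicator_nonneg (fun _ _ => norm_nonneg _) _, indicator_le_self' (fun _ _ => norm_nonneg _) _⟩
    have heb : ∀ z, ∀ᵐ x ∂μ, ‖e z x‖ ≤ 2 * D := fun z => by
      filter_upwards [hBD z.1 z.2] with x hx
      rw [Real.norm_of_nonneg (hel z x).1]
      exact (hel z x).2.trans hx
    have hlim : Tendsto (fun z : ℕ × ℕ => ∫ x, e z x ∂μ) atTop (𝓝 (∫ _, (0 : ℝ) ∂μ)) := by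
      refine tendsto_integral_filter_of_dominated_convergence (fun _ => 2 * D)
        (Eventually.of_forall hem) (Eventually.of_forall heb) (integrable_const _) ?_
      filter_upwards [hc] with x hx
      rw [Metric.tendsto_atTop]
      intro η hη
      obtain ⟨p₀, hp₀⟩ := hx R hR (η / 2) (half_pos hη)
      refine ⟨(p₀, p₀), fun z hz => ?_⟩
      rw [Real.dist_eq, sub_zero, abs_of_nonneg (hel z x).1]
      by_cases hmem : x ∈ ({x | |K z.1 x| ≤ R} ∩ {x | |K z.2 x| ≤ R})
      · exact ((hel z x).2.trans (hp₀ _ hz.1 _ hz.2 hmem.1 hmem.2)).trans_lt (half_lt_self hη)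
      · simp only [e, indicator_of_notMem hmem]; exact hη
    rw [integral_zero, Metric.tendsto_atTop] at hlim
    obtain ⟨z₀, hz₀⟩ := hlim (ε / 2) (half_pos hε)
    refine ⟨max z₀.1 z₀.2, fun p hp q hq => ?_⟩
    have h1 := hz₀ (p, q) ⟨(le_max_left _ _).trans hp, (le_max_right _ _).trans hq⟩
    rw [Real.dist_eq, sub_zero] at h1
    have hei : Integrable (e (p, q)) μ := Integrable.of_bound (hem _) _ (heb _)
    have hKpq : Integrable (fun x => 2 * D / R ^ 2 * (K p x ^ 2 + K q x ^ 2)) μ :=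
      ((hKi p).add (hKi q)).const_mul _
    have h2 : ∫ x, ‖f p x - f q x‖ ∂μ ≤
        ∫ x, (e (p, q) x + 2 * D / R ^ 2 * (K p x ^ 2 + K q x ^ 2)) ∂μ := by
      refine integral_mono_ae ((hfi p).sub (hfi q)).norm (hei.add hKpq) ?_
      filter_upwards [hBD p q] with x hx
      have hR2 : 0 < R ^ 2 := by positivity
      by_cases hmem : x ∈ ({x | |K p x| ≤ R} ∩ {x | |K q x| ≤ R})
      · simp only [e, indicator_of_mem hmem]
        exact le_add_of_nonneg_right (by positivity)
      · simp only [e, indicator_of_notMem hmem, zero_add]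
        refine hx.trans ?_
        rw [div_mul_eq_mul_div, le_div_iff₀ hR2]
        refine mul_le_mul_of_nonneg_left ?_ (by positivity)
        simp only [mem_inter_iff, mem_ofPred_eq, not_and_or, not_le] at hmem
        rcases hmem with h | h
        · have := pow_le_pow_left₀ hR.le h.le 2
          rw [sq_abs] at this
          linarith [sq_nonneg (K q x)]
        · have := pow_le_pow_left₀ hR.le h.le 2
          rw [sq_abs] at this
          linarith [sq_nonneg (K p x)]
    rw [integral_add hei hKpq, integral_const_mul, integral_add (hKi p) (hKi q)] at h2
    have h3 : 2 * D / R ^ 2 * (∫ x, K p x ^ 2 ∂μ + ∫ x, K q x ^ 2 ∂μ) ≤ 4 * D * C / R ^ 2 := by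
      have := mul_le_mul_of_nonneg_left (add_le_add (hKC p) (hKC q))
        (by positivity : 0 ≤ 2 * D / R ^ 2)
      refine this.trans_eq ?_
      ring
    linarith [le_abs_self (∫ x, e (p, q) x ∂μ)]
  -- Completeness of `L¹` provides the limit, and convergence in measure an almost everywhere
  -- convergent subsequence.
  let fL : ℕ → α →₁[μ] E := fun p => (hfi p).toL1 (f p)
  have hcs : CauchySeq fL := by
    rw [Metric.cauchySeq_iff]
    intro ε hε
    obtain ⟨p₀, hp₀⟩ := hcauchy ε hε
    refine ⟨p₀, fun p hp q hq => ?_⟩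
    rw [dist_eq_norm, ← Integrable.toL1_sub, L1.norm_of_fun_eq_integral_norm]
    exact hp₀ p hp q hq
  obtain ⟨F, hF⟩ := cauchySeq_tendsto_of_complete hcs
  have hmeas := tendstoInMeasure_of_tendsto_Lp hF
  obtain ⟨σ, hσ, hae⟩ := hmeas.exists_seq_tendsto_ae
  refine ⟨F, Lp.stronglyMeasurable F, σ, hσ, ?_⟩
  have hall : ∀ᵐ x ∂μ, ∀ p, fL p x = f p x := ae_all_iff.2 fun p => (hfi p).coeFn_toL1
  filter_upwards [hae, hall] with x h1 h2
  simpa only [h2] using h1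

/-- Diagonal extraction. -/
lemma exists_subseq_tendsto {Y : Type*} [Countable Y] (F : ℕ → Y → ℝ) (B : Y → ℝ)
    (hB : ∀ p y, |F p y| ≤ B y) :
    ∃ σ : ℕ → ℕ, StrictMono σ ∧ ∀ y, ∃ l, Tendsto (fun p => F (σ p) y) atTop (𝓝 l) := by
  have hc : IsCompact (univ.pi fun y => Icc (-B y) (B y)) := isCompact_univ_pi fun y => isCompact_Icc
  obtain ⟨l, -, σ, hσ, hl⟩ := hc.tendsto_subseq (x := F) fun p y _ => abs_le.1 (hB p y)
  exact ⟨σ, hσ, fun y => ⟨l y, (tendsto_pi_nhds.1 hl) y⟩⟩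

/-- Bump function on the `k`-th of `m + 1` subintervals of a layer. -/
def bump (i : Fin 2) (m k : ℕ) : ContDiffBump (Problem.left i + (2 * k + 1) / (2 * (m + 1)) : ℝ) where
  rIn := 1 / (4 * (m + 1))
  rOut := 1 / (2 * (m + 1))
  rIn_pos := by positivity
  rIn_lt_rOut := by
    rw [div_lt_div_iff₀ (by positivity) (by positivity)]
    have : (0 : ℝ) ≤ m := Nat.cast_nonneg m
    nlinarith

lemma bump_support (i : Fin 2) (m k : ℕ) : Function.support (bump i m k) =
    Ioo (Problem.left i + k / (m + 1)) (Problem.left i + (k + 1) / (m + 1)) := by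
  rw [(bump i m k).support_eq, Real.ball_eq_Ioo]
  have hm : (0 : ℝ) < m + 1 := by positivity
  congr 1 <;> simp only [bump] <;> field_simp <;> ring

lemma bump_support_subset (i : Fin 2) {m k : ℕ} (hk : k ≤ m) :
    Function.support (bump i m k) ⊆ Problem.dom i := by
  have hm : (0 : ℝ) < m + 1 := by positivity
  have hk' : (k : ℝ) ≤ m := by exact_mod_cast hk
  rw [bump_support, Problem.dom_eq]
  refine Ioo_subset_Ioo (by simp; positivity) ?_
  have : (k + 1 : ℝ) / (m + 1) ≤ 1 := by rw [div_le_one hm]; linarith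
  linarith

lemma bump_deriv_bound (i : Fin 2) (m k : ℕ) : ∃ B, 0 ≤ B ∧ ∀ x, |deriv (bump i m k) x| ≤ B := by
  have h1 : ContDiff ℝ 1 (bump i m k) := (bump i m k).contDiff
  obtain ⟨B, hB⟩ := ((bump i m k).hasCompactSupport.deriv).exists_bound_of_continuous
    (h1.continuous_deriv le_rfl)
  exact ⟨B, (norm_nonneg _).trans (hB 0), hB⟩

end TwoPhase
-- Almost everywhere convergence of saturations and traces.
namespace TwoPhase
namespace Problem

variable {P : Problem}

lemma Admissible.exists_phi_modulus (hP : P.Admissible) {η : ℝ} (hη : 0 < η) :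
    ∃ r, 0 < r ∧ ∀ i, ∀ a ∈ Icc (0 : ℝ) 1, ∀ b ∈ Icc (0 : ℝ) 1,
      |P.phi i a - P.phi i b| ≤ r → |a - b| ≤ η := by
  choose r hr H using fun i => (hP.layers i).exists_phi_modulus hη
  refine ⟨min (r 0) (r 1), lt_min (hr 0) (hr 1), fun i a ha b hb h => H i a ha b hb (h.trans ?_)⟩
  fin_cases i
  exacts [min_le_left _ _, min_le_right _ _]

/-- Moment of the saturation against a function of the space variable. -/
def moment (P : Problem) (A : Approx) (χ : ℝ → ℝ) (t : ℝ) : ℝ :=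
  ∫ x in Ioo (-1 : ℝ) 1, P.poro x * A.u (x, t) * χ x

namespace IsApprox

variable {C ε : ℝ} {A : Approx} (hA : P.IsApprox C ε A)
include hA

lemma eps_nonneg {t : ℝ} (ht : t ∈ Ioo 0 P.T) : 0 ≤ ε := by
  have := hA.fl_mem t ht
  linarith [this.1.trans this.2]

lemma g_integrable {t : ℝ} (ht : t ∈ Ioo 0 P.T) {a b : ℝ} (ha : a ∈ Icc (-1 : ℝ) 1)
    (hb : b ∈ Icc (-1 : ℝ) 1) : IntervalIntegrable (fun y => A.g (y, t)) volume a b ∧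
      IntervalIntegrable (fun y => A.g (y, t) ^ 2) volume a b := by
  obtain ⟨B, hB⟩ := hA.g_bdd
  have hm : Measurable fun y => A.g (y, t) := hA.meas_g.comp measurable_prodMk_right
  have h0 : uIcc a b ⊆ uIcc (-1) 1 := by
    rw [uIcc_of_le (by norm_num : (-1 : ℝ) ≤ 1)]
    exact uIcc_subset_Icc ha hb
  constructor
  · refine IntervalIntegrable.mono_set ?_ h0
    rw [intervalIntegrable_iff_integrableOn_Ioo_of_le (by norm_num)]
    exact Measure.integrableOn_of_bounded (M := B) (by simp) hm.aestronglyMeasurable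
      ((ae_restrict_mem measurableSet_Ioo).mono fun x hx => hB x hx t ht)
  · refine IntervalIntegrable.mono_set ?_ h0
    rw [intervalIntegrable_iff_integrableOn_Ioo_of_le (by norm_num)]
    refine Measure.integrableOn_of_bounded (M := B ^ 2) (by simp) (hm.pow_const 2).aestronglyMeasurable
      ((ae_restrict_mem measurableSet_Ioo).mono fun x hx => ?_)
    rw [Real.norm_eq_abs, abs_pow]
    exact pow_le_pow_left₀ (abs_nonneg _) (hB x hx t ht) 2

/-- Young's inequality under the integral, with `δ` free: the length of the interval can be made
small after `δ K²`. -/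
lemma abs_integral_g_le {t : ℝ} (ht : t ∈ Ioo 0 P.T) {a b : ℝ} (ha : a ∈ Icc (-1 : ℝ) 1)
    (hb : b ∈ Icc (-1 : ℝ) 1) {δ : ℝ} (hδ : 0 < δ) :
    |∫ y in a..b, A.g (y, t)| ≤ |b - a| / δ + δ * A.K t ^ 2 := by
  wlog hab : a ≤ b generalizing a b
  · rw [intervalIntegral.integral_symm, abs_neg, abs_sub_comm]
    exact this hb ha (le_of_not_ge hab)
  have h2 := (hA.g_integrable ht ha hb).2
  have hi : IntervalIntegrable (fun y => 1 / δ + δ * A.g (y, t) ^ 2) volume a b :=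
    intervalIntegrable_const.add (h2.const_mul δ)
  rw [← Real.norm_eq_abs]
  refine (intervalIntegral.norm_integral_le_of_norm_le hab (ae_of_all _ fun y _ => ?_) hi).trans ?_
  · rw [Real.norm_eq_abs, ← sq_abs]
    have h0 : 0 < 1 / δ := by positivity
    have : 1 / δ * δ = 1 := by field_simp
    nlinarith [mul_nonneg h0.le (sq_nonneg (δ * |A.g (y, t)| - 1)), abs_nonneg (A.g (y, t))]
  · rw [intervalIntegral.integral_add intervalIntegrable_const (h2.const_mul δ),
      intervalIntegral.integral_const_mul, abs_of_nonneg (sub_nonneg.2 hab)]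
    have h3 : ∫ y in a..b, A.g (y, t) ^ 2 ≤ A.K t ^ 2 := by
      refine le_trans ?_ (hA.g_sq t ht)
      rw [integral_Ioo_eq _ (by norm_num)]
      exact intervalIntegral.integral_mono_interval ha.1 hab hb.2 (ae_of_all _ fun y => sq_nonneg _)
        (hA.g_integrable ht (by simp) (by simp)).2
    have := mul_le_mul_of_nonneg_left h3 hδ.le
    simp only [intervalIntegral.integral_const, smul_eq_mul]
    rw [mul_one_div]
    linarith

/-- Up to `ε K` at each point, `φ(u)` is a primitive of `g`. At times with bounded `K` this is
equicontinuity in space, although `u` itself is piecewise constant. -/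
lemma phi_osc_le {t : ℝ} (ht : t ∈ Ioo 0 P.T) {i : Fin 2} {x y : ℝ} (hx : x ∈ dom i) (hy : y ∈ dom i)
    {δ : ℝ} (hδ : 0 < δ) : |P.phi i (A.u (x, t)) - P.phi i (A.u (y, t))| ≤
      2 * (ε * A.K t) + (|x - y| / δ + δ * A.K t ^ 2) := by
  have hl := left_mem i
  have hl' : left i ∈ Icc (-1 : ℝ) 1 := ⟨hl.1, by linarith [hl.2]⟩
  have hx' := Ioo_subset_Icc_self (dom_subset i hx)
  have hy' := Ioo_subset_Icc_self (dom_subset i hy)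
  have h1 := hA.near i x hx t ht
  have h2 := hA.near i y hy t ht
  have h3 := hA.abs_integral_g_le ht hy' hx' hδ
  have h4 := intervalIntegral.integral_interval_sub_left (hA.g_integrable ht hl' hx').1
    (hA.g_integrable ht hl' hy').1
  rw [abs_le] at *
  constructor <;> linarith [h1.1, h1.2, h2.1, h2.2, h3.1, h3.2]

lemma phi_traceL_sub_le {t : ℝ} (ht : t ∈ Ioo 0 P.T) {i : Fin 2} {x : ℝ} (hx : x ∈ dom i)
    {δ : ℝ} (hδ : 0 < δ) : |P.phi i (A.tl i t) - P.phi i (A.u (x, t))| ≤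
      ε * A.K t + ((x - left i) / δ + δ * A.K t ^ 2) := by
  have hl := left_mem i
  have hl' : left i ∈ Icc (-1 : ℝ) 1 := ⟨hl.1, by linarith [hl.2]⟩
  have hx' := Ioo_subset_Icc_self (dom_subset i hx)
  have h1 := hA.near i x hx t ht
  have h3 := hA.abs_integral_g_le ht hl' hx' hδ
  rw [dom_eq] at hx
  rw [abs_of_pos (sub_pos.2 hx.1)] at h3
  rw [abs_le] at *
  constructor <;> linarith [h1.1, h1.2, h3.1, h3.2]

lemma phi_traceR_sub_le {t : ℝ} (ht : t ∈ Ioo 0 P.T) {i : Fin 2} {x : ℝ} (hx : x ∈ dom i)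
    {δ : ℝ} (hδ : 0 < δ) : |P.phi i (A.tr i t) - P.phi i (A.u (x, t))| ≤
      ε * A.K t + ((left i + 1 - x) / δ + δ * A.K t ^ 2) := by
  have hl := left_mem i
  have hl' : left i ∈ Icc (-1 : ℝ) 1 := ⟨hl.1, by linarith [hl.2]⟩
  have hr' : left i + 1 ∈ Icc (-1 : ℝ) 1 := ⟨by linarith [hl.1], by linarith [hl.2]⟩
  have hx' := Ioo_subset_Icc_self (dom_subset i hx)
  have h1 := hA.near i x hx t ht
  have h2 := hA.right i t ht
  have h3 := hA.abs_integral_g_le ht hx' hr' hδ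
  have h4 := intervalIntegral.integral_interval_sub_left (hA.g_integrable ht hl' hr').1
    (hA.g_integrable ht hl' hx').1
  rw [dom_eq] at hx
  rw [abs_of_pos (sub_pos.2 hx.2)] at h3
  rw [abs_le] at *
  constructor <;> linarith [h1.1, h1.2, h3.1, h3.2]

lemma moment_integrable (hP : P.Admissible) {χ : ℝ → ℝ} (hχ : Continuous χ) {B : ℝ}
    (hB : ∀ x, |χ x| ≤ B) {t : ℝ} (ht : t ∈ Ioo 0 P.T) :
    IntegrableOn (fun x => P.poro x * A.u (x, t) * χ x) (Ioo (-1) 1) := by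
  refine Measure.integrableOn_of_bounded (M := B) (by simp)
    ((P.measurable_poro.mul (hA.meas_u.comp measurable_prodMk_right)).mul
      hχ.measurable).aestronglyMeasurable ?_
  filter_upwards [ae_restrict_mem measurableSet_Ioo] with x hx
  have h1 := hP.poro_mem x
  have h2 := hA.u_mem x hx t ht
  rw [Real.norm_eq_abs, abs_mul, abs_mul, abs_of_pos h1.1, abs_of_nonneg h2.1]
  exact (mul_le_of_le_one_left (abs_nonneg _) (mul_le_one₀ h1.2.le h2.1 h2.2)).trans (hB x)

lemma abs_moment_le (hP : P.Admissible) {χ : ℝ → ℝ} {B : ℝ}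
    (hB : ∀ x, |χ x| ≤ B) {t : ℝ} (ht : t ∈ Ioo 0 P.T) : |P.moment A χ t| ≤ B * 2 := by
  have := norm_setIntegral_le_of_norm_le_const (μ := volume) (s := Ioo (-1 : ℝ) 1)
    (f := fun x => P.poro x * A.u (x, t) * χ x) (C := B) (by simp) fun x hx => by
      have h1 := hP.poro_mem x
      have h2 := hA.u_mem x hx t ht
      rw [Real.norm_eq_abs, abs_mul, abs_mul, abs_of_pos h1.1, abs_of_nonneg h2.1]
      exact (mul_le_of_le_one_left (abs_nonneg _) (mul_le_one₀ h1.2.le h2.1 h2.2)).trans (hB x)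
  rw [Real.volume_real_Ioo_of_le (by norm_num)] at this
  norm_num at this
  exact this

end IsApprox

lemma abs_bump_le (i : Fin 2) (m k : ℕ) (x : ℝ) : |bump i m k x| ≤ 1 := by
  rw [abs_of_nonneg (bump i m k).nonneg]
  exact (bump i m k).le_one

lemma Admissible.bump_integral_pos (hP : P.Admissible) (i : Fin 2) {m k : ℕ} (hk : k ≤ m) :
    0 < ∫ x in Ioo (-1 : ℝ) 1, P.poro x * bump i m k x := by
  have hint : IntegrableOn (fun x => P.poro x * bump i m k x) (Ioo (-1) 1) := by
    refine Measure.integrableOn_of_bounded (M := 1) (by simp)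
      (P.measurable_poro.mul (bump i m k).continuous.measurable).aestronglyMeasurable
      (ae_of_all _ fun x => ?_)
    have h1 := hP.poro_mem x
    rw [Real.norm_eq_abs, abs_mul, abs_of_pos h1.1]
    exact mul_le_one₀ h1.2.le (abs_nonneg _) (abs_bump_le i m k x)
  have hsupp : Function.support (fun x => P.poro x * bump i m k x) = Function.support (bump i m k) := by
    ext x
    simp [(hP.poro_mem x).1.ne']
  rw [integral_pos_iff_support_of_nonneg (fun x => mul_nonneg (hP.poro_mem x).1.le
    (bump i m k).nonneg) hint, hsupp, Measure.restrict_apply' measurableSet_Ioo,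
    inter_eq_left.2 ((bump_support_subset i hk).trans (dom_subset i)), bump_support, Real.volume_Ioo,
    ENNReal.ofReal_pos]
  have : (k : ℝ) / (m + 1) < (k + 1) / (m + 1) := by gcongr; linarith
  linarith

section Sequence

variable (hP : P.Admissible) {C : ℝ} {ε : ℕ → ℝ} {A : ℕ → Approx}
  (hA : ∀ p, P.IsApprox C (ε p) (A p)) (hε : Tendsto ε atTop (𝓝 0))
include hP hA hε

omit hP in
-- Convergence at rational times passes to all times by equicontinuity: a rational `r < t` close to
-- `t` is compared with `t` uniformly for large `p`.
lemma cauchySeq_moment {χ : ℝ → ℝ} (hχ : ContDiff ℝ 1 χ) (h1 : χ (-1) = 0) (h2 : χ 1 = 0) {B : ℝ}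
    (hB : 0 ≤ B) (hχB : ∀ x, |deriv χ x| ≤ B)
    (hr : ∀ r : ℚ, (r : ℝ) ∈ Ioo 0 P.T → ∃ l, Tendsto (fun p => P.moment (A p) χ r) atTop (𝓝 l))
    {t : ℝ} (ht : t ∈ Ioo 0 P.T) : CauchySeq fun p => P.moment (A p) χ t := by
  have hC0 : 0 ≤ C := (setIntegral_nonneg measurableSet_Ioo fun t _ => sq_nonneg _).trans (hA 0).K_sq
  rw [Metric.cauchySeq_iff]
  intro η hη
  -- Makes the part of the estimate that does not shrink with `t - r` at most `η/8`. The part with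
  -- factor `L` is then made small by the choice of `r` and `p`.
  set δ : ℝ := η / (8 * (B * C + 1)) with hδdef
  have hBC : 0 < B * C + 1 := by positivity
  have hδ : 0 < δ := by positivity
  have hδB : B * (δ * C) ≤ η / 8 := by
    rw [hδdef]
    have : B * (η / (8 * (B * C + 1)) * C) = η / 8 * (B * C / (B * C + 1)) := by field_simp
    rw [this]
    refine mul_le_of_le_one_right (by positivity) ((div_le_one hBC).2 (by linarith))
  set L := B * (2 * C + 2 / δ) with hL
  have hL0 : 0 ≤ L := by positivity
  obtain ⟨r, hr1, hr2⟩ := exists_rat_btwn (show max 0 (t - η / (16 * (L + 1))) < t from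
    max_lt ht.1 (by have : 0 < η / (16 * (L + 1)) := by positivity
                    linarith))
  have hr0 : (r : ℝ) ∈ Ioo 0 P.T := ⟨(le_max_left _ _).trans_lt hr1, hr2.trans ht.2⟩
  have hrt : t - r ≤ η / (16 * (L + 1)) := by linarith [(le_max_right 0 _).trans_lt hr1]
  obtain ⟨l, hl⟩ := hr r hr0
  obtain ⟨p₁, hp₁⟩ := Metric.cauchySeq_iff.1 hl.cauchySeq (η / 4) (by positivity)
  obtain ⟨p₂, hp₂⟩ := eventually_atTop.1 (hε.eventually (gt_mem_nhds
    (show 0 < η / (16 * (L + 1)) by positivity)))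
  have hLL : L * (η / (16 * (L + 1)) + η / (16 * (L + 1))) ≤ η / 8 := by
    have : L * (η / (16 * (L + 1)) + η / (16 * (L + 1))) = η / 8 * (L / (L + 1)) := by
      field_simp; ring
    rw [this]
    exact mul_le_of_le_one_right (by positivity) ((div_le_one (by positivity)).2 (by linarith))
  have key : ∀ p ≥ p₂, |P.moment (A p) χ t - P.moment (A p) χ r| ≤ η / 4 := by
    intro p hp
    have h := (hA p).equi χ hχ h1 h2 B hB (fun x _ => hχB x) δ hδ r hr0 t ht hr2.le
    refine h.trans ?_
    have h3 : L * (t - r + ε p) ≤ L * (η / (16 * (L + 1)) + η / (16 * (L + 1))) :=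
      mul_le_mul_of_nonneg_left (add_le_add hrt (hp₂ p hp).le) hL0
    rw [mul_add, ← mul_assoc, ← hL]
    linarith
  refine ⟨max p₁ p₂, fun p hp q hq => ?_⟩
  have k1 := key p ((le_max_right _ _).trans hp)
  have k2 := key q ((le_max_right _ _).trans hq)
  have k3 := hp₁ p ((le_max_left _ _).trans hp) q ((le_max_left _ _).trans hq)
  rw [Real.dist_eq, abs_lt] at *
  rw [abs_le] at k1 k2
  constructor <;> linarith [k1.1, k1.2, k2.1, k2.2, k3.1, k3.2]

lemma exists_subseq_moments : ∃ σ : ℕ → ℕ, StrictMono σ ∧ ∀ i m k, k ≤ m → ∀ t ∈ Ioo 0 P.T,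
    CauchySeq fun p => P.moment (A (σ p)) (bump i m k) t := by
  classical
  -- Layers, bumps and rational times form a countable family. The bound 2 is the length of the
  -- domain, as bumps, porosity and saturation are at most 1. Times outside `(0,T)` get the value 0.
  obtain ⟨σ, hσ, h⟩ := exists_subseq_tendsto (Y := Fin 2 × ℕ × ℕ × ℚ)
    (fun p y => if (y.2.2.2 : ℝ) ∈ Ioo 0 P.T then
      P.moment (A p) (bump y.1 y.2.1 y.2.2.1) y.2.2.2 else 0) (fun _ => 2) fun p y => by
      split_ifs with hy
      · simpa using (hA p).abs_moment_le hP (abs_bump_le _ _ _) hy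
      · simp
  refine ⟨σ, hσ, fun i m k hk t ht => ?_⟩
  obtain ⟨B, hB, hB'⟩ := bump_deriv_bound i m k
  have hz : ∀ x, x ∉ dom i → bump i m k x = 0 := fun x hx =>
    Function.notMem_support.1 fun h => hx (bump_support_subset i hk h)
  refine cauchySeq_moment (fun p => hA (σ p)) (hε.comp hσ.tendsto_atTop) (bump i m k).contDiff
    (hz _ fun h => lt_irrefl _ (dom_subset i h).1) (hz _ fun h => lt_irrefl _ (dom_subset i h).2)
    hB hB' (fun r hr => ?_) ht
  obtain ⟨l, hl⟩ := h (i, m, k, r)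
  simp only [hr, if_true] at hl
  exact ⟨l, hl⟩

/-- At a fixed time, the saturations with bounded energy form a uniform Cauchy family. -/
lemma cauchy_of_moments {t : ℝ} (ht : t ∈ Ioo 0 P.T)
    (hmom : ∀ i m k, k ≤ m → CauchySeq fun p => P.moment (A p) (bump i m k) t)
    {R η : ℝ} (hR : 0 < R) (hη : 0 < η) : ∃ p₀, ∀ p ≥ p₀, ∀ q ≥ p₀, (A p).K t ≤ R → (A q).K t ≤ R →
      ∀ i, ∀ x ∈ dom i, |(A p).u (x, t) - (A q).u (x, t)| ≤ η := by
  obtain ⟨r, hr, hmod⟩ := hP.exists_phi_modulus (show 0 < η / 4 by positivity)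
  -- The budget `r` for the oscillation of `φ(u)` on a subinterval is split as `δ K² ≤ r/4`, `|x -
  -- y|/δ ≤ r/4` through the choice of `m`, and twice `ε K ≤ r/4` for large `p`.
  set δ := r / (4 * R ^ 2) with hδdef
  have hδ : 0 < δ := by positivity
  have hδR : δ * R ^ 2 = r / 4 := by rw [hδdef]; field_simp
  obtain ⟨m, hm⟩ := exists_nat_one_div_lt (show 0 < r / 4 * δ by positivity)
  have hm0 : (0 : ℝ) < m + 1 := by positivity
  have hev1 : ∀ᶠ p in atTop, ε p < r / (4 * R) := hε.eventually (gt_mem_nhds (by positivity))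
  have hev2 : ∀ᶠ z : ℕ × ℕ in atTop, ∀ i : Fin 2, ∀ k ∈ Finset.range (m + 1),
      dist (P.moment (A z.1) (bump i m k) t) (P.moment (A z.2) (bump i m k) t) <
        η / 2 * ∫ x in Ioo (-1 : ℝ) 1, P.poro x * bump i m k x := by
    refine eventually_all.2 fun i => (Filter.eventually_all_finset _).2 fun k hk => ?_
    have hk' : k ≤ m := Nat.lt_succ_iff.1 (Finset.mem_range.1 hk)
    have h := cauchySeq_iff_tendsto_dist_atTop_0.1 (hmom i m k hk')
    exact h.eventually (gt_mem_nhds (mul_pos (by positivity) (hP.bump_integral_pos i hk')))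
  obtain ⟨p₁, hp₁⟩ := eventually_atTop.1 hev1
  obtain ⟨z, hz⟩ := eventually_atTop.1 hev2
  refine ⟨max p₁ (max z.1 z.2), fun p hp q hq hKp hKq i x hx => ?_⟩
  have hz' := hz (p, q) ⟨(le_max_left _ _).trans ((le_max_right _ _).trans hp),
    (le_max_right _ _).trans ((le_max_right _ _).trans hq)⟩ i
  have hx0 := hx
  rw [dom_eq] at hx0
  -- The subinterval containing `x`. Only finitely many bumps occur, so `p₀` does not depend on `x`.
  -- If `x` is the left endpoint it is not in the support, but is still within `1/(m+1)` of every
  -- point there.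
  set k := ⌊(x - left i) * (m + 1)⌋₊ with hk
  have hxl : 0 ≤ (x - left i) * (m + 1) := mul_nonneg (by linarith [hx0.1]) hm0.le
  have hk1 : (k : ℝ) ≤ (x - left i) * (m + 1) := Nat.floor_le hxl
  have hk2 : (x - left i) * (m + 1) < k + 1 := Nat.lt_floor_add_one _
  have hkm : k ≤ m := by
    have : (k : ℝ) < m + 1 := hk1.trans_lt (by nlinarith [hx0.2])
    have : k < m + 1 := by exact_mod_cast this
    omega
  specialize hz' k (Finset.mem_range.2 (Nat.lt_succ_of_le hkm))
  set W := ∫ x in Ioo (-1 : ℝ) 1, P.poro x * bump i m k x with hW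
  have hW0 : 0 < W := hP.bump_integral_pos i hkm
  have hWi : IntegrableOn (fun x => P.poro x * bump i m k x) (Ioo (-1) 1) := by
    by_contra hcon
    rw [hW, integral_undef hcon] at hW0
    exact lt_irrefl _ hW0
  -- Since `u` varies by at most `η/4` on the support, its moment is nearly `u(x,t) W`. Two such
  -- errors and a gap of `η/2 W` between the moments add up to `η W`.
  have hmean : ∀ p ≥ p₁, (A p).K t ≤ R →
      |P.moment (A p) (bump i m k) t - (A p).u (x, t) * W| ≤ η / 4 * W := by
    intro p hp hKp
    have hK0 := (hA p).K_nonneg t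
    have hosc : ∀ y ∈ Function.support (bump i m k),
        |(A p).u (y, t) - (A p).u (x, t)| ≤ η / 4 := by
      intro y hy
      have hyd := bump_support_subset i hkm hy
      rw [bump_support] at hy
      refine hmod i _ ((hA p).u_mem y (dom_subset i hyd) t ht) _
        ((hA p).u_mem x (dom_subset i hx) t ht) (((hA p).phi_osc_le ht hyd hx hδ).trans ?_)
      have hxy : |y - x| ≤ 1 / (m + 1) := by
        have e1 : (k : ℝ) / (m + 1) ≤ x - left i := (div_le_iff₀ hm0).2 hk1
        have e2 : x - left i < (k + 1) / (m + 1) := (lt_div_iff₀ hm0).2 hk2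
        have e3 : ((k : ℝ) + 1) / (m + 1) = k / (m + 1) + 1 / (m + 1) := by ring
        rw [abs_le]
        constructor <;> linarith [hy.1, hy.2]
      have a1 : |y - x| / δ ≤ r / 4 := by
        rw [div_le_iff₀ hδ]
        exact hxy.trans hm.le
      have a2 : δ * (A p).K t ^ 2 ≤ r / 4 := by
        rw [← hδR]
        exact mul_le_mul_of_nonneg_left (pow_le_pow_left₀ hK0 hKp 2) hδ.le
      have a3 : ε p * (A p).K t ≤ r / 4 := by
        have e0 := (hA p).eps_nonneg ht
        refine (mul_le_mul_of_nonneg_left hKp e0).trans ?_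
        have := (lt_div_iff₀ (by positivity)).1 (hp₁ p hp)
        linarith
      linarith
    have hmi := (hA p).moment_integrable hP (bump i m k).continuous (abs_bump_le i m k) ht
    have hdiff : P.moment (A p) (bump i m k) t - (A p).u (x, t) * W = ∫ y in Ioo (-1 : ℝ) 1,
        (P.poro y * (A p).u (y, t) * bump i m k y - (A p).u (x, t) * (P.poro y * bump i m k y)) := by
      rw [integral_sub hmi (hWi.const_mul _), integral_const_mul]
      rfl
    rw [hdiff, hW, ← integral_const_mul, ← Real.norm_eq_abs]
    refine norm_integral_le_of_norm_le (hWi.const_mul _) (ae_of_all _ fun y => ?_)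
    have h0 := hP.poro_mem y
    have hb := (bump i m k).nonneg (x := y)
    have : P.poro y * (A p).u (y, t) * bump i m k y - (A p).u (x, t) * (P.poro y * bump i m k y) =
        ((A p).u (y, t) - (A p).u (x, t)) * (P.poro y * bump i m k y) := by ring
    rw [this, Real.norm_eq_abs, abs_mul, abs_of_nonneg (mul_nonneg h0.1.le hb)]
    by_cases hy : y ∈ Function.support (bump i m k)
    · exact mul_le_mul_of_nonneg_right (hosc y hy) (mul_nonneg h0.1.le hb)
    · rw [Function.notMem_support.1 hy]; simp
  have k1 := hmean p ((le_max_left _ _).trans hp) hKp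
  have k2 := hmean q ((le_max_left _ _).trans hq) hKq
  rw [Real.dist_eq] at hz'
  have hfin : |((A p).u (x, t) - (A q).u (x, t)) * W| ≤ η * W := by
    rw [abs_lt] at hz'
    rw [abs_le] at *
    constructor <;> linarith [k1.1, k1.2, k2.1, k2.2, hz'.1, hz'.2]
  rw [abs_mul, abs_of_pos hW0] at hfin
  exact le_of_mul_le_mul_right hfin hW0

/-- A trace is close to the saturation at a point `h` inside the layer, where the uniform Cauchy
property is already known. -/
lemma cauchy_traces_of_moments {t : ℝ} (ht : t ∈ Ioo 0 P.T)
    (hmom : ∀ i m k, k ≤ m → CauchySeq fun p => P.moment (A p) (bump i m k) t)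
    {R η : ℝ} (hR : 0 < R) (hη : 0 < η) : ∃ p₀, ∀ p ≥ p₀, ∀ q ≥ p₀, (A p).K t ≤ R → (A q).K t ≤ R →
      ∀ i, |(A p).tl i t - (A q).tl i t| ≤ η ∧ |(A p).tr i t - (A q).tr i t| ≤ η := by
  obtain ⟨p₁, hp₁⟩ := cauchy_of_moments hP hA hε ht hmom hR (show 0 < η / 3 by positivity)
  obtain ⟨r, hr, hmod⟩ := hP.exists_phi_modulus (show 0 < η / 3 by positivity)
  set δ := r / (4 * R ^ 2) with hδdef
  have hδ : 0 < δ := by positivity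
  have hδR : δ * R ^ 2 = r / 4 := by rw [hδdef]; field_simp
  -- The bound `1/2` keeps the point in the layer, and the other makes `h/δ ≤ r/4`.
  set h := min (1 / 2) (r / 4 * δ) with hh
  have hh0 : 0 < h := lt_min (by norm_num) (by positivity)
  have hh1 : h ≤ 1 / 2 := min_le_left _ _
  have hhδ : h / δ ≤ r / 4 := by rw [div_le_iff₀ hδ]; exact min_le_right _ _
  have hev1 : ∀ᶠ p in atTop, ε p < r / (4 * R) := hε.eventually (gt_mem_nhds (by positivity))
  obtain ⟨p₂, hp₂⟩ := eventually_atTop.1 hev1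
  have hbd : ∀ p ≥ p₂, (A p).K t ≤ R → ε p * (A p).K t + (h / δ + δ * (A p).K t ^ 2) ≤ r := by
    intro p hp hKp
    have hK0 := (hA p).K_nonneg t
    have a2 : δ * (A p).K t ^ 2 ≤ r / 4 := by
      rw [← hδR]
      exact mul_le_mul_of_nonneg_left (pow_le_pow_left₀ hK0 hKp 2) hδ.le
    have a3 : ε p * (A p).K t ≤ r / 4 := by
      have e0 := (hA p).eps_nonneg ht
      refine (mul_le_mul_of_nonneg_left hKp e0).trans ?_
      have := (lt_div_iff₀ (by positivity)).1 (hp₂ p hp)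
      linarith
    linarith
  refine ⟨max p₁ p₂, fun p hp q hq hKp hKq i => ?_⟩
  have hp' := (le_max_right _ _).trans hp
  have hq' := (le_max_right _ _).trans hq
  have hx : left i + h ∈ dom i := by rw [dom_eq]; constructor <;> linarith
  have hy : left i + 1 - h ∈ dom i := by rw [dom_eq]; constructor <;> linarith
  have c1 := hp₁ p ((le_max_left _ _).trans hp) q ((le_max_left _ _).trans hq) hKp hKq i _ hx
  have c2 := hp₁ p ((le_max_left _ _).trans hp) q ((le_max_left _ _).trans hq) hKp hKq i _ hy
  have hL : ∀ p ≥ p₂, (A p).K t ≤ R → |(A p).tl i t - (A p).u (left i + h, t)| ≤ η / 3 := by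
    intro p hp hKp
    refine hmod i _ ((hA p).tl_mem i t ht) _ ((hA p).u_mem _ (dom_subset i hx) t ht) ?_
    refine ((hA p).phi_traceL_sub_le ht hx hδ).trans ?_
    rw [add_sub_cancel_left]
    exact hbd p hp hKp
  have hRR : ∀ p ≥ p₂, (A p).K t ≤ R → |(A p).tr i t - (A p).u (left i + 1 - h, t)| ≤ η / 3 := by
    intro p hp hKp
    refine hmod i _ ((hA p).tr_mem i t ht) _ ((hA p).u_mem _ (dom_subset i hy) t ht) ?_
    refine ((hA p).phi_traceR_sub_le ht hy hδ).trans ?_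
    rw [sub_sub_cancel]
    exact hbd p hp hKp
  have l1 := hL p hp' hKp
  have l2 := hL q hq' hKq
  have r1 := hRR p hp' hKp
  have r2 := hRR q hq' hKq
  simp only [abs_le] at *
  refine ⟨⟨?_, ?_⟩, ?_, ?_⟩ <;> linarith [c1.1, c1.2, c2.1, c2.2, l1.1, l1.2, l2.1, l2.2, r1.1, r1.2,
    r2.1, r2.2]

/-- Compactness: along a subsequence the saturations and their traces converge almost everywhere. -/
theorem exists_ae_limit : ∃ σ : ℕ → ℕ, StrictMono σ ∧ ∃ (u : ℝ × ℝ → ℝ) (tl tr : Fin 2 → ℝ → ℝ),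
    Measurable u ∧ (∀ z, u z ∈ Icc (0 : ℝ) 1) ∧
    (∀ i, Measurable (tl i) ∧ Measurable (tr i) ∧
      ∀ t, tl i t ∈ Icc (0 : ℝ) 1 ∧ tr i t ∈ Icc (0 : ℝ) 1) ∧
    (∀ᵐ z ∂volume.restrict (Ioo (-1 : ℝ) 1 ×ˢ Ioo 0 P.T),
      Tendsto (fun p => (A (σ p)).u z) atTop (𝓝 (u z))) ∧
    ∀ᵐ t ∂volume.restrict (Ioo 0 P.T), ∀ i,
      Tendsto (fun p => (A (σ p)).tl i t) atTop (𝓝 (tl i t)) ∧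
      Tendsto (fun p => (A (σ p)).tr i t) atTop (𝓝 (tr i t)) := by
  obtain ⟨σ₀, hσ₀, hmom⟩ := exists_subseq_moments hP hA hε
  have hA₀ := fun p => hA (σ₀ p)
  have hε₀ := hε.comp hσ₀.tendsto_atTop
  have hQ : MeasurableSet (Ioo (-1 : ℝ) 1 ×ˢ Ioo 0 P.T) := measurableSet_Ioo.prod measurableSet_Ioo
  have hKQ : ∀ p, Integrable (fun z : ℝ × ℝ => (A (σ₀ p)).K z.2 ^ 2)
      (volume.restrict (Ioo (-1 : ℝ) 1 ×ˢ Ioo 0 P.T)) ∧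
      ∫ z in Ioo (-1 : ℝ) 1 ×ˢ Ioo 0 P.T, (A (σ₀ p)).K z.2 ^ 2 ≤ 2 * C := by
    intro p
    rw [Measure.volume_eq_prod, ← Measure.prod_restrict]
    refine ⟨(hA₀ p).K_int.comp_snd _, ?_⟩
    rw [integral_fun_snd (μ := volume.restrict (Ioo (-1 : ℝ) 1)) (fun t => (A (σ₀ p)).K t ^ 2)]
    have := (hA₀ p).K_sq
    have h2 : ((volume.restrict (Ioo (-1 : ℝ) 1)).real univ) = 2 := by
      rw [Measure.real, Measure.restrict_apply_univ, Real.volume_Ioo]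
      norm_num
    rw [h2, smul_eq_mul]
    linarith
  obtain ⟨F, hF, σ₁, hσ₁, hlim₁⟩ := exists_subseq_ae_tendsto
    (μ := volume.restrict (Ioo (-1 : ℝ) 1 ×ˢ Ioo 0 P.T))
    (fun p => (A (σ₀ p)).u) (fun p => (hA₀ p).meas_u.aestronglyMeasurable) (B := 1) (C := 2 * C)
    (fun p => (ae_restrict_mem hQ).mono fun z hz => by
      have := (hA₀ p).u_mem z.1 hz.1 z.2 hz.2
      exact abs_le.2 ⟨by linarith [this.1], this.2⟩)
    (fun p z => (A (σ₀ p)).K z.2) (fun p => (hA₀ p).meas_K.comp measurable_snd)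
    (fun p => (hKQ p).1) (fun p => (hKQ p).2) (by
      have hne : ∀ᵐ z : ℝ × ℝ ∂volume.restrict (Ioo (-1 : ℝ) 1 ×ˢ Ioo 0 P.T), z.1 ≠ 0 := by
        refine ae_restrict_of_ae ?_
        rw [Measure.volume_eq_prod]
        exact (Measure.quasiMeasurePreserving_fst (μ := volume) (ν := volume)).ae
          (p := fun x : ℝ => x ≠ 0) (by simp [ae_iff])
      filter_upwards [ae_restrict_mem hQ, hne] with z hz hz0 R hR η hη
      obtain ⟨p₀, hp₀⟩ := cauchy_of_moments hP hA₀ hε₀ hz.2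
        (fun i m k hk => hmom i m k hk z.2 hz.2) hR hη
      refine ⟨p₀, fun p hp q hq h1 h2 => ?_⟩
      have hd : ∃ i, z.1 ∈ dom i := by
        rcases lt_or_gt_of_ne hz0 with h | h
        · exact ⟨0, by simp [dom, h, hz.1.1]⟩
        · exact ⟨1, by simp [dom, h, hz.1.2]⟩
      obtain ⟨i, hi⟩ := hd
      exact hp₀ p hp q hq ((le_abs_self _).trans h1) ((le_abs_self _).trans h2) i z.1 hi)
  have hA₁ := fun p => hA₀ (σ₁ p)
  have hε₁ := hε₀.comp hσ₁.tendsto_atTop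
  have hmom₁ : ∀ i m k, k ≤ m → ∀ t ∈ Ioo 0 P.T,
      CauchySeq fun p => P.moment (A (σ₀ (σ₁ p))) (bump i m k) t := fun i m k hk t ht =>
    (hmom i m k hk t ht).comp_tendsto hσ₁.tendsto_atTop
  -- All four traces are extracted at once, as a single function of time with values in a product
  -- space.
  obtain ⟨G, hG, σ₂, hσ₂, hlim₂⟩ := exists_subseq_ae_tendsto
    (μ := volume.restrict (Ioo 0 P.T)) (E := (Fin 2 → ℝ) × (Fin 2 → ℝ))
    (fun p t => (fun i => (A (σ₀ (σ₁ p))).tl i t, fun i => (A (σ₀ (σ₁ p))).tr i t))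
    (fun p => ((measurable_pi_lambda _ fun i => (hA₁ p).meas_tl i).prodMk
      (measurable_pi_lambda _ fun i => (hA₁ p).meas_tr i)).aestronglyMeasurable) (B := 1) (C := C)
    (fun p => (ae_restrict_mem measurableSet_Ioo).mono fun t ht => by
      rw [Prod.norm_def]
      refine max_le ?_ ?_ <;> refine (pi_norm_le_iff_of_nonneg zero_le_one).2 fun i => ?_
      · have := (hA₁ p).tl_mem i t ht
        exact abs_le.2 ⟨by linarith [this.1], this.2⟩
      · have := (hA₁ p).tr_mem i t ht
        exact abs_le.2 ⟨by linarith [this.1], this.2⟩)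
    (fun p => (A (σ₀ (σ₁ p))).K) (fun p => (hA₁ p).meas_K)
    (fun p => (hA₁ p).K_int) (fun p => (hA₁ p).K_sq) (by
      filter_upwards [ae_restrict_mem measurableSet_Ioo] with t ht R hR η hη
      obtain ⟨p₀, hp₀⟩ := cauchy_traces_of_moments hP hA₁ hε₁ ht
        (fun i m k hk => hmom₁ i m k hk t ht) hR hη
      refine ⟨p₀, fun p hp q hq h1 h2 => ?_⟩
      have h := hp₀ p hp q hq ((le_abs_self _).trans h1) ((le_abs_self _).trans h2)
      rw [Prod.norm_def]
      refine max_le ?_ ?_ <;> refine (pi_norm_le_iff_of_nonneg hη.le).2 fun i => ?_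
      · exact (h i).1
      · exact (h i).2)
  -- Truncating the limits does not change them where convergence holds, and makes them
  -- `[0,1]`-valued everywhere, not only almost everywhere.
  have hcl : ∀ {f : ℕ → ℝ} {l : ℝ}, (∀ p, f p ∈ Icc (0 : ℝ) 1) → Tendsto f atTop (𝓝 l) →
      Tendsto f atTop (𝓝 (clamp l)) := by
    intro f l hf hl
    have := (continuous_clamp.tendsto l).comp hl
    exact this.congr fun p => clamp_of_mem (hf p)
  refine ⟨σ₀ ∘ σ₁ ∘ σ₂, hσ₀.comp (hσ₁.comp hσ₂), fun z => clamp (F z), fun i t => clamp ((G t).1 i),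
    fun i t => clamp ((G t).2 i), continuous_clamp.measurable.comp hF.measurable, fun z => clamp_mem _,
    fun i => ⟨?_, ?_, fun t => ⟨clamp_mem _, clamp_mem _⟩⟩, ?_, ?_⟩
  · exact continuous_clamp.measurable.comp ((measurable_pi_apply i).comp hG.measurable.fst)
  · exact continuous_clamp.measurable.comp ((measurable_pi_apply i).comp hG.measurable.snd)
  · filter_upwards [hlim₁, ae_restrict_mem hQ] with z hz hzQ
    exact hcl (fun p => (hA _).u_mem z.1 hzQ.1 z.2 hzQ.2) (hz.comp hσ₂.tendsto_atTop)
  · filter_upwards [hlim₂, ae_restrict_mem measurableSet_Ioo] with t ht htT i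
    exact ⟨hcl (fun p => (hA _).tl_mem i t htT) (((continuous_apply i).tendsto _).comp
        ((continuous_fst.tendsto _).comp ht)),
      hcl (fun p => (hA _).tr_mem i t htT) (((continuous_apply i).tendsto _).comp
        ((continuous_snd.tendsto _).comp ht))⟩

end Sequence
end Problem
end TwoPhase
-- Weak limits, Lebesgue differentiation, weak derivatives and one-sided limits.
namespace TwoPhase

/-- Weak sequential compactness of bounded sets of square integrable functions. -/
theorem exists_subseq_weak_limit {α : Type*} [MeasurableSpace α] {μ : Measure α}
    [IsSeparable μ] (g : ℕ → α → ℝ) (hg : ∀ p, MemLp (g p) 2 μ) {C : ℝ}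
    (hC : ∀ p, ∫ x, g p x ^ 2 ∂μ ≤ C) :
    ∃ σ : ℕ → ℕ, StrictMono σ ∧ ∃ G : α → ℝ, StronglyMeasurable G ∧ MemLp G 2 μ ∧
      ∀ χ, MemLp χ 2 μ → Tendsto (fun p => ∫ x, g (σ p) x * χ x ∂μ) atTop
        (𝓝 (∫ x, G x * χ x ∂μ)) := by
  have : Fact ((2 : ℝ≥0∞) ≠ ⊤) := ⟨by simp⟩
  have hinner : ∀ a b : Lp ℝ 2 μ, inner ℝ a b = ∫ x, a x * b x ∂μ := fun a b => by
    rw [L2.inner_def]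
    exact integral_congr_ae (ae_of_all _ fun x => by simp [mul_comm])
  have hnorm : ∀ p, ‖(hg p).toLp (g p)‖ ≤ √C := fun p => by
    refine Real.le_sqrt_of_sq_le ?_
    rw [← real_inner_self_eq_norm_sq, hinner]
    refine le_of_eq_of_le (integral_congr_ae ?_) (hC p)
    filter_upwards [(hg p).coeFn_toLp] with x hx
    rw [hx, sq]
  -- Riesz representation moves the sequence to the dual, where closed balls are sequentially
  -- weak-star compact because `L²` is separable.
  let Λ : ℕ → WeakDual ℝ (Lp ℝ 2 μ) := fun p =>
    StrongDual.toWeakDual (InnerProductSpace.toDual ℝ (Lp ℝ 2 μ) ((hg p).toLp (g p)))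
  have hΛ : ∀ p, Λ p ∈ WeakDual.toStrongDual ⁻¹'
      Metric.closedBall (0 : StrongDual ℝ (Lp ℝ 2 μ)) (√C) := fun p => by
    simpa [Λ] using hnorm p
  obtain ⟨L, -, σ, hσ, hL⟩ := WeakDual.isSeqCompact_closedBall ℝ _ 0 (√C) hΛ
  obtain ⟨G, hG⟩ := (InnerProductSpace.toDual ℝ (Lp ℝ 2 μ)).surjective (WeakDual.toStrongDual L)
  refine ⟨σ, hσ, G, Lp.stronglyMeasurable G, Lp.memLp G, fun χ hχ => ?_⟩
  have h1 := ((WeakDual.eval_continuous (𝕜 := ℝ) (hχ.toLp χ)).tendsto L).comp hL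
  have h2 : L (hχ.toLp χ) = ∫ x, G x * χ x ∂μ := by
    have : L (hχ.toLp χ) = inner ℝ G (hχ.toLp χ) := by
      rw [← InnerProductSpace.toDual_apply_apply, hG]; rfl
    rw [this, hinner]
    refine integral_congr_ae ?_
    filter_upwards [hχ.coeFn_toLp] with x hx
    rw [hx]
  rw [h2] at h1
  refine h1.congr fun p => ?_
  have : Λ (σ p) (hχ.toLp χ) = inner ℝ ((hg (σ p)).toLp (g (σ p))) (hχ.toLp χ) := rfl
  change Λ (σ p) (hχ.toLp χ) = _
  rw [this, hinner]
  refine integral_congr_ae ?_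
  filter_upwards [hχ.coeFn_toLp, (hg (σ p)).coeFn_toLp] with x hx hx'
  rw [hx, hx']

/-- Lebesgue differentiation along intervals that contain the point. -/
lemma ae_tendsto_interval_mean {f : ℝ → ℝ} {s : Set ℝ} (hs : IsOpen s) (hf : IntegrableOn f s) :
    ∀ᵐ x ∂volume.restrict s, ∀ a b : ℕ → ℝ, (∀ p, a p < b p) → (∀ p, x ∈ Icc (a p) (b p)) →
      (∀ p, Ioo (a p) (b p) ⊆ s) → Tendsto (fun p => b p - a p) atTop (𝓝 0) →
      Tendsto (fun p => 1 / (b p - a p) * ∫ y in (a p)..(b p), f y) atTop (𝓝 (f x)) := by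
  rw [ae_restrict_iff' hs.measurableSet]
  have hloc : LocallyIntegrable (s.indicator f) volume :=
    ((integrable_indicator_iff hs.measurableSet).2 hf).locallyIntegrable
  -- The intervals contain `x` but are not centred at it. The differentiation theorem is applied to
  -- balls around their midpoints, which still contain `x`.
  filter_upwards [IsUnifLocDoublingMeasure.ae_tendsto_average volume hloc 1] with x hx hxs a b hab
    hmem hsub hlim
  have h := hx (l := atTop) (fun p => (a p + b p) / 2) (fun p => (b p - a p) / 2)
    (tendsto_nhdsWithin_iff.2 ⟨by simpa using hlim.div_const 2, Eventually.of_forall fun p =>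
      half_pos (sub_pos.2 (hab p))⟩) (Eventually.of_forall fun p => by
      have := hmem p
      rw [one_mul, Metric.mem_closedBall, Real.dist_eq, abs_le]
      constructor <;> linarith [this.1, this.2])
  rw [indicator_of_mem hxs] at h
  refine h.congr fun p => ?_
  have hb : Metric.closedBall ((a p + b p) / 2) ((b p - a p) / 2) = Icc (a p) (b p) := by
    rw [Real.closedBall_eq_Icc]
    congr 1 <;> ring
  rw [hb, setAverage_eq, intervalIntegral.integral_of_le (hab p).le,
    integral_Icc_eq_integral_Ioc, measureReal_def, Real.volume_Icc,
    ENNReal.toReal_ofReal (sub_pos.2 (hab p)).le, smul_eq_mul, one_div,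
    integral_Ioc_eq_integral_Ioo, integral_Ioc_eq_integral_Ioo]
  congr 1
  exact setIntegral_congr_fun measurableSet_Ioo fun y hy => indicator_of_mem (hsub p hy) _

/-- A sequence that is small in the mean of order two has a subsequence that tends to zero almost
everywhere. -/
lemma exists_subseq_ae_tendsto_zero {α : Type*} [MeasurableSpace α] {μ : Measure α}
    (K : ℕ → α → ℝ) (hK : ∀ p, Measurable (K p)) (hKi : ∀ p, Integrable (fun x => K p x ^ 2) μ)
    {C : ℝ} (hC : ∀ p, ∫ x, K p x ^ 2 ∂μ ≤ C) {ε : ℕ → ℝ} (hε : Tendsto ε atTop (𝓝 0)) :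
    ∃ σ : ℕ → ℕ, StrictMono σ ∧
      ∀ᵐ x ∂μ, Tendsto (fun p => ε (σ p) * K (σ p) x) atTop (𝓝 0) := by
  have hlim : Tendsto (fun p => eLpNorm ((fun x => (ε p * K p x) ^ 2) - fun _ => (0 : ℝ)) 1 μ) atTop
      (𝓝 0) := by
    have h1 : ∀ p, eLpNorm ((fun x => (ε p * K p x) ^ 2) - fun _ => (0 : ℝ)) 1 μ =
        ENNReal.ofReal (∫ x, (ε p * K p x) ^ 2 ∂μ) := fun p => by
      have e : ((fun x => (ε p * K p x) ^ 2) - fun _ => (0 : ℝ)) = fun x => (ε p * K p x) ^ 2 := by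
        ext x; simp
      have hi : Integrable (fun x => (ε p * K p x) ^ 2) μ := by
        simp only [mul_pow]; exact (hKi p).const_mul _
      rw [e, eLpNorm_one_eq_lintegral_enorm, ofReal_integral_eq_lintegral_ofReal hi
        (ae_of_all _ fun x => sq_nonneg _)]
      exact lintegral_congr fun x => Real.enorm_of_nonneg (sq_nonneg _)
    simp only [h1]
    rw [← ENNReal.ofReal_zero]
    refine ENNReal.tendsto_ofReal (squeeze_zero (g := fun p => ε p ^ 2 * C)
      (fun p => integral_nonneg fun x => sq_nonneg _) (fun p => ?_) ?_)
    · simp only [mul_pow, integral_const_mul]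
      exact mul_le_mul_of_nonneg_left (hC p) (sq_nonneg _)
    · simpa using (hε.pow 2).mul_const C
  obtain ⟨σ, hσ, h⟩ := (tendstoInMeasure_of_tendsto_eLpNorm one_ne_zero
    (fun p => (((hK p).const_mul (ε p)).pow_const 2).aestronglyMeasurable)
    aestronglyMeasurable_const hlim).exists_seq_tendsto_ae
  refine ⟨σ, hσ, h.mono fun x hx => ?_⟩
  have := hx.sqrt
  simp only [Real.sqrt_sq_eq_abs, Real.sqrt_zero] at this
  exact (tendsto_zero_iff_abs_tendsto_zero _).2 this

/-- A function that agrees almost everywhere with a primitive has a weak derivative. -/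
lemma isWeakDeriv_of_ae_eq {a b c : ℝ} (hab : a ≤ b) {w g : ℝ → ℝ}
    (hg : IntervalIntegrable g volume a b)
    (hw : ∀ᵐ x ∂volume.restrict (Ioo a b), w x = c + ∫ y in a..x, g y) :
    Problem.IsWeakDeriv (Ioo a b) w g := by
  have hgi : IntegrableOn g (Ioo a b) :=
    ((intervalIntegrable_iff_integrableOn_Ioc_of_le hab).1 hg).mono_set Ioo_subset_Ioc_self
  have hac : AbsolutelyContinuousOnInterval (fun x => c + ∫ y in a..x, g y) a b := by
    have h1 := hg.absolutelyContinuousOnInterval_intervalIntegral (c := a) left_mem_uIcc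
    have h2 : AbsolutelyContinuousOnInterval (fun _ : ℝ => c) a b :=
      ((LipschitzWith.const c).lipschitzOnWith (s := uIcc a b)).absolutelyContinuousOnInterval
    exact h2.add h1
  have hcont : ContinuousOn (fun x => c + ∫ y in a..x, g y) (Icc a b) := by
    have := hac.continuousOn
    rwa [uIcc_of_le hab] at this
  have hwi : IntegrableOn w (Ioo a b) :=
    ((hcont.integrableOn_Icc).mono_set Ioo_subset_Icc_self).congr (hw.mono fun x hx => hx.symm)
  refine ⟨hwi.locallyIntegrableOn, hgi.locallyIntegrableOn, fun ζ hζ hc hsupp => ?_⟩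
  have hza : ζ a = 0 := image_eq_zero_of_notMem_tsupport fun h => lt_irrefl _ (hsupp h).1
  have hzb : ζ b = 0 := image_eq_zero_of_notMem_tsupport fun h => lt_irrefl _ (hsupp h).2
  have hζac : AbsolutelyContinuousOnInterval ζ a b := by
    obtain ⟨K, hK⟩ := (hζ.of_le (by simp) : ContDiff ℝ 1 ζ).lipschitzWith_of_hasCompactSupport hc
      (by simp)
    exact (hK.lipschitzOnWith).absolutelyContinuousOnInterval
  -- Integration by parts for absolutely continuous functions. The boundary terms vanish because the
  -- support of `ζ` lies in the open interval.
  have hparts := hac.integral_mul_deriv_eq_deriv_mul hζac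
  simp only [hza, hzb, mul_zero, sub_zero, zero_sub] at hparts
  have h1 : ∫ x in Ioo a b, w x * deriv ζ x =
      ∫ x in a..b, (c + ∫ y in a..x, g y) * deriv ζ x := by
    rw [intervalIntegral.integral_of_le hab, integral_Ioc_eq_integral_Ioo]
    exact integral_congr_ae (hw.mono fun x hx => by simp only [hx])
  have h2 : ∫ x in a..b, deriv (fun x => c + ∫ y in a..x, g y) x * ζ x =
      ∫ x in Ioo a b, g x * ζ x := by
    rw [← integral_Ioc_eq_integral_Ioo, ← intervalIntegral.integral_of_le hab]
    refine intervalIntegral.integral_congr_ae ?_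
    filter_upwards [hg.ae_hasDerivAt_integral] with x hx hxm
    have hd := hx (uIoc_subset_uIcc hxm) a left_mem_uIcc
    rw [(hd.const_add c).deriv]
  rw [h1, hparts, h2]

/-- One-sided limits of a function that agrees almost everywhere with a continuous one. -/
lemma tendsto_of_ae_eq {a b α : ℝ} (hα : α ∈ Icc a b) {v Φ : ℝ → ℝ}
    (hΦ : ContinuousOn Φ (Icc a b))
    (hv : ∀ᵐ x ∂volume.restrict (Ioo a b), v x = Φ x) :
    Tendsto v (𝓝[Ioo a b] α ⊓ ae volume) (𝓝 (Φ α)) := by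
  have h1 : Tendsto Φ (𝓝[Ioo a b] α ⊓ ae volume) (𝓝 (Φ α)) :=
    ((hΦ α hα).mono_left (nhdsWithin_mono α Ioo_subset_Icc_self)).mono_left inf_le_left
  refine h1.congr' ?_
  rw [ae_restrict_iff' measurableSet_Ioo] at hv
  have h2 : ∀ᶠ x in 𝓝[Ioo a b] α ⊓ ae volume, x ∈ Ioo a b :=
    eventually_mem_nhdsWithin.filter_mono inf_le_left
  filter_upwards [h2, hv.filter_mono inf_le_right] with x hx hx'
  exact (hx' hx).symm

end TwoPhase
-- Identification of the limit of the discrete gradients.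
namespace TwoPhase

lemma setIntegral_prod_symm' {s t : Set ℝ} {h : ℝ × ℝ → ℝ} (hh : IntegrableOn h (s ×ˢ t)) :
    ∫ z in s ×ˢ t, h z = ∫ y in t, ∫ x in s, h (x, y) := by
  rw [IntegrableOn, Measure.volume_eq_prod, ← Measure.prod_restrict] at hh
  rw [Measure.volume_eq_prod, ← Measure.prod_restrict]
  exact integral_prod_symm h hh

namespace Problem

/-- `φ_i` extended by constants outside `[0,1]`. -/
def cphi (P : Problem) (i : Fin 2) (s : ℝ) : ℝ := P.phi i (clamp s)

/-- The limits of a sequence of approximate solutions. -/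
structure Converges (P : Problem) (ε : ℕ → ℝ) (A : ℕ → Approx) (u g : ℝ × ℝ → ℝ)
    (tl tr : Fin 2 → ℝ → ℝ) : Prop where
  meas_u : Measurable u
  u_mem : ∀ z, u z ∈ Icc (0 : ℝ) 1
  meas_g : StronglyMeasurable g
  g_memLp : MemLp g 2 (volume.restrict (Ioo (-1 : ℝ) 1 ×ˢ Ioo 0 P.T))
  meas_tl : ∀ i, Measurable (tl i)
  meas_tr : ∀ i, Measurable (tr i)
  tl_mem : ∀ i t, tl i t ∈ Icc (0 : ℝ) 1
  tr_mem : ∀ i t, tr i t ∈ Icc (0 : ℝ) 1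
  u_lim : ∀ᵐ z ∂volume.restrict (Ioo (-1 : ℝ) 1 ×ˢ Ioo 0 P.T),
    Tendsto (fun p => (A p).u z) atTop (𝓝 (u z))
  trace_lim : ∀ᵐ t ∂volume.restrict (Ioo 0 P.T), ∀ i,
    Tendsto (fun p => (A p).tl i t) atTop (𝓝 (tl i t)) ∧
    Tendsto (fun p => (A p).tr i t) atTop (𝓝 (tr i t))
  K_lim : ∀ᵐ t ∂volume.restrict (Ioo 0 P.T), Tendsto (fun p => ε p * (A p).K t) atTop (𝓝 0)
  g_lim : ∀ χ, MemLp χ 2 (volume.restrict (Ioo (-1 : ℝ) 1 ×ˢ Ioo 0 P.T)) →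
    Tendsto (fun p => ∫ z in Ioo (-1 : ℝ) 1 ×ˢ Ioo 0 P.T, (A p).g z * χ z) atTop
      (𝓝 (∫ z in Ioo (-1 : ℝ) 1 ×ˢ Ioo 0 P.T, g z * χ z))

variable {P : Problem}

lemma IsApprox.g_memLp {C ε : ℝ} {A : Approx} (hA : P.IsApprox C ε A) :
    MemLp A.g 2 (volume.restrict (Ioo (-1 : ℝ) 1 ×ˢ Ioo 0 P.T)) := by
  obtain ⟨B, hB⟩ := hA.g_bdd
  refine MemLp.of_bound hA.meas_g.aestronglyMeasurable B ?_
  filter_upwards [ae_restrict_mem (measurableSet_Ioo.prod measurableSet_Ioo)] with z hz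
  exact hB z.1 hz.1 z.2 hz.2

lemma IsApprox.integral_g_sq_le {C ε : ℝ} {A : Approx} (hA : P.IsApprox C ε A) :
    ∫ z in Ioo (-1 : ℝ) 1 ×ˢ Ioo 0 P.T, A.g z ^ 2 ≤ C := by
  have hi := hA.g_memLp.integrable_sq
  rw [setIntegral_prod_symm' hi]
  rw [Measure.volume_eq_prod, ← Measure.prod_restrict] at hi
  refine (setIntegral_mono_on hi.integral_prod_right hA.K_int measurableSet_Ioo
    fun t ht => hA.g_sq t ht).trans hA.K_sq

/-- Three successive extractions: almost everywhere limits of saturations and traces, `ε K → 0`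
almost everywhere, weak limit of the gradients. Each property is inherited by further subsequences.
-/
lemma Converges.exists (hP : P.Admissible) {C : ℝ} {ε : ℕ → ℝ} {A : ℕ → Approx}
    (hA : ∀ p, P.IsApprox C (ε p) (A p)) (hε : Tendsto ε atTop (𝓝 0)) :
    ∃ σ : ℕ → ℕ, StrictMono σ ∧ ∃ u g tl tr,
      P.Converges (fun p => ε (σ p)) (fun p => A (σ p)) u g tl tr := by
  obtain ⟨σ, hσ, u, tl, tr, hu, hu1, ht, hul, htl⟩ := exists_ae_limit hP hA hε
  obtain ⟨τ, hτ, hK⟩ := exists_subseq_ae_tendsto_zero (fun p => (A (σ p)).K)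
    (fun p => (hA (σ p)).meas_K) (fun p => (hA (σ p)).K_int) (fun p => (hA (σ p)).K_sq)
    (hε.comp hσ.tendsto_atTop)
  obtain ⟨υ, hυ, g, hg, hg2, hgl⟩ := exists_subseq_weak_limit (fun p => (A (σ (τ p))).g)
    (fun p => (hA _).g_memLp) (fun p => (hA _).integral_g_sq_le)
  have hτυ := (hτ.comp hυ).tendsto_atTop
  exact ⟨σ ∘ τ ∘ υ, hσ.comp (hτ.comp hυ), u, g, tl, tr, hu, hu1, hg, hg2, fun i => (ht i).1,
    fun i => (ht i).2.1, fun i t => ((ht i).2.2 t).1, fun i t => ((ht i).2.2 t).2,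
    hul.mono fun z hz => hz.comp hτυ,
    htl.mono fun t ht i => ⟨(ht i).1.comp hτυ, (ht i).2.comp hτυ⟩,
    hK.mono fun t ht => ht.comp hυ.tendsto_atTop, hgl⟩

lemma Admissible.continuous_cphi (hP : P.Admissible) (i : Fin 2) : Continuous (P.cphi i) :=
  continuous_comp_clamp (hP.phi_cont i)

lemma cphi_of_mem {i : Fin 2} {s : ℝ} (hs : s ∈ Icc (0 : ℝ) 1) : P.cphi i s = P.phi i s := by
  rw [cphi, clamp_of_mem hs]

lemma Admissible.exists_cphi_bound (hP : P.Admissible) (i : Fin 2) : ∃ B, 0 ≤ B ∧ ∀ s, |P.cphi i s| ≤ B := by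
  obtain ⟨B, hB, h⟩ := exists_abs_le_of_continuousOn (hP.phi_cont i)
  exact ⟨B, hB, fun s => h _ (clamp_mem s)⟩

/-- Indicators of rectangles as test functions for the weak limit: they isolate the integral of `g`
over a space interval, averaged over a set of times. -/
lemma integral_mul_indicator_rect {h : ℝ × ℝ → ℝ}
    (hh : IntegrableOn h (Ioo (-1 : ℝ) 1 ×ˢ Ioo 0 P.T)) {a b : ℝ} (ha : -1 ≤ a) (hb : b ≤ 1)
    (hab : a ≤ b) {E : Set ℝ} (hE : MeasurableSet E) :
    ∫ z in Ioo (-1 : ℝ) 1 ×ˢ Ioo 0 P.T, h z * (Ioo a b ×ˢ E).indicator 1 z =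
      ∫ t in E, (∫ y in a..b, h (y, t)) ∂volume.restrict (Ioo 0 P.T) := by
  have hR : MeasurableSet (Ioo a b ×ˢ E) := measurableSet_Ioo.prod hE
  have e1 : (fun z => h z * (Ioo a b ×ˢ E).indicator 1 z) = (Ioo a b ×ˢ E).indicator h := by
    ext z; by_cases hz : z ∈ Ioo a b ×ˢ E <;> simp [hz]
  rw [e1, setIntegral_indicator hR, prod_inter_prod, inter_eq_right.2 (Ioo_subset_Ioo ha hb),
    setIntegral_prod_symm' (hh.mono_set (prod_mono (Ioo_subset_Ioo ha hb) inter_subset_left)),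
    Measure.restrict_restrict hE, inter_comm]
  simp only [integral_Ioo_eq _ hab]

namespace Converges

variable (hP : P.Admissible) {C : ℝ} {ε : ℕ → ℝ} {A : ℕ → Approx}
  (hA : ∀ p, P.IsApprox C (ε p) (A p)) (hε : Tendsto ε atTop (𝓝 0)) {u g : ℝ × ℝ → ℝ}
  {tl tr : Fin 2 → ℝ → ℝ} (hc : P.Converges ε A u g tl tr)

include hA hε in
/-- `ε K` tends to zero in the mean. -/
lemma tendsto_integral_eps_K :
    Tendsto (fun p => ∫ t in Ioo 0 P.T, ε p * (A p).K t) atTop (𝓝 0) := by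
  have hfin : ∀ p, IntegrableOn (fun t => (1 + (A p).K t ^ 2)) (Ioo 0 P.T) := fun p =>
    (integrableOn_const (by simp)).add (hA p).K_int
  have hle : ∀ p t, ‖(A p).K t‖ ≤ 1 + (A p).K t ^ 2 := fun p t => by
    rw [Real.norm_eq_abs, abs_le]
    constructor <;> nlinarith [sq_nonneg ((A p).K t - 1), sq_nonneg ((A p).K t + 1)]
  have hb : ∀ p, |∫ t in Ioo 0 P.T, (A p).K t| ≤ volume.real (Ioo 0 P.T) + C := fun p => by
    refine (norm_integral_le_of_norm_le (hfin p) (ae_of_all _ (hle p))).trans ?_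
    rw [integral_add (integrable_const _) (hA p).K_int]
    simpa using (hA p).K_sq
  simp only [integral_const_mul]
  exact hε.zero_mul_isBoundedUnder_le (isBoundedUnder_of ⟨_, fun p => hb p⟩)

include hP hA hε hc in
/-- Identification of the weak limit of the discrete gradients along vertical lines. -/
lemma cphi_eq_of_near {i : Fin 2} {x : ℝ} (hx : x ∈ Icc (left i) (left i + 1)) {a : ℕ → ℝ → ℝ}
    {b : ℝ → ℝ} (ha : ∀ p, Measurable (a p)) (hb : Measurable b)
    (hab : ∀ᵐ t ∂volume.restrict (Ioo 0 P.T), Tendsto (fun p => a p t) atTop (𝓝 (b t)))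
    (hn : ∀ p, ∀ t ∈ Ioo 0 P.T, |P.cphi i (a p t) -
      (P.cphi i ((A p).tl i t) + ∫ y in (left i)..x, (A p).g (y, t))| ≤ ε p * (A p).K t) :
    ∀ᵐ t ∂volume.restrict (Ioo 0 P.T),
      P.cphi i (b t) = P.cphi i (tl i t) + ∫ y in (left i)..x, g (y, t) := by
  have hl := left_mem i
  have hφ := hP.continuous_cphi i
  obtain ⟨B, hB0, hB⟩ := hP.exists_cphi_bound i
  set ν := volume.restrict (Ioo 0 P.T) with hν
  have hgi := hc.g_memLp.integrable (by norm_num)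
  have hgpi : ∀ p, Integrable (A p).g (volume.restrict (Ioo (-1 : ℝ) 1 ×ˢ Ioo 0 P.T)) := fun p =>
    (hA p).g_memLp.integrable (by norm_num)
  have hSint : ∀ h : ℝ × ℝ → ℝ, IntegrableOn h (Ioo (-1 : ℝ) 1 ×ˢ Ioo 0 P.T) →
      Integrable (fun t => ∫ y in (left i)..x, h (y, t)) ν := fun h hh => by
    have h2 := hh.mono_set (prod_mono (Ioo_subset_Ioo hl.1 (show x ≤ 1 by linarith [hl.2, hx.2])) (le_refl (Ioo 0 P.T)))
    rw [IntegrableOn, Measure.volume_eq_prod, ← Measure.prod_restrict] at h2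
    simpa only [integral_Ioo_eq _ hx.1] using h2.integral_prod_right
  have hD : ∀ (a b : ℝ → ℝ), Measurable a → Measurable b →
      Integrable (fun t => P.cphi i (a t) - P.cphi i (b t)) ν := fun a b ha hb => by
    refine Integrable.of_bound (C := B + B) ((hφ.measurable.comp ha).sub
      (hφ.measurable.comp hb)).aestronglyMeasurable (ae_of_all _ fun t => ?_)
    exact (abs_sub _ _).trans (add_le_add (hB _) (hB _))
  -- It suffices to compare integrals over all measurable sets `E` of times. There the left side
  -- converges by dominated convergence (`l1`), the right side weakly (`l2`), and their discrete
  -- difference is controlled by the mean of `ε K` (`l3`).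
  have key := (hD b (tl i) hb (hc.meas_tl i)).ae_eq_of_forall_setIntegral_eq _ _ (hSint g hgi)
    fun E hE _ => ?_
  · filter_upwards [key] with t ht
    linarith
  have l1 : Tendsto (fun p => ∫ t in E, (P.cphi i (a p t) - P.cphi i ((A p).tl i t)) ∂ν) atTop
      (𝓝 (∫ t in E, (P.cphi i (b t) - P.cphi i (tl i t)) ∂ν)) := by
    refine tendsto_integral_of_dominated_convergence (fun _ => B + B)
      (fun p => (hD _ _ (ha p) ((hA p).meas_tl i)).aestronglyMeasurable.restrict)
      (integrable_const _) (fun p => ae_of_all _ fun t =>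
        (abs_sub _ _).trans (add_le_add (hB _) (hB _))) ?_
    refine ae_restrict_of_ae ?_
    filter_upwards [hab, hc.trace_lim] with t h1 h2
    exact ((hφ.tendsto _).comp h1).sub ((hφ.tendsto _).comp (h2 i).1)
  have l2 : Tendsto (fun p => ∫ t in E, (∫ y in (left i)..x, (A p).g (y, t)) ∂ν) atTop
      (𝓝 (∫ t in E, (∫ y in (left i)..x, g (y, t)) ∂ν)) := by
    have hx1 : x ≤ 1 := by linarith [hl.2, hx.2]
    have := hc.g_lim ((Ioo (left i) x ×ˢ E).indicator 1)
      (((memLp_const (1 : ℝ)).indicator (measurableSet_Ioo.prod hE)))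
    rw [integral_mul_indicator_rect hgi hl.1 hx1 hx.1 hE] at this
    exact this.congr fun p => integral_mul_indicator_rect (hgpi p) hl.1 hx1 hx.1 hE
  have l3 : Tendsto (fun p => (∫ t in E, (P.cphi i (a p t) - P.cphi i ((A p).tl i t)) ∂ν) -
      ∫ t in E, (∫ y in (left i)..x, (A p).g (y, t)) ∂ν) atTop (𝓝 0) := by
    refine squeeze_zero_norm (fun p => ?_) (tendsto_integral_eps_K hA hε)
    have hKi : Integrable (fun t => ε p * (A p).K t) ν := by
      refine Integrable.const_mul ?_ _
      refine (Integrable.add (integrable_const (1 : ℝ)) (hA p).K_int).mono'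
        (hA p).meas_K.aestronglyMeasurable (ae_of_all _ fun t => ?_)
      rw [Real.norm_eq_abs, abs_le]
      constructor <;> simp only [Pi.add_apply] <;>
        nlinarith [sq_nonneg ((A p).K t - 1), sq_nonneg ((A p).K t + 1)]
    have hnn : 0 ≤ᵐ[ν] fun t => ε p * (A p).K t := by
      filter_upwards [ae_restrict_mem measurableSet_Ioo] with t ht
      exact (abs_nonneg _).trans (hn p t ht)
    rw [← integral_sub (hD _ _ (ha p) ((hA p).meas_tl i)).integrableOn
      (hSint _ (hgpi p)).integrableOn]
    refine (norm_integral_le_of_norm_le hKi.integrableOn (ae_restrict_of_ae ?_)).trans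
      (setIntegral_le_integral hKi hnn)
    filter_upwards [ae_restrict_mem measurableSet_Ioo] with t ht
    have := hn p t ht
    rwa [← sub_sub] at this
  have l4 := l1.sub l2
  exact sub_eq_zero.1 (tendsto_nhds_unique l4 l3)

end Converges
end Problem
end TwoPhase
-- Regularity, traces and transmission condition of the limit.
namespace TwoPhase

/-- The transmission condition is stable under limits. -/
lemma Layer.Admissible.graph_inter_of_tendsto {L₁ L₂ : Layer} (h₁ : L₁.Admissible)
    (h₂ : L₂.Admissible) {s t : ℕ → ℝ} {a b : ℝ} (hs : Tendsto s atTop (𝓝 a))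
    (ht : Tendsto t atTop (𝓝 b)) (h : ∀ p, (L₁.graph (s p) ∩ L₂.graph (t p)).Nonempty) :
    (L₁.graph a ∩ L₂.graph b).Nonempty := by
  obtain ⟨k₁, hk₁, -, -, hk₁0, hk₁1, hg₁⟩ := h₁.exists_graph_inverse
  obtain ⟨k₂, hk₂, -, -, hk₂0, hk₂1, hg₂⟩ := h₂.exists_graph_inverse
  set l := min (L₁.pc 0) (L₂.pc 0) with hl
  set r := max (L₁.pc 1) (L₂.pc 1) with hr
  have hlr : l ≤ r := (min_le_left _ _).trans ((h₁.pc_strictMono (left_mem_Icc.2 zero_le_one)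
    (right_mem_Icc.2 zero_le_one) zero_lt_one).le.trans (le_max_left _ _))
  -- The pairs with intersecting graphs form the curve `q ↦ (k₁ q, k₂ q)`. It is constant on either
  -- side of `[l, r]`, so it is the image of a compact interval and therefore closed.
  have hcl : IsClosed ((fun q => (k₁ q, k₂ q)) '' Icc l r) :=
    (isCompact_Icc.image (hk₁.prodMk hk₂)).isClosed
  have hmem : ∀ p, (s p, t p) ∈ (fun q => (k₁ q, k₂ q)) '' Icc l r := fun p => by
    obtain ⟨q, hq₁, hq₂⟩ := h p
    rw [hg₁] at hq₁
    rw [hg₂] at hq₂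
    rcases le_total q l with hql | hql
    · refine ⟨l, left_mem_Icc.2 hlr, ?_⟩
      simp only [← hq₁, ← hq₂, hk₁0 q (hql.trans (min_le_left _ _)), hk₁0 l (min_le_left _ _),
        hk₂0 q (hql.trans (min_le_right _ _)), hk₂0 l (min_le_right _ _)]
    rcases le_total r q with hqr | hqr
    · refine ⟨r, right_mem_Icc.2 hlr, ?_⟩
      simp only [← hq₁, ← hq₂, hk₁1 q ((le_max_left _ _).trans hqr), hk₁1 r (le_max_left _ _),
        hk₂1 q ((le_max_right _ _).trans hqr), hk₂1 r (le_max_right _ _)]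
    · exact ⟨q, ⟨hql, hqr⟩, by simp only [hq₁, hq₂]⟩
  obtain ⟨q, -, hq⟩ := hcl.mem_of_tendsto (hs.prodMk_nhds ht) (Eventually.of_forall hmem)
  rw [Prod.mk.injEq] at hq
  exact ⟨q, (hg₁ _ _).2 hq.1, (hg₂ _ _).2 hq.2⟩

/-- Joint measurability in space and time, needed to exchange "for almost every `x`, almost every
`t`" with the opposite order. -/
lemma measurable_primitive {g : ℝ × ℝ → ℝ} (hg : StronglyMeasurable g) (a : ℝ) :
    Measurable fun z : ℝ × ℝ => ∫ y in Ioo a z.1, g (y, z.2) := by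
  have h : StronglyMeasurable (Function.uncurry fun (z : ℝ × ℝ) (y : ℝ) =>
      {w : (ℝ × ℝ) × ℝ | a < w.2 ∧ w.2 < w.1.1}.indicator (fun w => g (w.2, w.1.2)) (z, y)) := by
    refine (hg.comp_measurable (measurable_snd.prodMk
      (measurable_snd.comp measurable_fst))).indicator ?_
    exact (measurableSet_lt measurable_const measurable_snd).inter
      (measurableSet_lt measurable_snd (measurable_fst.comp measurable_fst))
  have h2 : (fun z : ℝ × ℝ => ∫ y in Ioo a z.1, g (y, z.2)) = fun z : ℝ × ℝ => ∫ y,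
      {w : (ℝ × ℝ) × ℝ | a < w.2 ∧ w.2 < w.1.1}.indicator (fun w => g (w.2, w.1.2)) (z, y) := by
    funext z
    rw [← integral_indicator measurableSet_Ioo]
    rfl
  rw [h2]
  exact (h.integral_prod_right (ν := volume)).measurable

namespace Problem

variable {P : Problem} (hP : P.Admissible) {C : ℝ} {ε : ℕ → ℝ} {A : ℕ → Approx}
  (hA : ∀ p, P.IsApprox C (ε p) (A p)) (hε : Tendsto ε atTop (𝓝 0)) {u g : ℝ × ℝ → ℝ}
  {tl tr : Fin 2 → ℝ → ℝ} (hc : P.Converges ε A u g tl tr)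

namespace Converges

include hP hA hε hc

/-- For almost every time, `φ_i(u)` is a primitive of `g` with boundary values given by the
traces. -/
lemma ae_primitive : ∀ᵐ t ∂volume.restrict (Ioo 0 P.T), ∀ i,
    IntervalIntegrable (fun y => g (y, t)) volume (left i) (left i + 1) ∧
    P.cphi i (tr i t) = P.cphi i (tl i t) + ∫ y in (left i)..(left i + 1), g (y, t) ∧
    ∀ᵐ x ∂volume.restrict (Ioo (left i) (left i + 1)),
      P.cphi i (u (x, t)) = P.cphi i (tl i t) + ∫ y in (left i)..x, g (y, t) := by
  rw [ae_all_iff]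
  intro i
  have hl := left_mem i
  have h1 : ∀ᵐ t ∂volume.restrict (Ioo 0 P.T),
      IntervalIntegrable (fun y => g (y, t)) volume (left i) (left i + 1) := by
    have hgi := hc.g_memLp.integrable (by norm_num)
    rw [Measure.volume_eq_prod, ← Measure.prod_restrict] at hgi
    filter_upwards [hgi.prod_left_ae] with t ht
    refine (intervalIntegrable_iff_integrableOn_Ioo_of_le (by linarith)).2 ?_
    exact IntegrableOn.mono_set ht (Ioo_subset_Ioo hl.1 (by linarith [hl.2]))
  have h2 := hc.cphi_eq_of_near hP hA hε (i := i) (x := left i + 1)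
    (right_mem_Icc.2 (by linarith)) (a := fun p => (A p).tr i) (b := tr i)
    (fun p => (hA p).meas_tr i) (hc.meas_tr i) (hc.trace_lim.mono fun t ht => (ht i).2)
    fun p t ht => by
      rw [cphi_of_mem ((hA p).tr_mem i t ht), cphi_of_mem ((hA p).tl_mem i t ht),
        (hA p).right i t ht, sub_self, abs_zero]
      exact mul_nonneg ((hA p).eps_nonneg ht) ((hA p).K_nonneg t)
  have h3 : ∀ᵐ x ∂volume.restrict (Ioo (left i) (left i + 1)), ∀ᵐ t ∂volume.restrict (Ioo 0 P.T),
      P.cphi i (u (x, t)) = P.cphi i (tl i t) + ∫ y in Ioo (left i) x, g (y, t) := by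
    have hul := hc.u_lim
    rw [Measure.volume_eq_prod, ← Measure.prod_restrict] at hul
    have hul' := ae_restrict_of_ae_restrict_of_subset (dom_subset i) (Measure.ae_ae_of_ae_prod hul)
    rw [dom_eq] at hul'
    filter_upwards [hul', ae_restrict_mem measurableSet_Ioo] with x hx hxd
    have := hc.cphi_eq_of_near hP hA hε (i := i) (x := x) (Ioo_subset_Icc_self hxd)
      (a := fun p t => (A p).u (x, t)) (b := fun t => u (x, t))
      (fun p => (hA p).meas_u.comp measurable_prodMk_left)
      (hc.meas_u.comp measurable_prodMk_left) hx fun p t ht => by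
        have hxi : x ∈ dom i := by rwa [dom_eq]
        rw [cphi_of_mem ((hA p).tl_mem i t ht),
          cphi_of_mem ((hA p).u_mem x (dom_subset i hxi) t ht)]
        exact (hA p).near i x hxi t ht
    simpa only [integral_Ioo_eq _ hxd.1.le] using this
  have hφ := (hP.continuous_cphi i).measurable
  have hmeas : MeasurableSet {z : ℝ × ℝ | P.cphi i (u (z.1, z.2)) =
      P.cphi i (tl i z.2) + ∫ y in Ioo (left i) z.1, g (y, z.2)} :=
    measurableSet_eq_fun (hφ.comp hc.meas_u)
      ((hφ.comp ((hc.meas_tl i).comp measurable_snd)).add (measurable_primitive hc.meas_g _))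
  -- The identification was made at fixed `x`, whereas traces and weak derivatives need one set of
  -- full measure in time.
  rw [Measure.ae_ae_comm hmeas] at h3
  filter_upwards [h1, h2, h3] with t e1 e2 e3
  refine ⟨e1, e2, ?_⟩
  filter_upwards [e3, ae_restrict_mem measurableSet_Ioo] with x hx hxd
  rw [hx, integral_Ioo_eq _ hxd.1.le]

lemma memL2H1 (i : Fin 2) : P.MemL2H1 (dom i) (fun z => P.phi i (u z)) g := by
  have hsub : dom i ×ˢ Ioo 0 P.T ⊆ Ioo (-1 : ℝ) 1 ×ˢ Ioo 0 P.T := prod_mono (dom_subset i) le_rfl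
  have hle := Measure.restrict_mono (μ := (volume : Measure (ℝ × ℝ))) hsub le_rfl
  have hcu : ∀ z, P.phi i (u z) = P.cphi i (u z) := fun z => (cphi_of_mem (hc.u_mem z)).symm
  simp only [MemL2H1, hcu]
  refine ⟨?_, hc.g_memLp.mono_measure hle, ?_⟩
  · obtain ⟨B, -, hB⟩ := hP.exists_cphi_bound i
    have : MemLp (fun z => P.cphi i (u z)) 2 (volume.restrict (Ioo (-1 : ℝ) 1 ×ˢ Ioo 0 P.T)) :=
      MemLp.of_bound ((hP.continuous_cphi i).measurable.comp hc.meas_u).aestronglyMeasurable B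
        (ae_of_all _ fun z => hB _)
    exact this.mono_measure hle
  · filter_upwards [hc.ae_primitive hP hA hε] with t ht
    rw [dom_eq]
    exact isWeakDeriv_of_ae_eq (by linarith) (ht i).1 (ht i).2.2

/-- For almost every time, `u` equals almost everywhere the continuous inverse of `φ` applied to a
primitive continuous up to the ends of the layer. The values at the ends are the limits of the
discrete traces. -/
lemma hasTrace (i : Fin 2) : P.HasTrace (dom i) (left i) u (tl i) ∧
    P.HasTrace (dom i) (left i + 1) u (tr i) := by
  obtain ⟨k, hk, -, hkφ, -⟩ := (hP.layers i).exists_phi_inverse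
  have hkc : ∀ s ∈ Icc (0 : ℝ) 1, k (P.cphi i s) = s := fun s hs => by
    rw [cphi_of_mem hs]; exact hkφ s hs
  have key : ∀ᵐ t ∂volume.restrict (Ioo 0 P.T), ∀ α ∈ Icc (left i) (left i + 1),
      Tendsto (fun x => u (x, t)) (𝓝[dom i] α ⊓ ae volume)
        (𝓝 (k (P.cphi i (tl i t) + ∫ y in (left i)..α, g (y, t)))) := by
    filter_upwards [hc.ae_primitive hP hA hε] with t ht α hα
    obtain ⟨h1, -, h3⟩ := ht i
    have hcont : ContinuousOn (fun x => k (P.cphi i (tl i t) + ∫ y in (left i)..x, g (y, t)))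
        (Icc (left i) (left i + 1)) := by
      refine hk.comp_continuousOn (continuousOn_const.add ?_)
      have := (h1.absolutelyContinuousOnInterval_intervalIntegral (c := left i)
        left_mem_uIcc).continuousOn
      rwa [uIcc_of_le (by linarith)] at this
    rw [dom_eq]
    refine tendsto_of_ae_eq hα hcont (h3.mono fun x hx => ?_)
    rw [← hx, hkc _ (hc.u_mem _)]
  refine ⟨⟨(hc.meas_tl i).aemeasurable, ?_⟩, (hc.meas_tr i).aemeasurable, ?_⟩
  · filter_upwards [key] with t ht
    have := ht _ (left_mem_Icc.2 (by linarith))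
    rwa [intervalIntegral.integral_same, add_zero, hkc _ (hc.tl_mem i t)] at this
  · filter_upwards [key, hc.ae_primitive hP hA hε] with t ht ht'
    have := ht _ (right_mem_Icc.2 (by linarith))
    rwa [← (ht' i).2.1, hkc _ (hc.tr_mem i t)] at this

omit hε in
lemma ae_compat : ∀ᵐ t ∂volume.restrict (Ioo 0 P.T),
    ((P.layer 0).graph (tr 0 t) ∩ (P.layer 1).graph (tl 1 t)).Nonempty := by
  filter_upwards [hc.trace_lim, ae_restrict_mem measurableSet_Ioo] with t ht htm
  exact (hP.layers 0).graph_inter_of_tendsto (hP.layers 1) (ht 0).2 (ht 1).1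
    fun p => (hA p).compat t htm

end Converges
end Problem
end TwoPhase
-- Passage to the limit in the weak formulation.
namespace TwoPhase

lemma tendsto_integral_of_bounded {α : Type*} [MeasurableSpace α] {μ : Measure α}
    [IsFiniteMeasure μ] {F : ℕ → α → ℝ} {f : α → ℝ} (hF : ∀ p, AEStronglyMeasurable (F p) μ)
    (B : ℝ) (hB : ∀ p, ∀ᵐ x ∂μ, |F p x| ≤ B)
    (hlim : ∀ᵐ x ∂μ, Tendsto (fun p => F p x) atTop (𝓝 (f x))) :
    Tendsto (fun p => ∫ x, F p x ∂μ) atTop (𝓝 (∫ x, f x ∂μ)) :=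
  tendsto_integral_of_dominated_convergence (fun _ => B) hF (integrable_const _) hB hlim

lemma abs_mul_le_of_le {a b A B : ℝ} (ha : |a| ≤ A) (hb : |b| ≤ B) : |a * b| ≤ A * B := by
  rw [abs_mul]
  exact mul_le_mul ha hb (abs_nonneg _) ((abs_nonneg _).trans ha)

lemma abs_le_one_of_mem {a : ℝ} (ha : a ∈ Icc (0 : ℝ) 1) : |a| ≤ 1 :=
  abs_le.2 ⟨by linarith [ha.1], ha.2⟩

namespace Problem

variable {P : Problem}

lemma Admissible.abs_poro_le (hP : P.Admissible) (x : ℝ) : |P.poro x| ≤ 1 :=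
  abs_le_one_of_mem (Ioo_subset_Icc_self (hP.poro_mem x))

/-- The convection flux of the layer that contains `x`. -/
def fluxAt (P : Problem) (x s : ℝ) : ℝ := if x < 0 then P.f 0 (clamp s) else P.f 1 (clamp s)

lemma Admissible.measurable_fluxAt (hP : P.Admissible) {u : ℝ × ℝ → ℝ} (hu : Measurable u) :
    Measurable fun z => P.fluxAt z.1 (u z) :=
  Measurable.ite (measurableSet_lt measurable_fst measurable_const)
    ((continuous_comp_clamp (hP.f_cont 0)).measurable.comp hu)
    ((continuous_comp_clamp (hP.f_cont 1)).measurable.comp hu)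

lemma fluxAt_eq {i : Fin 2} {x s : ℝ} (hx : x ∈ dom i) (hs : s ∈ Icc (0 : ℝ) 1) :
    P.fluxAt x s = P.f i s := by
  rw [dom_eq] at hx
  unfold fluxAt
  rw [clamp_of_mem hs]
  fin_cases i <;> simp only [left] at hx
  · rw [if_pos (by simpa using hx.2)]; rfl
  · rw [if_neg (by simpa using hx.1.le)]; rfl

lemma poro_eq {i : Fin 2} {x : ℝ} (hx : x ∈ dom i) : P.poro x = (P.layer i).poro := by
  rw [dom_eq] at hx
  unfold poro
  fin_cases i <;> simp only [left] at hx
  · rw [if_pos (by simpa using hx.2)]; rfl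
  · rw [if_neg (by simpa using hx.1.le)]; rfl

lemma exists_mem_dom {x : ℝ} (hx : x ∈ Ioo (-1 : ℝ) 1) (h0 : x ≠ 0) : ∃ i, x ∈ dom i := by
  rcases lt_or_gt_of_ne h0 with h | h
  · exact ⟨0, by simp [dom, h, hx.1]⟩
  · exact ⟨1, by simp [dom, h, hx.2]⟩

lemma ae_fst_ne_zero : ∀ᵐ z : ℝ × ℝ, z.1 ≠ 0 := by
  rw [Measure.volume_eq_prod]
  exact (Measure.quasiMeasurePreserving_fst (μ := volume) (ν := volume)).ae
    (p := fun x : ℝ => x ≠ 0) (by simp [ae_iff])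

lemma disjoint_dom : Disjoint (dom 0) (dom 1) := by
  rw [Set.disjoint_left]
  intro x h0 h1
  simp only [dom, if_true, one_ne_zero, if_false] at h0 h1
  exact lt_asymm h0.2 h1.1

lemma measurableSet_dom (i : Fin 2) : MeasurableSet (dom i) := by
  rw [dom_eq]; exact measurableSet_Ioo

lemma integral_eq_sum_dom {h : ℝ → ℝ} (hh : IntegrableOn h (Ioo (-1) 1)) :
    ∫ x in Ioo (-1 : ℝ) 1, h x = ∑ i, ∫ x in dom i, h x := by
  have hset : Ioo (-1 : ℝ) 1 =ᵐ[volume] (dom 0 ∪ dom 1 : Set ℝ) := by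
    have hne : ∀ᵐ x : ℝ, x ≠ 0 := by simp [ae_iff]
    filter_upwards [hne] with x hx
    refine propext ⟨fun h => ?_, fun h => h.elim (fun h => dom_subset 0 h) fun h => dom_subset 1 h⟩
    obtain ⟨i, hi⟩ := exists_mem_dom h hx
    fin_cases i
    exacts [Or.inl hi, Or.inr hi]
  rw [setIntegral_congr_set hset, setIntegral_union disjoint_dom (measurableSet_dom 1)
    (hh.mono_set (dom_subset 0)) (hh.mono_set (dom_subset 1)), Fin.sum_univ_two]

lemma integral_cylinder_eq_sum_dom {h : ℝ × ℝ → ℝ}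
    (hh : IntegrableOn h (Ioo (-1 : ℝ) 1 ×ˢ Ioo 0 P.T)) :
    ∫ z in Ioo (-1 : ℝ) 1 ×ˢ Ioo 0 P.T, h z = ∑ i, ∫ z in dom i ×ˢ Ioo 0 P.T, h z := by
  have hsub : ∀ i, dom i ×ˢ Ioo 0 P.T ⊆ Ioo (-1 : ℝ) 1 ×ˢ Ioo 0 P.T := fun i =>
    prod_mono (dom_subset i) le_rfl
  have hset : Ioo (-1 : ℝ) 1 ×ˢ Ioo 0 P.T =ᵐ[volume]
      (dom 0 ×ˢ Ioo 0 P.T ∪ dom 1 ×ˢ Ioo 0 P.T : Set (ℝ × ℝ)) := by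
    filter_upwards [ae_fst_ne_zero] with z hz
    refine propext ⟨fun h => ?_, fun h => h.elim (fun h => hsub 0 h) fun h => hsub 1 h⟩
    obtain ⟨i, hi⟩ := exists_mem_dom h.1 hz
    fin_cases i
    exacts [Or.inl ⟨hi, h.2⟩, Or.inr ⟨hi, h.2⟩]
  rw [setIntegral_congr_set hset, setIntegral_union (disjoint_dom.set_prod_left _ _)
    ((measurableSet_dom 1).prod measurableSet_Ioo) (hh.mono_set (hsub 0)) (hh.mono_set (hsub 1)),
    Fin.sum_univ_two]

namespace Converges

variable (hP : P.Admissible) {C : ℝ} {ε : ℕ → ℝ} {A : ℕ → Approx}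
  (hA : ∀ p, P.IsApprox C (ε p) (A p)) (hε : Tendsto ε atTop (𝓝 0)) {u g : ℝ × ℝ → ℝ}
  {tl tr : Fin 2 → ℝ → ℝ} (hc : P.Converges ε A u g tl tr)

include hA hε in
lemma tendsto_floor {t : ℝ} (ht : t ∈ Ioo 0 P.T) :
    Tendsto (fun p => (A p).fl t) atTop (𝓝 t) :=
  tendsto_of_tendsto_of_tendsto_of_le_of_le (by simpa using tendsto_const_nhds.sub hε)
    tendsto_const_nhds (fun p => ((hA p).fl_mem t ht).1) fun p => ((hA p).fl_mem t ht).2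

include hP hA hε hc in
-- The neighbouring values `a` and `b` differ from `u` by at most `ε K → 0` when measured through
-- `φ`, hence also in saturation by the uniform continuity of the inverse of `φ`.
lemma flux_lim : ∀ᵐ z ∂volume.restrict (Ioo (-1 : ℝ) 1 ×ˢ Ioo 0 P.T),
    Tendsto (fun p => (A p).H z) atTop (𝓝 (P.fluxAt z.1 (u z))) := by
  have hK : ∀ᵐ z ∂volume.restrict (Ioo (-1 : ℝ) 1 ×ˢ Ioo 0 P.T),
      Tendsto (fun p => ε p * (A p).K z.2) atTop (𝓝 0) := by
    rw [Measure.volume_eq_prod, ← Measure.prod_restrict]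
    exact Measure.quasiMeasurePreserving_snd.ae hc.K_lim
  filter_upwards [hc.u_lim, hK, ae_restrict_of_ae ae_fst_ne_zero,
    ae_restrict_mem (measurableSet_Ioo.prod measurableSet_Ioo)] with z hu hKz hz hzQ
  obtain ⟨i, hi⟩ := exists_mem_dom hzQ.1 hz
  have hC0 : 0 ≤ C := (abs_nonneg _).trans ((hA 0).abs_H_le z.1 hzQ.1 z.2 hzQ.2)
  have h1 : Tendsto (fun p => P.f i (clamp ((A p).u z))) atTop (𝓝 (P.f i (clamp (u z)))) :=
    ((continuous_comp_clamp (hP.f_cont i)).tendsto _).comp hu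
  rw [fluxAt_eq hi (hc.u_mem z)]
  rw [clamp_of_mem (hc.u_mem z)] at h1
  have h2 : Tendsto (fun p => (A p).H z - P.f i (clamp ((A p).u z))) atTop (𝓝 0) := by
    rw [Metric.tendsto_atTop]
    intro η hη
    obtain ⟨r, hr, hmod⟩ := hP.exists_phi_modulus (show 0 < η / (2 * C + 1) by positivity)
    have e1 := hKz.eventually (gt_mem_nhds hr)
    have e2 : ∀ᶠ p in atTop, ε p < 1 - |z.1| :=
      hε.eventually (gt_mem_nhds (sub_pos.2 (abs_lt.2 hzQ.1)))
    obtain ⟨p₀, hp₀⟩ := eventually_atTop.1 (e1.and e2)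
    refine ⟨p₀, fun p hp => ?_⟩
    obtain ⟨k1, k2⟩ := hp₀ p hp
    have hup := (hA p).u_mem z.1 hzQ.1 z.2 hzQ.2
    obtain ⟨a, ha, b, hb, h3, h4, h5⟩ := (hA p).H_near i z.1 hi z.2 hzQ.2 (by linarith)
    have h6 := hmod i a ha _ hup (h3.trans k1.le)
    have h7 := hmod i b hb _ hup (h4.trans k1.le)
    rw [Real.dist_eq, sub_zero, clamp_of_mem hup]
    refine (h5.trans (mul_le_mul_of_nonneg_left (add_le_add h6 h7) hC0)).trans_lt ?_
    have : C * (η / (2 * C + 1) + η / (2 * C + 1)) = η * (2 * C / (2 * C + 1)) := by ring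
    rw [this]
    exact mul_lt_of_lt_one_right hη ((div_lt_one (by positivity)).2 (by linarith))
  simpa using h2.add h1

include hA hε hc in
-- Weak times strong convergence: the gradients converge weakly in `L²`, and the test function at
-- the rounded time converges strongly.
lemma tendsto_integral_g {D : ℝ × ℝ → ℝ} (hD : Continuous D) {B : ℝ} (hB : ∀ z, |D z| ≤ B) :
    Tendsto (fun p => ∫ z in Ioo (-1 : ℝ) 1 ×ˢ Ioo 0 P.T, (A p).g z * D (z.1, (A p).fl z.2)) atTop
      (𝓝 (∫ z in Ioo (-1 : ℝ) 1 ×ˢ Ioo 0 P.T, g z * D z)) := by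
  set μ := (volume : Measure (ℝ × ℝ)).restrict (Ioo (-1 : ℝ) 1 ×ˢ Ioo 0 P.T) with hμ
  have hDm : ∀ p, Measurable fun z : ℝ × ℝ => D (z.1, (A p).fl z.2) := fun p =>
    hD.measurable.comp (measurable_fst.prodMk ((hA p).meas_fl.comp measurable_snd))
  have hgi : ∀ p, Integrable (A p).g μ := fun p => (hA p).g_memLp.integrable (by norm_num)
  have hsub : ∀ p, (∫ z, (A p).g z * D (z.1, (A p).fl z.2) ∂μ) = (∫ z, (A p).g z * D z ∂μ) +
      ∫ z, (A p).g z * (D (z.1, (A p).fl z.2) - D z) ∂μ := fun p => by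
    have i1 : Integrable (fun z => (A p).g z * D z) μ :=
      (hgi p).mul_bdd hD.aestronglyMeasurable (ae_of_all _ hB)
    have i2 : Integrable (fun z => (A p).g z * D (z.1, (A p).fl z.2)) μ :=
      (hgi p).mul_bdd (hDm p).aestronglyMeasurable (ae_of_all _ fun z => hB _)
    simp only [mul_sub]
    rw [integral_sub i2 i1]
    ring
  simp only [hsub]
  rw [← add_zero (∫ z, g z * D z ∂μ)]
  refine (hc.g_lim D (MemLp.of_bound hD.aestronglyMeasurable B (ae_of_all _ hB))).add ?_
  have hd2 : ∀ p, Integrable (fun z => (D (z.1, (A p).fl z.2) - D z) ^ 2) μ := fun p => by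
    refine Integrable.of_bound (C := (B + B) ^ 2)
      (((hDm p).sub hD.measurable).pow_const 2).aestronglyMeasurable (ae_of_all _ fun z => ?_)
    rw [Real.norm_eq_abs, abs_pow]
    exact pow_le_pow_left₀ (abs_nonneg _) ((abs_sub _ _).trans (add_le_add (hB _) (hB _))) 2
  have hlim : Tendsto (fun p => ∫ z, (D (z.1, (A p).fl z.2) - D z) ^ 2 ∂μ) atTop (𝓝 0) := by
    have := tendsto_integral_of_bounded (μ := μ)
      (F := fun p z => (D (z.1, (A p).fl z.2) - D z) ^ 2) (f := fun _ => 0)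
      (fun p => (hd2 p).aestronglyMeasurable) ((B + B) ^ 2) (fun p => ae_of_all _ fun z => by
        rw [abs_pow]
        exact pow_le_pow_left₀ (abs_nonneg _) ((abs_sub _ _).trans (add_le_add (hB _) (hB _))) 2) ?_
    · simpa using this
    · filter_upwards [ae_restrict_mem (measurableSet_Ioo.prod measurableSet_Ioo)] with z hz
      have h1 : Tendsto (fun p => D (z.1, (A p).fl z.2)) atTop (𝓝 (D z)) :=
        (hD.tendsto z).comp (tendsto_const_nhds.prodMk_nhds (tendsto_floor hA hε hz.2))
      simpa using (h1.sub_const (D z)).pow 2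
  -- Young's inequality in place of Cauchy–Schwarz: `η` absorbs the uniform bound on the gradients,
  -- then `p` is taken large.
  have hbound : ∀ η > 0, ∀ p, |∫ z, (A p).g z * (D (z.1, (A p).fl z.2) - D z) ∂μ| ≤
      η * C + (1 / η) * ∫ z, (D (z.1, (A p).fl z.2) - D z) ^ 2 ∂μ := fun η hη p => by
    have i1 : Integrable (fun z => η * (A p).g z ^ 2) μ := (hA p).g_memLp.integrable_sq.const_mul _
    have i2 := (hd2 p).const_mul (1 / η)
    rw [← Real.norm_eq_abs]
    refine (norm_integral_le_of_norm_le (i1.add i2) (ae_of_all _ fun z => ?_)).trans ?_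
    · rw [Real.norm_eq_abs, Pi.add_apply]
      set a := (A p).g z
      set b := D (z.1, (A p).fl z.2) - D z
      have e1 : η * a ^ 2 + 1 / η * b ^ 2 = ((η * a) ^ 2 + b ^ 2) / η := by field_simp
      rw [e1, le_div_iff₀ hη, ← abs_of_pos hη, ← abs_mul, abs_of_pos hη, abs_le]
      constructor <;> nlinarith [sq_nonneg (η * a + b), sq_nonneg (η * a - b), sq_nonneg (η * a),
        sq_nonneg b]
    · simp only [Pi.add_apply]
      rw [integral_add i1 i2, integral_const_mul, integral_const_mul]
      have := mul_le_mul_of_nonneg_left (hA p).integral_g_sq_le hη.le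
      linarith
  have hC0 : 0 ≤ C := (integral_nonneg fun z => sq_nonneg _).trans (hA 0).integral_g_sq_le
  rw [Metric.tendsto_atTop]
  intro η hη
  have hη' : 0 < η / (2 * (C + 1)) := by positivity
  have hev : ∀ᶠ p in atTop, (1 / (η / (2 * (C + 1)))) * ∫ z, (D (z.1, (A p).fl z.2) - D z) ^ 2 ∂μ <
      η / 2 := by
    refine Tendsto.eventually (f := fun p => _) ?_ (gt_mem_nhds (half_pos hη))
    simpa using hlim.const_mul (1 / (η / (2 * (C + 1))))
  obtain ⟨p₀, hp₀⟩ := eventually_atTop.1 hev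
  refine ⟨p₀, fun p hp => ?_⟩
  rw [Real.dist_eq, sub_zero]
  have h1 := hbound _ hη' p
  have h2 := hp₀ p hp
  have h3 : η / (2 * (C + 1)) * C ≤ η / 2 := by
    have : η / (2 * (C + 1)) * C = η / 2 * (C / (C + 1)) := by field_simp
    rw [this]
    exact mul_le_of_le_one_right (by positivity) ((div_le_one (by positivity)).2 (by linarith))
  linarith

end Converges
end Problem
end TwoPhase
namespace TwoPhase
namespace Problem

variable {P : Problem} (hP : P.Admissible) {C : ℝ} {ε : ℕ → ℝ} {A : ℕ → Approx}
  (hA : ∀ p, P.IsApprox C (ε p) (A p)) (hε : Tendsto ε atTop (𝓝 0)) {u g : ℝ × ℝ → ℝ}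
  {tl tr : Fin 2 → ℝ → ℝ} (hc : P.Converges ε A u g tl tr)

include hP in
lemma Admissible.exists_fluxAt_bound : ∃ Cf, ∀ x s, |P.fluxAt x s| ≤ Cf := by
  obtain ⟨C0, -, h0⟩ := exists_abs_le_of_continuousOn (hP.f_cont 0)
  obtain ⟨C1, -, h1⟩ := exists_abs_le_of_continuousOn (hP.f_cont 1)
  refine ⟨max C0 C1, fun x s => ?_⟩
  unfold fluxAt
  split_ifs
  exacts [(h0 _ (clamp_mem s)).trans (le_max_left _ _),
    (h1 _ (clamp_mem s)).trans (le_max_right _ _)]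

include hP in
lemma Admissible.tendsto_integral_boundary {i : Fin 2} {a b : ℕ → ℝ → ℝ} {α β : ℝ → ℝ}
    (ha : ∀ p, Measurable (a p)) (hb : ∀ p, Measurable (b p))
    (ham : ∀ p, ∀ t ∈ Ioo 0 P.T, a p t ∈ Icc (0 : ℝ) 1)
    (hbm : ∀ p, ∀ t ∈ Ioo 0 P.T, b p t ∈ Icc (0 : ℝ) 1)
    (hα : ∀ᵐ t ∂volume.restrict (Ioo 0 P.T), α t ∈ Icc (0 : ℝ) 1)
    (hβ : ∀ᵐ t ∂volume.restrict (Ioo 0 P.T), β t ∈ Icc (0 : ℝ) 1)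
    (hal : ∀ᵐ t ∂volume.restrict (Ioo 0 P.T), Tendsto (fun p => a p t) atTop (𝓝 (α t)))
    (hbl : ∀ᵐ t ∂volume.restrict (Ioo 0 P.T), Tendsto (fun p => b p t) atTop (𝓝 (β t)))
    {fl : ℕ → ℝ → ℝ} (hfm : ∀ p, Measurable (fl p))
    (hfl : ∀ t ∈ Ioo 0 P.T, Tendsto (fun p => fl p t) atTop (𝓝 t))
    {ψ : ℝ × ℝ → ℝ} (hψ : Continuous ψ) {B : ℝ} (hB : ∀ z, |ψ z| ≤ B) (x : ℝ) :
    Tendsto (fun p => ∫ t in Ioo 0 P.T, P.G i (a p t) (b p t) * ψ (x, fl p t)) atTop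
      (𝓝 (∫ t in Ioo 0 P.T, P.G i (α t) (β t) * ψ (x, t))) := by
  obtain ⟨CG, -, hCG⟩ := hP.exists_G_bound
  have hG := hP.G_cont_clamp i
  have e1 : ∀ p, ∫ t in Ioo 0 P.T, P.G i (a p t) (b p t) * ψ (x, fl p t) =
      ∫ t in Ioo 0 P.T, P.G i (clamp (a p t)) (clamp (b p t)) * ψ (x, fl p t) := fun p =>
    setIntegral_congr_fun measurableSet_Ioo fun t ht => by
      simp only [clamp_of_mem (ham p t ht), clamp_of_mem (hbm p t ht)]
  simp only [e1]
  refine tendsto_integral_of_bounded (fun p => ?_) (CG * B) (fun p => ae_of_all _ fun t =>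
    abs_mul_le_of_le (hCG i _ (clamp_mem _) _ (clamp_mem _)) (hB _)) ?_
  · exact ((hG.measurable.comp ((ha p).prodMk (hb p))).mul
      (hψ.measurable.comp (measurable_const.prodMk (hfm p)))).aestronglyMeasurable
  · filter_upwards [hα, hβ, hal, hbl, ae_restrict_mem measurableSet_Ioo] with t h1 h2 h3 h4 ht
    have k1 := (hG.tendsto (α t, β t)).comp (h3.prodMk_nhds h4)
    simp only [clamp_of_mem h1, clamp_of_mem h2] at k1
    exact k1.mul ((hψ.tendsto (x, t)).comp (tendsto_const_nhds.prodMk_nhds (hfl t ht)))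

namespace Converges

include hP hA hε hc

/-- The limit satisfies the weak formulation. -/
lemma weak_formulation
    (hu0 : ∀ᵐ x ∂volume.restrict (Ioo (-1 : ℝ) 1), Tendsto (fun p => (A p).u0 x) atTop (𝓝 (P.u0 x)))
    (hul : ∀ᵐ t ∂volume.restrict (Ioo 0 P.T), Tendsto (fun p => (A p).bl t) atTop (𝓝 (P.ul t)))
    (hur : ∀ᵐ t ∂volume.restrict (Ioo 0 P.T), Tendsto (fun p => (A p).br t) atTop (𝓝 (P.ur t)))
    {ψ : ℝ × ℝ → ℝ} (hψ : P.IsTest ψ) :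
    (∫ z in Ioo (-1 : ℝ) 1 ×ˢ Ioo 0 P.T, P.poro z.1 * u z * deriv (fun t => ψ (z.1, t)) z.2)
    + (∫ x in Ioo (-1 : ℝ) 1, P.poro x * P.u0 x * ψ (x, 0))
    + (∫ z in Ioo (-1 : ℝ) 1 ×ˢ Ioo 0 P.T,
        (P.fluxAt z.1 (u z) - g z) * deriv (fun x => ψ (x, z.2)) z.1)
    + (∫ t in Ioo 0 P.T, P.G 0 (P.ul t) (tl 0 t) * ψ (-1, t))
    - (∫ t in Ioo 0 P.T, P.G 1 (tr 1 t) (P.ur t) * ψ (1, t)) = 0 := by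
  obtain ⟨hψ1, hψ2, -⟩ := id hψ
  obtain ⟨B, hB⟩ := hψ2.exists_bound_of_continuous hψ1.continuous
  obtain ⟨Bx, hBx⟩ := exists_bound_fderiv_apply hψ1 hψ2 (1, 0)
  obtain ⟨Bt, hBt⟩ := exists_bound_fderiv_apply hψ1 hψ2 (0, 1)
  have hDx := continuous_fderiv_apply hψ1 (1, 0)
  have hDt := continuous_fderiv_apply hψ1 (0, 1)
  have hQ : MeasurableSet (Ioo (-1 : ℝ) 1 ×ˢ Ioo 0 P.T) := measurableSet_Ioo.prod measurableSet_Ioo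
  have hfl := fun t (ht : t ∈ Ioo 0 P.T) => tendsto_floor hA hε ht
  have hporo : Measurable fun z : ℝ × ℝ => P.poro z.1 := P.measurable_poro.comp measurable_fst
  have hDm : ∀ p, Measurable fun z : ℝ × ℝ => fderiv ℝ ψ (z.1, (A p).fl z.2) (1, 0) := fun p =>
    hDx.measurable.comp (measurable_fst.prodMk ((hA p).meas_fl.comp measurable_snd))
  simp only [(hasDerivAt_snd hψ1 _ _).deriv, (hasDerivAt_fst hψ1 _ _).deriv]
  have l1 : Tendsto (fun p => ∫ z in Ioo (-1 : ℝ) 1 ×ˢ Ioo 0 P.T,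
      P.poro z.1 * (A p).u z * fderiv ℝ ψ (z.1, z.2) (0, 1)) atTop
      (𝓝 (∫ z in Ioo (-1 : ℝ) 1 ×ˢ Ioo 0 P.T,
        P.poro z.1 * u z * fderiv ℝ ψ (z.1, z.2) (0, 1))) := by
    refine tendsto_integral_of_bounded (fun p => ((hporo.mul (hA p).meas_u).mul
      hDt.measurable).aestronglyMeasurable) (1 * 1 * Bt) (fun p => ?_) ?_
    · filter_upwards [ae_restrict_mem hQ] with z hz
      exact abs_mul_le_of_le (abs_mul_le_of_le (hP.abs_poro_le _)
        (abs_le_one_of_mem ((hA p).u_mem z.1 hz.1 z.2 hz.2))) (hBt _)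
    · filter_upwards [hc.u_lim] with z hz
      exact (hz.const_mul _).mul_const _
  have l2 : Tendsto (fun p => ∫ x in Ioo (-1 : ℝ) 1, P.poro x * (A p).u0 x * ψ (x, 0)) atTop
      (𝓝 (∫ x in Ioo (-1 : ℝ) 1, P.poro x * P.u0 x * ψ (x, 0))) := by
    refine tendsto_integral_of_bounded (fun p => ((P.measurable_poro.mul (hA p).meas_u0).mul
      (hψ1.continuous.measurable.comp measurable_prodMk_right)).aestronglyMeasurable)
      (1 * 1 * B) (fun p => ?_) ?_
    · filter_upwards [ae_restrict_mem measurableSet_Ioo] with x hx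
      exact abs_mul_le_of_le (abs_mul_le_of_le (hP.abs_poro_le _)
        (abs_le_one_of_mem ((hA p).u0_mem x hx))) (hB _)
    · filter_upwards [hu0] with x hx
      exact (hx.const_mul _).mul_const _
  have l3 : Tendsto (fun p => ∫ z in Ioo (-1 : ℝ) 1 ×ˢ Ioo 0 P.T,
      (A p).H z * fderiv ℝ ψ (z.1, (A p).fl z.2) (1, 0)) atTop
      (𝓝 (∫ z in Ioo (-1 : ℝ) 1 ×ˢ Ioo 0 P.T,
        P.fluxAt z.1 (u z) * fderiv ℝ ψ (z.1, z.2) (1, 0))) := by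
    refine tendsto_integral_of_bounded (fun p => ((hA p).meas_H.mul
      (hDm p)).aestronglyMeasurable) (C * Bx) (fun p => ?_) ?_
    · filter_upwards [ae_restrict_mem hQ] with z hz
      exact abs_mul_le_of_le ((hA p).abs_H_le z.1 hz.1 z.2 hz.2) (hBx _)
    · filter_upwards [hc.flux_lim hP hA hε, ae_restrict_mem hQ] with z hz hzQ
      exact hz.mul ((hDx.tendsto (z.1, z.2)).comp
        (tendsto_const_nhds.prodMk_nhds (hfl z.2 hzQ.2)))
  have l4 := hc.tendsto_integral_g hA hε hDx hBx
  have l5 := hP.tendsto_integral_boundary (i := 0) (fun p => (hA p).meas_bl)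
    (fun p => (hA p).meas_tl 0) (fun p => (hA p).bl_mem) (fun p => (hA p).tl_mem 0) hP.ul_mem
    (ae_of_all _ (hc.tl_mem 0)) hul (hc.trace_lim.mono fun t ht => (ht 0).1)
    (fun p => (hA p).meas_fl) hfl hψ1.continuous hB (-1)
  have l6 := hP.tendsto_integral_boundary (i := 1) (fun p => (hA p).meas_tr 1)
    (fun p => (hA p).meas_br) (fun p => (hA p).tr_mem 1) (fun p => (hA p).br_mem)
    (ae_of_all _ (hc.tr_mem 1)) hP.ur_mem (hc.trace_lim.mono fun t ht => (ht 1).2) hur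
    (fun p => (hA p).meas_fl) hfl hψ1.continuous hB 1
  have i1 : ∀ p, IntegrableOn (fun z : ℝ × ℝ => (A p).H z * fderiv ℝ ψ (z.1, (A p).fl z.2) (1, 0))
      (Ioo (-1 : ℝ) 1 ×ˢ Ioo 0 P.T) := fun p =>
    integrableOn_cylinder ((hA p).meas_H.mul (hDm p)).aestronglyMeasurable
      fun x hx t ht => abs_mul_le_of_le ((hA p).abs_H_le x hx t ht) (hBx _)
  have i2 : ∀ p, IntegrableOn (fun z : ℝ × ℝ => (A p).g z * fderiv ℝ ψ (z.1, (A p).fl z.2) (1, 0))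
      (Ioo (-1 : ℝ) 1 ×ˢ Ioo 0 P.T) := fun p =>
    ((hA p).g_memLp.integrable (by norm_num)).mul_bdd (hDm p).aestronglyMeasurable
      (ae_of_all _ fun z => hBx _)
  obtain ⟨Cf, hCf⟩ := hP.exists_fluxAt_bound
  have i3 : IntegrableOn (fun z : ℝ × ℝ => P.fluxAt z.1 (u z) * fderiv ℝ ψ (z.1, z.2) (1, 0))
      (Ioo (-1 : ℝ) 1 ×ˢ Ioo 0 P.T) :=
    integrableOn_cylinder ((hP.measurable_fluxAt hc.meas_u).mul hDx.measurable).aestronglyMeasurable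
      fun x _ t _ => abs_mul_le_of_le (hCf _ _) (hBx _)
  have i4 : IntegrableOn (fun z : ℝ × ℝ => g z * fderiv ℝ ψ (z.1, z.2) (1, 0))
      (Ioo (-1 : ℝ) 1 ×ˢ Ioo 0 P.T) :=
    (hc.g_memLp.integrable (by norm_num)).mul_bdd hDx.aestronglyMeasurable
      (ae_of_all _ fun z => hBx _)
  have hlim := (((l1.add l2).add (l3.sub l4)).add l5).sub l6
  simp only [sub_mul]
  rw [integral_sub i3 i4]
  -- The discrete formulation is exactly zero for every `p`, so its limit is zero.
  refine tendsto_nhds_unique hlim (tendsto_const_nhds.congr fun p => ?_)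
  have h := (hA p).weak ψ hψ
  simp only [(hasDerivAt_snd hψ1 _ _).deriv, (hasDerivAt_fst hψ1 _ _).deriv, sub_mul] at h
  rw [integral_sub (i1 p) (i2 p)] at h
  exact h.symm

/-- The limit is a weak solution. -/
theorem isWeakSolution
    (hu0 : ∀ᵐ x ∂volume.restrict (Ioo (-1 : ℝ) 1), Tendsto (fun p => (A p).u0 x) atTop (𝓝 (P.u0 x)))
    (hul : ∀ᵐ t ∂volume.restrict (Ioo 0 P.T), Tendsto (fun p => (A p).bl t) atTop (𝓝 (P.ul t)))
    (hur : ∀ᵐ t ∂volume.restrict (Ioo 0 P.T), Tendsto (fun p => (A p).br t) atTop (𝓝 (P.ur t))) :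
    P.IsWeakSolution u := by
  -- At `x = 0` the traces are the right one of the first layer and the left one of the second. One
  -- function `g` on the whole cylinder serves both layers.
  refine ⟨hc.meas_u.aestronglyMeasurable, ae_of_all _ hc.u_mem, fun _ => g, ![tr 0, tl 1], tl 0,
    tr 1, hc.memL2H1 hP hA hε, ?_, ?_, ?_, ?_, fun ψ hψ => ?_⟩
  · intro i
    fin_cases i
    · simpa [left] using (hc.hasTrace hP hA hε 0).2
    · simpa [left] using (hc.hasTrace hP hA hε 1).1
  · simpa [left] using (hc.hasTrace hP hA hε 0).1
  · simpa [left] using (hc.hasTrace hP hA hε 1).2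
  · simpa using hc.ae_compat hP hA
  obtain ⟨hψ1, hψ2, -⟩ := id hψ
  obtain ⟨B, hB⟩ := hψ2.exists_bound_of_continuous hψ1.continuous
  obtain ⟨Bx, hBx⟩ := exists_bound_fderiv_apply hψ1 hψ2 (1, 0)
  obtain ⟨Bt, hBt⟩ := exists_bound_fderiv_apply hψ1 hψ2 (0, 1)
  have hDx := continuous_fderiv_apply hψ1 (1, 0)
  have hDt := continuous_fderiv_apply hψ1 (0, 1)
  have h := hc.weak_formulation hP hA hε hu0 hul hur hψ
  simp only [(hasDerivAt_snd hψ1 _ _).deriv, (hasDerivAt_fst hψ1 _ _).deriv] at h ⊢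
  have i1 : IntegrableOn (fun z : ℝ × ℝ => P.poro z.1 * u z * fderiv ℝ ψ (z.1, z.2) (0, 1))
      (Ioo (-1 : ℝ) 1 ×ˢ Ioo 0 P.T) :=
    integrableOn_cylinder (((P.measurable_poro.comp measurable_fst).mul hc.meas_u).mul
      hDt.measurable).aestronglyMeasurable fun x _ t _ =>
      abs_mul_le_of_le (abs_mul_le_of_le (hP.abs_poro_le x) (abs_le_one_of_mem (hc.u_mem (x, t))))
        (hBt (x, t))
  have i2 : IntegrableOn (fun x : ℝ => P.poro x * P.u0 x * ψ (x, 0)) (Ioo (-1 : ℝ) 1) := by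
    refine Integrable.of_bound (C := 1 * 1 * B)
      ((P.measurable_poro.aestronglyMeasurable.mul hP.u0_meas).mul
        (hψ1.continuous.comp (by fun_prop : Continuous fun x : ℝ => (x, (0 : ℝ)))).aestronglyMeasurable)
      ?_
    filter_upwards [hP.u0_mem] with x hx
    exact abs_mul_le_of_le (abs_mul_le_of_le (hP.abs_poro_le x) (abs_le_one_of_mem hx)) (hB _)
  have i3 : IntegrableOn (fun z : ℝ × ℝ => (P.fluxAt z.1 (u z) - g z) * fderiv ℝ ψ (z.1, z.2) (1, 0))
      (Ioo (-1 : ℝ) 1 ×ˢ Ioo 0 P.T) := by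
    obtain ⟨Cf, hCf⟩ := hP.exists_fluxAt_bound
    refine Integrable.mul_bdd (c := Bx) (Integrable.sub ?_ (hc.g_memLp.integrable (by norm_num)))
      hDx.aestronglyMeasurable (ae_of_all _ fun z => hBx _)
    exact integrableOn_cylinder (hP.measurable_fluxAt hc.meas_u).aestronglyMeasurable
      fun x _ t _ => hCf _ _
  rw [integral_cylinder_eq_sum_dom i1, integral_eq_sum_dom i2, integral_cylinder_eq_sum_dom i3] at h
  have s1 : ∀ i, ∫ z in dom i ×ˢ Ioo 0 P.T, P.poro z.1 * u z * fderiv ℝ ψ (z.1, z.2) (0, 1) =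
      ∫ z in dom i ×ˢ Ioo 0 P.T, (P.layer i).poro * u z * fderiv ℝ ψ (z.1, z.2) (0, 1) := fun i =>
    setIntegral_congr_fun ((measurableSet_dom i).prod measurableSet_Ioo) fun z hz => by
      simp only [poro_eq hz.1]
  have s2 : ∀ i, ∫ x in dom i, P.poro x * P.u0 x * ψ (x, 0) =
      ∫ x in dom i, (P.layer i).poro * P.u0 x * ψ (x, 0) := fun i =>
    setIntegral_congr_fun (measurableSet_dom i) fun x hx => by simp only [poro_eq hx]
  have s3 : ∀ i, ∫ z in dom i ×ˢ Ioo 0 P.T,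
      (P.fluxAt z.1 (u z) - g z) * fderiv ℝ ψ (z.1, z.2) (1, 0) =
      ∫ z in dom i ×ˢ Ioo 0 P.T, (P.f i (u z) - g z) * fderiv ℝ ψ (z.1, z.2) (1, 0) := fun i =>
    setIntegral_congr_fun ((measurableSet_dom i).prod measurableSet_Ioo) fun z hz => by
      simp only [fluxAt_eq hz.1 (hc.u_mem z)]
  simpa only [s1, s2, s3] using h

end Converges
end Problem
end TwoPhase
-- Convergence of the data and conclusion.
namespace TwoPhase

/-- Bounded almost everywhere convergence implies convergence in `L^r`. -/
lemma tendsto_eLpNorm_of_ae_tendsto {α : Type*} [MeasurableSpace α] {μ : Measure α}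
    [IsFiniteMeasure μ] {f : ℕ → α → ℝ} {g : α → ℝ} (hf : ∀ p, AEStronglyMeasurable (f p) μ)
    (hg : AEStronglyMeasurable g μ) {B : ℝ} (hB : ∀ p, ∀ᵐ x ∂μ, |f p x - g x| ≤ B)
    (hlim : ∀ᵐ x ∂μ, Tendsto (fun p => f p x) atTop (𝓝 (g x))) {r : ℝ≥0∞} (hr : 1 ≤ r)
    (hr' : r ≠ ⊤) : Tendsto (fun p => eLpNorm (fun x => f p x - g x) r μ) atTop (𝓝 0) := by
  have hr0 : r ≠ 0 := (zero_lt_one.trans_le hr).ne'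
  have hpos : 0 < r.toReal := ENNReal.toReal_pos hr0 hr'
  simp only [eLpNorm_eq_lintegral_rpow_enorm_toReal hr0 hr']
  have h1 : Tendsto (fun p => ∫⁻ x, ‖f p x - g x‖ₑ ^ r.toReal ∂μ) atTop
      (𝓝 (∫⁻ _, (0 : ℝ≥0∞) ∂μ)) := by
    refine tendsto_lintegral_of_dominated_convergence' (fun _ => ENNReal.ofReal B ^ r.toReal)
      (fun p => ((hf p).sub hg).enorm.pow_const _) (fun p => ?_) ?_ ?_
    · filter_upwards [hB p] with x hx
      refine ENNReal.rpow_le_rpow ?_ hpos.le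
      rw [Real.enorm_eq_ofReal_abs]
      exact ENNReal.ofReal_le_ofReal hx
    · rw [lintegral_const]
      exact ENNReal.mul_ne_top (ENNReal.rpow_ne_top_of_nonneg hpos.le ENNReal.ofReal_ne_top)
        (measure_ne_top _ _)
    · filter_upwards [hlim] with x hx
      have h2 : Tendsto (fun p => f p x - g x) atTop (𝓝 0) := by simpa using hx.sub_const (g x)
      have h3 := (h2.enorm).ennrpow_const r.toReal
      rwa [enorm_zero, ENNReal.zero_rpow_of_pos hpos] at h3
  have h2 := h1.ennrpow_const (1 / r.toReal)
  rwa [lintegral_zero, ENNReal.zero_rpow_of_pos (one_div_pos.2 hpos)] at h2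

lemma integrableOn_of_ae_mem {f : ℝ → ℝ} {a b : ℝ}
    (hf : AEStronglyMeasurable f (volume.restrict (Ioo a b)))
    (hm : ∀ᵐ x ∂volume.restrict (Ioo a b), f x ∈ Icc (0 : ℝ) 1) : IntegrableOn f (Ioo a b) :=
  Integrable.of_bound (C := 1) hf (hm.mono fun _ hx => abs_le_one_of_mem hx)

namespace Problem

lemma tendsto_dx {N : ℕ → ℕ} (hN : Tendsto N atTop atTop) :
    Tendsto (fun p => dx (N p)) atTop (𝓝 0) :=
  tendsto_one_div_atTop_nhds_zero_nat.comp hN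

variable {P : Problem}

lemma tendsto_dt {M : ℕ → ℕ} (hM : Tendsto M atTop atTop) :
    Tendsto (fun p => P.dt (M p)) atTop (𝓝 0) :=
  (tendsto_const_div_atTop_nhds_zero_nat P.T).comp hM

namespace Admissible

variable (hP : P.Admissible)
include hP

/-- The cell that contains `x` shrinks to `x`, so the cell means converge at Lebesgue points of the
initial datum. The boundary data are treated in the same way with time steps. -/
lemma ae_tendsto_u0 {N M : ℕ → ℕ} (hN : ∀ p, 0 < N p) (hlim : Tendsto N atTop atTop)
    {w : ℕ → Unknowns} (hw : ∀ p, P.IsSchemeSolution (N p) (M p) (w p)) :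
    ∀ᵐ x ∂volume.restrict (Ioo (-1 : ℝ) 1),
      Tendsto (fun p => (w p).cell 0 ⌊x / dx (N p)⌋) atTop (𝓝 (P.u0 x)) := by
  filter_upwards [ae_tendsto_interval_mean isOpen_Ioo (integrableOn_of_ae_mem hP.u0_meas hP.u0_mem),
    ae_restrict_mem measurableSet_Ioo] with x hx hxm
  have hd := fun p => dx_pos (hN p)
  have hsub : ∀ p, ((⌊x / dx (N p)⌋ : ℝ) + 1) * dx (N p) - ⌊x / dx (N p)⌋ * dx (N p) = dx (N p) :=
    fun p => by ring
  have hfl := fun p => floor_mem (hN p) (Ioo_subset_Ico_self hxm)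
  have h := hx (fun p => ⌊x / dx (N p)⌋ * dx (N p)) (fun p => (⌊x / dx (N p)⌋ + 1) * dx (N p))
    (fun p => by nlinarith [hd p]) (fun p => ⟨?_, ?_⟩) (fun p => ?_)
    (by simpa only [hsub] using tendsto_dx hlim)
  · refine h.congr fun p => ?_
    rw [(hw p).initial _ (hfl p).1 (hfl p).2, u0Mean, hsub]
  · exact (le_div_iff₀ (hd p)).1 (Int.floor_le _)
  · exact ((div_lt_iff₀ (hd p)).1 (Int.lt_floor_add_one _)).le
  · have e : (N p : ℝ) * dx (N p) = 1 := mul_dx _ (hN p)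
    have h1 : (-(N p : ℝ)) ≤ ⌊x / dx (N p)⌋ := by exact_mod_cast (hfl p).1
    have h2 : (⌊x / dx (N p)⌋ : ℝ) + 1 ≤ N p := by exact_mod_cast Int.add_one_le_iff.2 (hfl p).2
    refine Ioo_subset_Ioo ?_ ?_ <;> nlinarith [hd p]

omit hP in
lemma ae_tendsto_time_mean {f : ℝ → ℝ} (hf : IntegrableOn f (Ioo 0 P.T)) (hP : P.Admissible)
    {M : ℕ → ℕ} (hM : ∀ p, 0 < M p) (hlim : Tendsto M atTop atTop) :
    ∀ᵐ t ∂volume.restrict (Ioo 0 P.T), Tendsto (fun p => 1 / P.dt (M p) *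
      ∫ s in (P.lev (M p) t * P.dt (M p))..((P.lev (M p) t + 1) * P.dt (M p)), f s) atTop
      (𝓝 (f t)) := by
  filter_upwards [ae_tendsto_interval_mean isOpen_Ioo hf, ae_restrict_mem measurableSet_Ioo]
    with t ht htm
  have hd := fun p => hP.dt_pos (hM p)
  have hsub : ∀ p, ((P.lev (M p) t : ℝ) + 1) * P.dt (M p) - P.lev (M p) t * P.dt (M p) =
      P.dt (M p) := fun p => by ring
  have hl := fun p => hP.lev_lt (hM p) htm
  have h := ht (fun p => P.lev (M p) t * P.dt (M p)) (fun p => (P.lev (M p) t + 1) * P.dt (M p))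
    (fun p => by nlinarith [hd p]) (fun p => Ioc_subset_Icc_self (hl p).2.1)
    (fun p => hP.time_subset (hM p) (hl p).1) (by simpa only [hsub] using tendsto_dt hlim)
  simpa only [hsub] using h

/-- Convergence of the scheme along a subsequence. -/
theorem exists_subseq_tendsto_weakSolution {N M : ℕ → ℕ} (hN : ∀ p, 0 < N p) (hM : ∀ p, 0 < M p)
    (hN_lim : Tendsto N atTop atTop) (hM_lim : Tendsto M atTop atTop) {w : ℕ → Unknowns}
    (hw : ∀ p, P.IsSchemeSolution (N p) (M p) (w p)) :
    ∃ (σ : ℕ → ℕ) (u : ℝ × ℝ → ℝ), StrictMono σ ∧ P.IsWeakSolution u ∧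
      ∀ r : ℝ≥0∞, 1 ≤ r → r ≠ ⊤ → Tendsto (fun p => eLpNorm
        (fun z => P.reconstruct (N (σ p)) (M (σ p)) (w (σ p)) z - u z) r
        (volume.restrict (Ioo (-1 : ℝ) 1 ×ˢ Ioo 0 P.T))) atTop (𝓝 0) := by
  obtain ⟨C, -, hC⟩ := hP.exists_isApprox
  have hA := fun p => hC (N p) (M p) (w p) (hN p) (hM p) (hw p)
  have hε : Tendsto (fun p => 2 * √(dx (N p)) + P.dt (M p)) atTop (𝓝 0) := by
    simpa using ((tendsto_dx hN_lim).sqrt.const_mul 2).add (tendsto_dt hM_lim)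
  obtain ⟨σ, hσ, u, g, tl, tr, hc⟩ := Converges.exists hP hA hε
  have hσt := hσ.tendsto_atTop
  refine ⟨σ, u, hσ, hc.isWeakSolution hP (fun p => hA (σ p)) (hε.comp hσt) ?_ ?_ ?_,
    fun r hr hr' => ?_⟩
  · exact hP.ae_tendsto_u0 (fun p => hN (σ p)) (hN_lim.comp hσt) fun p => hw (σ p)
  · exact ae_tendsto_time_mean (integrableOn_of_ae_mem hP.ul_meas hP.ul_mem) hP
      (fun p => hM (σ p)) (hM_lim.comp hσt)
  · exact ae_tendsto_time_mean (integrableOn_of_ae_mem hP.ur_meas hP.ur_mem) hP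
      (fun p => hM (σ p)) (hM_lim.comp hσt)
  · refine tendsto_eLpNorm_of_ae_tendsto (B := 1)
      (fun p => (hA (σ p)).meas_u.aestronglyMeasurable) hc.meas_u.aestronglyMeasurable
      (fun p => ?_) hc.u_lim hr hr'
    filter_upwards [ae_restrict_mem (measurableSet_Ioo.prod measurableSet_Ioo)] with z hz
    have h1 := (hA (σ p)).u_mem z.1 hz.1 z.2 hz.2
    have h2 := hc.u_mem z
    rw [abs_le]
    constructor <;> linarith [h1.1, h1.2, h2.1, h2.2]

end Admissible
end Problem
end TwoPhase
end

theorem mainTheorem3 (P : TwoPhase.Problem) (hP : P.Admissible) (N M : ℕ → ℕ)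
    (hN : ∀ p, 0 < N p) (hM : ∀ p, 0 < M p)
    (hN_lim : Tendsto N atTop atTop) (hM_lim : Tendsto M atTop atTop) :
    (∀ p, ∃ v : ℝ × ℝ → ℝ, P.IsDiscreteSolution (N p) (M p) v) ∧
    ∀ uD : ℕ → ℝ × ℝ → ℝ, (∀ p, P.IsDiscreteSolution (N p) (M p) (uD p)) →
      ∃ (σ : ℕ → ℕ) (u : ℝ × ℝ → ℝ), StrictMono σ ∧ P.IsWeakSolution u ∧
        ∀ r : ℝ≥0∞, 1 ≤ r → r ≠ ⊤ →
          Tendsto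
            (fun p => eLpNorm (fun z => uD (σ p) z - u z) r
              (volume.restrict (Ioo (-1 : ℝ) 1 ×ˢ Ioo 0 P.T)))
            atTop (𝓝 0) := by
  refine ⟨fun p => ?_, fun uD hD => ?_⟩
  · obtain ⟨w, hw⟩ := hP.exists_schemeSolution (hN p) (hM p)
    exact ⟨_, w, hw, rfl⟩
  · choose w hw huD using hD
    simp only [huD]
    exact hP.exists_subseq_tendsto_weakSolution hN hM hN_lim hM_lim hw
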